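/- **Theorem (Exponential concentration).** Let $\Omega$ be a Polish space with its Borel $\sigma$-algebra and a probability measure $\mu$. Let $(Z_t)_{t\ge 0}$ be a time-homogeneous Markov process on $\Omega$ with stationary measure $\mu$, and let $(P_t f)(z) = \mathbb{E}[f(Z_t)\mid Z_0=z]$ be its Markov semigroup, given by the transition kernels of the process, acting on real-valued functions and on functions with values in the complex $d\times d$ matrices $\mathbb{M}_d$ ($d\ge 1$). Suppose that the semigroup is reversible, i.e. $\mathbb{E}_\mu[(P_tf)\,g]=\mathbb{E}_\mu[f\,(P_tg)]$ for all $t\ge 0$ and all $f,g\in L_2(\mu)$, and ergodic, i.e. $P_tf\to\mathbb{E}_\mu f$ in $L_2(\mu)$ as $t\to\infty$ for all $f\in L_2(\mu)$. Define the generator $(\mathcal{L}f)(z)=\lim_{t\downarrow 0}t^{-1}\big((P_tf)(z)-f(z)\big)$, the carré du champ $\Gamma(f,g)=\frac12[\mathcal{L}(fg)-f\mathcal{L}(g)-\mathcal{L}(f)g]$, the iterated carré du champ $\Gamma_2(f,g)=\frac12[\mathcal{L}\Gamma(f,g)-\Gamma(f,\mathcal{L}g)-\Gamma(\mathcal{L}f,g)]$,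 and write $\Gamma(f)=\Gamma(f,f)$, $\Gamma_2(f)=\Gamma_2(f,f)$. Fix an algebra $\mathcal{A}$ of suitable real functions on $\Omega$: a real algebra of measurable functions that contains the constants, whose members are integrable with respect to $\mu$ and to the law of $Z_t$ given $Z_0=z$ for all $t\ge0$ and $z\in\Omega$, such that for every $f\in\mathcal{A}$ the limit defining $\mathcal{L}f$ exists at every point of $\Omega$ and also holds in $L_2(\mu)$, and such that $P_tf\in\mathcal{A}$ and $\mathcal{L}f\in\mathcal{A}$ for every $f\in\mathcal{A}$ and $t\ge 0$. A function $f$ from $\Omega$ to the Hermitian matrices $\mathbb{H}_d$ is called suitable if the real and imaginary parts of its entries belong to $\mathcal{A}$. Assume that the Bakry–Émery criterion holds with a constant $c>0$: for every suitable $f:\Omega\to\mathbb{H}_d$, $\Gamma(f)\preccurlyeq c\,\Gamma_2(f)$ in the semidefinite order, $\mu$-almost everywhere. Let $f:\Omega\to\mathbb{H}_d$ be suitable, let $\operatorname{\overline{tr}}=d^{-1}\operatorname{tr}$, and put $$r_f(\beta)=\frac1\beta\log\mathbb{E}_\mu\operatorname{\overline{tr}}e^{\beta\Gamma(f)}\in[0,+\infty]\quad(\beta>0),\qquad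 v_f=\big\|\,\|\Gamma(f)\|\,\big\|_{L_\infty(\mu)}\in[0,+\infty],$$ where $\|\cdot\|$ is the $\ell_2$ operator norm. Then, for all $t\ge 0$, $$\mathbb{P}_\mu\{\lambda_{\max}(f-\mathbb{E}_\mu f)\ge t\}\le d\cdot\inf_{\beta>0}\exp\!\left(\frac{-t^2}{2c\,r_f(\beta)+2t\sqrt{c/\beta}}\right).$$ If in addition $v_f<+\infty$, then for all $t\ge 0$ $$\mathbb{P}_\mu\{\lambda_{\max}(f-\mathbb{E}_\mu f)\ge t\}\le d\cdot\exp\!\left(\frac{-t^2}{2c\,v_f}\right),$$ and $\lambda_{\max}(f-\mathbb{E}_\mu f)$ is $\mu$-integrable with $$\mathbb{E}_\mu\lambda_{\max}(f-\mathbb{E}_\mu f)\le\sqrt{2c\,v_f\log d}.$$ Likewise for the minimum eigenvalue: for all $t\ge0$, $\mathbb{P}_\mu\{\lambda_{\min}(f-\mathbb{E}_\mu f)\le -t\}$ obeys the first tail bound and, if $v_f<+\infty$, the second; and if $v_f<+\infty$, then $\lambda_{\min}(f-\mathbb{E}_\mu f)$ is $\mu$-integrable with $\mathbb{E}_\mu\lambda_{\min}(f-\mathbb{E}_\mu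 f)\ge-\sqrt{2c\,v_f\log d}$. Conventions: the exponential is $1$ when $r_f(\beta)=+\infty$ or $t=0$, and $\exp(-t^2/(2cv_f))$ is $0$ when $v_f=0$ and $t>0$. -/

import Mathlib

open MeasureTheory ProbabilityTheory Filter Topology
open scoped NNReal ENNReal Matrix Matrix.Norms.L2Operator ComplexOrder

noncomputable section

namespace MatrixMarkov

/-- A Markov semigroup on the state space `Ω`, given by the transition kernels of a
time-homogeneous Markov process `(Z_t)_{t ≥ 0}`: `kernel t z` is the law of `Z_t` conditional on
`Z_0 = z`. -/
structure MarkovSemigroup (Ω : Type*) [MeasurableSpace Ω] where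
  kernel : ℝ≥0 → Kernel Ω Ω
  isMarkovKernel : ∀ t, IsMarkovKernel (kernel t)
  kernel_zero : kernel 0 = Kernel.id
  kernel_add : ∀ s t, kernel (s + t) = kernel t ∘ₖ kernel s

namespace MarkovSemigroup

variable {Ω : Type*} [MeasurableSpace Ω]

/-! The semigroup, its generator and its carré du champ operators act on functions with values
in `E`. They are used for `E = ℝ` and for the algebra `E` of complex `d × d` matrices. -/

section Operators

variable {E : Type*} [NormedRing E] [NormedAlgebra ℝ E]

/-- `(P_t f)(z) = 𝔼[f(Z_t) | Z_0 = z]`. -/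
def act (P : MarkovSemigroup Ω) (t : ℝ≥0) (f : Ω → E) : Ω → E :=
  fun z => ∫ y, f y ∂(P.kernel t z)

/-- The difference quotient `((P_t f)(z) - f(z)) / t`. -/
def diffQuot (P : MarkovSemigroup Ω) (f : Ω → E) (t : ℝ≥0) (z : Ω) : E :=
  (t : ℝ)⁻¹ • (P.act t f z - f z)

/-- The infinitesimal generator, `(𝓛 f)(z) = lim_{t ↓ 0} ((P_t f)(z) - f(z)) / t`. -/
def generator (P : MarkovSemigroup Ω) (f : Ω → E) : Ω → E :=
  fun z => limUnder (𝓝[>] (0 : ℝ≥0)) (fun t => P.diffQuot f t z)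

/-- The carré du champ `Γ(f, g) = (1/2) [𝓛(f g) - f 𝓛(g) - 𝓛(f) g]`. -/
def gamma (P : MarkovSemigroup Ω) (f g : Ω → E) : Ω → E :=
  (1 / 2 : ℝ) • (P.generator (f * g) - f * P.generator g - P.generator f * g)

/-- The iterated carré du champ `Γ₂(f, g) = (1/2) [𝓛 Γ(f, g) - Γ(f, 𝓛(g)) - Γ(𝓛(f), g)]`. -/
def gamma₂ (P : MarkovSemigroup Ω) (f g : Ω → E) : Ω → E :=
  (1 / 2 : ℝ) • (P.generator (P.gamma f g) - P.gamma f (P.generator g)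
    - P.gamma (P.generator f) g)

end Operators

/-- `μ` is a stationary measure of the semigroup. -/
def IsStationary (P : MarkovSemigroup Ω) (μ : Measure Ω) : Prop :=
  ∀ t, Kernel.Invariant (P.kernel t) μ

/-- Reversibility: every `P_t` is a symmetric operator on `L_2(μ)`. -/
def IsReversible (P : MarkovSemigroup Ω) (μ : Measure Ω) : Prop :=
  ∀ (t : ℝ≥0) (f g : Ω → ℝ), MemLp f 2 μ → MemLp g 2 μ →
    ∫ z, P.act t f z * g z ∂μ = ∫ z, f z * P.act t g z ∂μ

/-- Ergodicity: `P_t f → 𝔼_μ f` in `L_2(μ)` as `t → ∞`, for all `f` in `L_2(μ)`. -/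
def IsErgodic (P : MarkovSemigroup Ω) (μ : Measure Ω) : Prop :=
  ∀ f : Ω → ℝ, MemLp f 2 μ →
    Tendsto (fun t : ℝ≥0 => eLpNorm (fun z => P.act t f z - ∫ y, f y ∂μ) 2 μ) atTop (𝓝 0)

/-- An algebra of suitable real functions: an algebra of measurable, `μ`-integrable functions
(hence of functions in `L_p(μ)` for every finite `p`) that contains the constants, on which
the semigroup and the generator are defined and which they leave invariant, the limit that
defines the generator being taken pointwise and in `L_2(μ)`. Functions in the algebra may be
unbounded. -/
structure IsSuitableAlgebra (P : MarkovSemigroup Ω) (μ : Measure Ω)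
    (A : Subalgebra ℝ (Ω → ℝ)) : Prop where
  measurable : ∀ f ∈ A, Measurable f
  integrable : ∀ f ∈ A, Integrable f μ
  integrable_kernel : ∀ f ∈ A, ∀ t z, Integrable f (P.kernel t z)
  act_mem : ∀ f ∈ A, ∀ t, P.act t f ∈ A
  tendsto_generator : ∀ f ∈ A, ∀ z,
    Tendsto (fun t : ℝ≥0 => P.diffQuot f t z) (𝓝[>] 0) (𝓝 (P.generator f z))
  tendsto_generator_L2 : ∀ f ∈ A,
    Tendsto (fun t : ℝ≥0 => eLpNorm (P.diffQuot f t - P.generator f) 2 μ) (𝓝[>] 0) (𝓝 0)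
  generator_mem : ∀ f ∈ A, P.generator f ∈ A

end MarkovSemigroup

section Matrices

variable {Ω : Type*} {d : ℕ}

/-- A suitable function with values in the Hermitian `d × d` matrices: the real and
imaginary parts of its entries belong to the algebra `A` of suitable real functions. -/
structure IsSuitable (A : Subalgebra ℝ (Ω → ℝ)) (f : Ω → Matrix (Fin d) (Fin d) ℂ) : Prop where
  isHermitian : ∀ z, (f z).IsHermitian
  re_mem : ∀ i j, (fun z => (f z i j).re) ∈ A
  im_mem : ∀ i j, (fun z => (f z i j).im) ∈ A

/-- The largest eigenvalue of a Hermitian matrix. -/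
def lambdaMax (M : Matrix (Fin d) (Fin d) ℂ) : ℝ := sSup (spectrum ℝ M)

/-- The smallest eigenvalue of a Hermitian matrix. -/
def lambdaMin (M : Matrix (Fin d) (Fin d) ℂ) : ℝ := sInf (spectrum ℝ M)

/-- The normalized trace `d⁻¹ tr M` (its real part, which is all of it for Hermitian `M`). -/
def normTrace (M : Matrix (Fin d) (Fin d) ℂ) : ℝ := (d : ℝ)⁻¹ * M.trace.re

variable [MeasurableSpace Ω]

/-- The centered random matrix `f - 𝔼_μ f`. -/
def centered (μ : Measure Ω) (f : Ω → Matrix (Fin d) (Fin d) ℂ) :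
    Ω → Matrix (Fin d) (Fin d) ℂ :=
  fun z => f z - ∫ y, f y ∂μ

/-- The Bakry–Émery criterion with constant `c`: `Γ(f) ≼ c Γ₂(f)` holds `μ`-almost everywhere,
for all suitable `f` with values in the Hermitian `d × d` matrices. -/
def BakryEmery (P : MarkovSemigroup Ω) (μ : Measure Ω) (A : Subalgebra ℝ (Ω → ℝ)) (d : ℕ)
    (c : ℝ) : Prop :=
  ∀ f : Ω → Matrix (Fin d) (Fin d) ℂ, IsSuitable A f →
    ∀ᵐ z ∂μ, (c • P.gamma₂ f f z - P.gamma f f z).PosSemidef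

/-- The exponential mean `r_f(β) = β⁻¹ log 𝔼_μ tr̄ exp(β Γ(f))`, which may be `+∞`. -/
def expMean (P : MarkovSemigroup Ω) (μ : Measure Ω) (f : Ω → Matrix (Fin d) (Fin d) ℂ)
    (β : ℝ) : EReal :=
  ((β⁻¹ : ℝ) : EReal) *
    ENNReal.log (∫⁻ z, ENNReal.ofReal (normTrace (NormedSpace.exp (β • P.gamma f f z))) ∂μ)

/-- The variance proxy `v_f`, the `L_∞(μ)` norm of the `ℓ_2` operator norm of `Γ(f)`. -/
def varProxy (P : MarkovSemigroup Ω) (μ : Measure Ω) (f : Ω → Matrix (Fin d) (Fin d) ℂ) :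
    ℝ≥0∞ :=
  eLpNorm (P.gamma f f) ∞ μ

/-- The bound `d · inf_{β > 0} exp(-t² / (2 c r_f(β) + 2 t √(c / β)))`. The quotient is `0` when
`r_f(β) = +∞`. -/
def expTail (P : MarkovSemigroup Ω) (μ : Measure Ω) (f : Ω → Matrix (Fin d) (Fin d) ℂ)
    (c t : ℝ) : ℝ≥0∞ :=
  (d : ℝ≥0∞) * ⨅ (β : ℝ) (_ : 0 < β),
    EReal.exp (((-t ^ 2 : ℝ) : EReal) /
      (((2 * c : ℝ) : EReal) * expMean P μ f β + ((2 * t * √(c / β) : ℝ) : EReal)))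

/-- The bound `d · exp(-t² / (2 c v_f))`. The quotient is formed in `[0, ∞]`, so that the bound is
`0` when `v_f = 0` and `t > 0`. -/
def gaussTail (P : MarkovSemigroup Ω) (μ : Measure Ω) (f : Ω → Matrix (Fin d) (Fin d) ℂ)
    (c t : ℝ) : ℝ≥0∞ :=
  (d : ℝ≥0∞) * EReal.exp
    (-((ENNReal.ofReal (t ^ 2) / (ENNReal.ofReal (2 * c) * varProxy P μ f) : ℝ≥0∞) : EReal))

end Matrices

end MatrixMarkov

end

open MatrixMarkov

/-
Centre `f` so that `E f = 0`, and let `m(θ) = E tr exp(θ f)`.  Reversibility makes `(Z₀, Z_t)` an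
exchangeable pair, so that for suitable `g` and a spectral weight `K = φ(f)` the Dirichlet form
`-E tr (𝓛 g) K` is the limit of `(2t)⁻¹ E tr (g(Z₀) - g(Z_t)) (K(Z₀) - K(Z_t))`.  Ergodicity gives
`E tr f K = -∫₀^∞ E tr 𝓛(P_t f) K dt`.  If `K = exp(θ f)`, the mean value trace inequality (expand
in eigenbases, then AM–GM with a free parameter `s`) bounds the integrand by
`θ/2 · E tr (s Γ(f) + s⁻¹ Γ(P_t f)) K`.  The Bakry–Émery criterion forces
`Γ(P_t f) ≼ e^{-2t/c} P_t Γ(f)`, and `s = e^{-t/c}` balances the two terms; integrating in `t`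
controls `m'(θ)` by `c θ E tr Γ(f) K`, up to moving `P_t` onto the weight.

If `Γ(f)` is bounded this gives `m(θ) ≤ d exp(c v_f θ² / 2)`.  In general the Gibbs variational
principle replaces `E tr Γ(f) K` by `r_f(β)` plus an entropy term, and an integrating factor solves
the resulting differential inequality.  Markov's and Jensen's inequalities then give the tail bounds
and the expectation bounds; the minimum eigenvalue is the case of `-f`.

As `exp(θ f)` need not be integrable a priori, everything is run with `K = exp(θ min(f, k))`, where
`min` acts on the spectrum.  Markov's inequality at level `t` only needs `k = t`, and in Jensen's
inequality `k → ∞`.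
-/

noncomputable section

namespace MatrixMarkov

section TraceInequalities

variable {n : Type*} [Fintype n]

/-- The real part of the trace, as a continuous linear functional. It is the whole trace on
Hermitian matrices and on products of two Hermitian matrices that commute. -/
def reTrace : Matrix n n ℂ →L[ℝ] ℝ :=
  LinearMap.toContinuousLinearMap (Complex.reLm ∘ₗ Matrix.traceLinearMap n ℝ ℂ)

lemma reTrace_apply (X : Matrix n n ℂ) : reTrace X = X.trace.re := rfl

lemma reTrace_mul_comm (X Y : Matrix n n ℂ) : reTrace (X * Y) = reTrace (Y * X) := by
  rw [reTrace_apply, reTrace_apply, Matrix.trace_mul_comm]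

lemma reTrace_conjTranspose_mul (X Y : Matrix n n ℂ) :
    reTrace (Xᴴ * Y) = ∑ i, ∑ j, (star (X i j) * Y i j).re := by
  rw [reTrace_apply, Matrix.trace, Complex.re_sum, Finset.sum_comm]
  simp only [Matrix.diag_apply, Matrix.mul_apply, Matrix.conjTranspose_apply, Complex.re_sum]

variable [DecidableEq n] {A B X Y : Matrix n n ℂ} (hA : A.IsHermitian) (hB : B.IsHermitian)

/-- The matrix of the operator `X` with respect to an orthonormal eigenbasis of `B` in the source
and an orthonormal eigenbasis of `A` in the target. Functions of `A` and of `B` act on it from the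
left and from the right by diagonal matrices, which reduces trace inequalities to inequalities
between scalars. -/
def eigenCoord (X : Matrix n n ℂ) : Matrix n n ℂ :=
  star (hA.eigenvectorUnitary : Matrix n n ℂ) * X * hB.eigenvectorUnitary

lemma eigenCoord_sub : eigenCoord hA hB (X - Y) = eigenCoord hA hB X - eigenCoord hA hB Y := by
  simp only [eigenCoord, mul_sub, sub_mul]

lemma eigenCoord_cfc_mul (φ : ℝ → ℝ) (X : Matrix n n ℂ) (i j : n) :
    eigenCoord hA hB (cfc φ A * X) i j = φ (hA.eigenvalues i) * eigenCoord hA hB X i j := by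
  have h : eigenCoord hA hB (cfc φ A * X)
      = Matrix.diagonal (fun i => (φ (hA.eigenvalues i) : ℂ)) * eigenCoord hA hB X := by
    rw [hA.cfc_eq, Matrix.IsHermitian.cfc, Unitary.conjStarAlgAut_apply, eigenCoord, eigenCoord]
    simp only [← mul_assoc, Unitary.coe_star_mul_self, one_mul]
    rfl
  rw [h, Matrix.diagonal_mul]

lemma eigenCoord_mul_cfc (φ : ℝ → ℝ) (X : Matrix n n ℂ) (i j : n) :
    eigenCoord hA hB (X * cfc φ B) i j = φ (hB.eigenvalues j) * eigenCoord hA hB X i j := by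
  have h : eigenCoord hA hB (X * cfc φ B)
      = eigenCoord hA hB X * Matrix.diagonal (fun j => (φ (hB.eigenvalues j) : ℂ)) := by
    rw [hB.cfc_eq, Matrix.IsHermitian.cfc, Unitary.conjStarAlgAut_apply, eigenCoord, eigenCoord]
    simp only [mul_assoc, Unitary.coe_star_mul_self, mul_one]
    rfl
  rw [h, Matrix.mul_diagonal, mul_comm]

lemma eigenCoord_cfc_left (φ : ℝ → ℝ) (i j : n) :
    eigenCoord hA hB (cfc φ A) i j = φ (hA.eigenvalues i) * eigenCoord hA hB 1 i j := by
  rw [← eigenCoord_cfc_mul, mul_one]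

lemma eigenCoord_cfc_right (φ : ℝ → ℝ) (i j : n) :
    eigenCoord hA hB (cfc φ B) i j = φ (hB.eigenvalues j) * eigenCoord hA hB 1 i j := by
  rw [← eigenCoord_mul_cfc, one_mul]

/-- Parseval's identity for the Hilbert–Schmidt inner product. -/
lemma reTrace_conjTranspose_mul_eq_sum_eigenCoord (X Y : Matrix n n ℂ) :
    reTrace (Xᴴ * Y)
      = ∑ i, ∑ j, (star (eigenCoord hA hB X i j) * eigenCoord hA hB Y i j).re := by
  rw [← reTrace_conjTranspose_mul]
  set U : Matrix n n ℂ := hA.eigenvectorUnitary.1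
  set V : Matrix n n ℂ := hB.eigenvectorUnitary.1
  have hU : U * star U = 1 := Unitary.coe_mul_star_self _
  have hV : V * star V = 1 := Unitary.coe_mul_star_self _
  have h : (eigenCoord hA hB X)ᴴ * eigenCoord hA hB Y
      = star V * (Xᴴ * (U * star U) * Y * V) := by
    simp only [eigenCoord, ← Matrix.star_eq_conjTranspose, star_mul, star_star, Matrix.mul_assoc,
      U, V]
  rw [h, hU, mul_one, reTrace_mul_comm (star V), mul_assoc (Xᴴ * Y), hV, mul_one]

lemma reTrace_cfc_mul_cfc (φ ψ : ℝ → ℝ) :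
    reTrace (cfc φ A * cfc ψ B) = ∑ i, ∑ j,
      φ (hA.eigenvalues i) * ψ (hB.eigenvalues j) * ‖eigenCoord hA hB 1 i j‖ ^ 2 := by
  have hφ : (cfc φ A)ᴴ = cfc φ A := cfc_predicate φ A
  rw [← hφ, reTrace_conjTranspose_mul_eq_sum_eigenCoord hA hB]
  refine Finset.sum_congr rfl fun i _ => Finset.sum_congr rfl fun j _ => ?_
  rw [eigenCoord_cfc_left, eigenCoord_cfc_right, ← Complex.normSq_eq_norm_sq,
    ← Complex.ofReal_re (_ * _), star_mul']
  congr 1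
  push_cast
  rw [Complex.normSq_eq_conj_mul_self, Complex.star_def, Complex.conj_ofReal]
  ring

lemma reTrace_cfc (φ : ℝ → ℝ) : reTrace (cfc φ A) = ∑ i, φ (hA.eigenvalues i) := by
  rw [hA.cfc_eq, Matrix.IsHermitian.cfc, Unitary.conjStarAlgAut_apply, reTrace_mul_comm,
    ← Matrix.mul_assoc, Unitary.coe_star_mul_self, Matrix.one_mul, reTrace_apply,
    Matrix.trace_diagonal]
  simp

lemma reTrace_cfc_left (φ : ℝ → ℝ) :
    reTrace (cfc φ A)
      = ∑ i, ∑ j, φ (hA.eigenvalues i) * ‖eigenCoord hA hB 1 i j‖ ^ 2 := by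
  simpa [cfc_const_one ℝ B hB.isSelfAdjoint] using reTrace_cfc_mul_cfc hA hB φ fun _ => 1

lemma reTrace_cfc_right (φ : ℝ → ℝ) :
    reTrace (cfc φ B)
      = ∑ i, ∑ j, φ (hB.eigenvalues j) * ‖eigenCoord hA hB 1 i j‖ ^ 2 := by
  simpa [cfc_const_one ℝ A hA.isSelfAdjoint] using reTrace_cfc_mul_cfc hA hB (fun _ => 1) φ

include hA hB in
lemma reTrace_cfc_mul_cfc_nonneg {φ ψ : ℝ → ℝ} (hφ : ∀ i, 0 ≤ φ (hA.eigenvalues i))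
    (hψ : ∀ x, 0 ≤ ψ x) : 0 ≤ reTrace (cfc φ A * cfc ψ B) := by
  rw [reTrace_cfc_mul_cfc hA hB]
  exact Finset.sum_nonneg fun i _ => Finset.sum_nonneg fun j _ =>
    mul_nonneg (mul_nonneg (hφ i) (hψ _)) (sq_nonneg _)

omit hA in
include hB in
lemma reTrace_mul_cfc_nonneg (hA : A.PosSemidef) {φ : ℝ → ℝ} (hφ : ∀ x, 0 ≤ φ x) :
    0 ≤ reTrace (A * cfc φ B) := by
  conv_rhs => rw [← cfc_id ℝ A hA.isHermitian.isSelfAdjoint]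
  exact reTrace_cfc_mul_cfc_nonneg hA.isHermitian hB hA.eigenvalues_nonneg hφ

omit hB in
include hA in
lemma reTrace_cfc_mono {φ ψ : ℝ → ℝ} (h : ∀ x, φ x ≤ ψ x) :
    reTrace (cfc φ A) ≤ reTrace (cfc ψ A) := by
  rw [reTrace_cfc hA, reTrace_cfc hA]
  exact Finset.sum_le_sum fun i _ => h _

include hA hB in
/-- The Gibbs variational inequality: `a eʰ ≤ (h - b - 1) eʰ + eᵇ eᵃ`, lifted to matrices. -/
lemma reTrace_mul_cfc_exp_le (ψ : ℝ → ℝ) (b : ℝ) :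
    reTrace (A * cfc (fun x => Real.exp (ψ x)) B) ≤
      reTrace (cfc (fun x => (ψ x - b - 1) * Real.exp (ψ x)) B)
        + Real.exp b * reTrace (cfc Real.exp A) := by
  have scalar (a h : ℝ) :
      a * Real.exp h ≤ (h - b - 1) * Real.exp h + Real.exp b * Real.exp a := by
    have := Real.add_one_le_exp (b + a - h)
    rw [Real.exp_sub, Real.exp_add, le_div_iff₀ (Real.exp_pos h)] at this
    linarith
  conv_lhs => rw [← cfc_id ℝ A hA.isSelfAdjoint]
  rw [reTrace_cfc_mul_cfc hA hB, reTrace_cfc_right hA hB, reTrace_cfc_left hA hB]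
  simp only [Finset.mul_sum, ← mul_assoc, ← Finset.sum_add_distrib, ← add_mul]
  gcongr
  exact scalar _ _

include hA hB in
lemma reTrace_mul_cfc_le {r : ℝ} (hr : ∀ i, hA.eigenvalues i ≤ r) {φ : ℝ → ℝ}
    (hφ : ∀ x, 0 ≤ φ x) : reTrace (A * cfc φ B) ≤ r * reTrace (cfc φ B) := by
  conv_lhs => rw [← cfc_id ℝ A hA.isSelfAdjoint]
  rw [reTrace_cfc_mul_cfc hA hB, reTrace_cfc_right hA hB]
  simp only [Finset.mul_sum, ← mul_assoc]
  gcongr with i _ j _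
  exacts [hφ _, hr i]

lemma norm_eigenCoord_swap (hX : X.IsHermitian) (i j : n) :
    ‖eigenCoord hB hA X j i‖ = ‖eigenCoord hA hB X i j‖ := by
  have h : eigenCoord hB hA X = (eigenCoord hA hB X)ᴴ := by
    simp only [eigenCoord, ← Matrix.star_eq_conjTranspose, star_mul, star_star, mul_assoc,
      hX.isSelfAdjoint.star_eq]
  rw [h, Matrix.conjTranspose_apply, norm_star]

lemma reTrace_mul_self_mul_cfc_right (hX : X.IsHermitian) (χ : ℝ → ℝ) :
    reTrace (X * X * cfc χ B)
      = ∑ i, ∑ j, χ (hB.eigenvalues j) * ‖eigenCoord hA hB X i j‖ ^ 2 := by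
  rw [mul_assoc]
  nth_rewrite 1 [← hX.eq]
  rw [reTrace_conjTranspose_mul_eq_sum_eigenCoord hA hB]
  refine Finset.sum_congr rfl fun i _ => Finset.sum_congr rfl fun j _ => ?_
  rw [eigenCoord_mul_cfc, mul_left_comm, Complex.re_ofReal_mul, Complex.star_def,
    ← Complex.normSq_eq_conj_mul_self, Complex.ofReal_re, Complex.normSq_eq_norm_sq]

lemma reTrace_mul_self_mul_cfc_left (hX : X.IsHermitian) (χ : ℝ → ℝ) :
    reTrace (X * X * cfc χ A)
      = ∑ i, ∑ j, χ (hA.eigenvalues i) * ‖eigenCoord hA hB X i j‖ ^ 2 := by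
  rw [reTrace_mul_self_mul_cfc_right hB hA hX, Finset.sum_comm]
  simp only [norm_eigenCoord_swap hA hB hX]

lemma reTrace_mul_cfc_sub_cfc (hX : X.IsHermitian) (φ : ℝ → ℝ) :
    reTrace (X * (cfc φ A - cfc φ B)) = ∑ i, ∑ j, (φ (hA.eigenvalues i) - φ (hB.eigenvalues j))
      * (star (eigenCoord hA hB X i j) * eigenCoord hA hB 1 i j).re := by
  nth_rewrite 1 [← hX.eq]
  rw [reTrace_conjTranspose_mul_eq_sum_eigenCoord hA hB]
  refine Finset.sum_congr rfl fun i _ => Finset.sum_congr rfl fun j _ => ?_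
  rw [eigenCoord_sub, Matrix.sub_apply, eigenCoord_cfc_left, eigenCoord_cfc_right, ← sub_mul,
    mul_left_comm, ← Complex.ofReal_sub, Complex.re_ofReal_mul]

lemma norm_eigenCoord_sub (i j : n) :
    ‖eigenCoord hA hB (A - B) i j‖
      = |hA.eigenvalues i - hB.eigenvalues j| * ‖eigenCoord hA hB 1 i j‖ := by
  have hleft := eigenCoord_cfc_left hA hB id i j
  have hright := eigenCoord_cfc_right hA hB id i j
  rw [cfc_id ℝ A hA.isSelfAdjoint] at hleft
  rw [cfc_id ℝ B hB.isSelfAdjoint] at hright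
  rw [eigenCoord_sub, Matrix.sub_apply, hleft, hright, ← sub_mul, norm_mul, id, id,
    ← Complex.ofReal_sub, Complex.norm_real, Real.norm_eq_abs]

lemma two_mul_mul_le_smul_sq_add (x y : ℝ) {s : ℝ} (hs : 0 < s) :
    2 * (x * y) ≤ s * x ^ 2 + s⁻¹ * y ^ 2 := by
  have h : s * x ^ 2 + s⁻¹ * y ^ 2 - 2 * (x * y) = s * (x - s⁻¹ * y) ^ 2 := by
    field_simp
    ring
  have : 0 ≤ s * (x - s⁻¹ * y) ^ 2 := by positivity
  linarith

include hA hB in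
/-- The mean value trace inequality: in the eigenbases the left side has the coefficients
`φ aᵢ - φ bⱼ`, and the weighted AM–GM inequality separates the factors `A - B` and `X`. -/
lemma reTrace_mul_cfc_sub_cfc_le (hX : X.IsHermitian) {φ χ : ℝ → ℝ} (hχ : ∀ x, 0 ≤ χ x)
    (hφ : ∀ x y, |φ x - φ y| ≤ |x - y| * ((χ x + χ y) / 2)) {s : ℝ} (hs : 0 < s) :
    reTrace (X * (cfc φ A - cfc φ B)) ≤ 1 / 4 *
      reTrace ((s • ((A - B) * (A - B)) + s⁻¹ • (X * X)) * (cfc χ A + cfc χ B)) := by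
  set a := hA.eigenvalues
  set b := hB.eigenvalues
  set Y := A - B with hY
  have hYherm : Y.IsHermitian := hA.sub hB
  have rhs : reTrace ((s • (Y * Y) + s⁻¹ • (X * X)) * (cfc χ A + cfc χ B))
      = ∑ i, ∑ j, (χ (a i) + χ (b j)) *
          (s * ‖eigenCoord hA hB Y i j‖ ^ 2 + s⁻¹ * ‖eigenCoord hA hB X i j‖ ^ 2) := by
    simp only [add_mul, mul_add, smul_mul_assoc, map_add, map_smul, smul_eq_mul,
      reTrace_mul_self_mul_cfc_left hA hB hYherm, reTrace_mul_self_mul_cfc_right hA hB hYherm,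
      reTrace_mul_self_mul_cfc_left hA hB hX, reTrace_mul_self_mul_cfc_right hA hB hX,
      Finset.mul_sum, ← Finset.sum_add_distrib]
    refine Finset.sum_congr rfl fun i _ => Finset.sum_congr rfl fun j _ => ?_
    ring
  rw [reTrace_mul_cfc_sub_cfc hA hB hX, rhs]
  simp only [Finset.mul_sum]
  refine Finset.sum_le_sum fun i _ => Finset.sum_le_sum fun j _ => ?_
  set w := ‖eigenCoord hA hB 1 i j‖
  set x := ‖eigenCoord hA hB X i j‖
  have hχij : 0 ≤ χ (a i) + χ (b j) := add_nonneg (hχ _) (hχ _)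
  calc (φ (a i) - φ (b j)) * (star (eigenCoord hA hB X i j) * eigenCoord hA hB 1 i j).re
      ≤ |φ (a i) - φ (b j)| * (x * w) := by
        refine (le_abs_self _).trans ?_
        rw [abs_mul]
        gcongr
        refine (Complex.abs_re_le_norm _).trans_eq ?_
        rw [norm_mul, norm_star]
    _ ≤ |a i - b j| * ((χ (a i) + χ (b j)) / 2) * (x * w) := by
        gcongr
        exact hφ _ _
    _ = 1 / 4 * ((χ (a i) + χ (b j)) * (2 * (‖eigenCoord hA hB Y i j‖ * x))) := by
        rw [hY, norm_eigenCoord_sub]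
        ring
    _ ≤ _ := by
        gcongr
        exact two_mul_mul_le_smul_sq_add _ _ hs

end TraceInequalities

section Eigenvalues

lemma abs_eigenvalues_le {n : Type*} [Fintype n] [DecidableEq n] {A : Matrix n n ℂ}
    (hA : A.IsHermitian) (i : n) : |hA.eigenvalues i| ≤ ‖A‖ := by
  have : Nonempty n := ⟨i⟩
  simpa using spectrum.norm_le_norm_mul_of_mem (hA.eigenvalues_mem_spectrum_real i)

lemma stronglyMeasurable_cfc {n : Type*} [Fintype n] [DecidableEq n] {Ω : Type*}
    [MeasurableSpace Ω] {F : Ω → Matrix n n ℂ} (hF : StronglyMeasurable F)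
    (hH : ∀ z, (F z).IsHermitian) {φ : ℝ → ℝ} (hφ : Continuous φ) :
    StronglyMeasurable fun z => cfc φ (F z) := by
  have hcont : Continuous fun X : Matrix n n ℂ => cfc φ (selfAdjointPart ℝ X : Matrix n n ℂ) := by
    refine Continuous.cfc_of_mem_nhdsSet (𝕜 := ℝ) (p := IsSelfAdjoint) (s := Set.univ) φ
      Filter.univ_mem ?_ (fun X => (selfAdjointPart ℝ X).2) hφ.continuousOn
    exact continuous_subtype_val.comp (continuous_selfAdjointPart ℝ _)
  simpa only [fun z => (hH z).isSelfAdjoint.coe_selfAdjointPart_apply ℝ]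
    using hcont.comp_stronglyMeasurable hF

variable {d : ℕ} {A : Matrix (Fin d) (Fin d) ℂ}

lemma eigenvalues_le_lambdaMax (hA : A.IsHermitian) (i : Fin d) :
    hA.eigenvalues i ≤ lambdaMax A :=
  le_csSup Matrix.finite_real_spectrum.bddAbove (hA.eigenvalues_mem_spectrum_real i)

lemma lambdaMin_eq_neg_lambdaMax_neg (A : Matrix (Fin d) (Fin d) ℂ) :
    lambdaMin A = -lambdaMax (-A) := by
  rw [lambdaMin, lambdaMax, ← spectrum.neg_eq, Real.sInf_def]

variable [NeZero d]

lemma exists_lambdaMax_eq_eigenvalues (hA : A.IsHermitian) :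
    ∃ i, lambdaMax A = hA.eigenvalues i := by
  have hne : (spectrum ℝ A).Nonempty := ⟨_, hA.eigenvalues_mem_spectrum_real 0⟩
  have hmem := hne.csSup_mem Matrix.finite_real_spectrum
  rw [hA.spectrum_real_eq_range_eigenvalues] at hmem
  obtain ⟨i, hi⟩ := hmem
  exact ⟨i, by rw [lambdaMax, hA.spectrum_real_eq_range_eigenvalues, hi]⟩

lemma abs_lambdaMax_le (hA : A.IsHermitian) : |lambdaMax A| ≤ ‖A‖ := by
  obtain ⟨i, hi⟩ := exists_lambdaMax_eq_eigenvalues hA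
  exact hi ▸ abs_eigenvalues_le hA i

lemma apply_lambdaMax_le_reTrace_cfc (hA : A.IsHermitian) {φ : ℝ → ℝ} (hφ : ∀ x, 0 ≤ φ x) :
    φ (lambdaMax A) ≤ reTrace (cfc φ A) := by
  obtain ⟨i, hi⟩ := exists_lambdaMax_eq_eigenvalues hA
  rw [hi, reTrace_cfc hA]
  exact Finset.single_le_sum (f := fun i => φ (hA.eigenvalues i)) (fun j _ => hφ _)
    (Finset.mem_univ i)

lemma lambdaMax_le_iff (hA : A.IsHermitian) (r : ℝ) :
    lambdaMax A ≤ r ↔ reTrace (cfc (fun x => max (x - r) 0) A) ≤ 0 := by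
  refine ⟨fun h => ?_, fun h => ?_⟩
  · rw [reTrace_cfc hA]
    refine Finset.sum_nonpos fun i _ => max_le ?_ le_rfl
    linarith [eigenvalues_le_lambdaMax hA i]
  · have hmax := apply_lambdaMax_le_reTrace_cfc hA (φ := fun x => max (x - r) 0)
      fun x => le_max_right _ _
    linarith [le_max_left (lambdaMax A - r) 0]

lemma measurable_lambdaMax {Ω : Type*} [MeasurableSpace Ω] {F : Ω → Matrix (Fin d) (Fin d) ℂ}
    (hF : StronglyMeasurable F) (hH : ∀ z, (F z).IsHermitian) :
    Measurable fun z => lambdaMax (F z) := by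
  refine measurable_of_Iic fun r => ?_
  have hset : (fun z => lambdaMax (F z)) ⁻¹' Set.Iic r
      = {z | reTrace (cfc (fun x => max (x - r) 0) (F z)) ≤ 0} :=
    Set.ext fun z => lambdaMax_le_iff (hH z) r
  rw [hset]
  exact measurableSet_le (reTrace.continuous.comp_stronglyMeasurable
    (stronglyMeasurable_cfc hF hH (by fun_prop))).measurable measurable_const

end Eigenvalues

section JointLaw

variable {Ω : Type*} [MeasurableSpace Ω] {μ : Measure Ω} {P : MarkovSemigroup Ω}

instance (P : MarkovSemigroup Ω) (t : ℝ≥0) : IsMarkovKernel (P.kernel t) := P.isMarkovKernel t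

lemma MarkovSemigroup.act_zero {E : Type*} [NormedRing E] [NormedAlgebra ℝ E] [CompleteSpace E]
    (P : MarkovSemigroup Ω) {F : Ω → E} (hF : StronglyMeasurable F) : P.act 0 F = F :=
  funext fun z => by rw [act, P.kernel_zero, Kernel.id_apply, integral_dirac' _ _ hF]

/-- The law of `(Z_0, Z_t)` for the process started from `μ`. -/
def MarkovSemigroup.jointLaw (P : MarkovSemigroup Ω) (μ : Measure Ω) (t : ℝ≥0) :
    Measure (Ω × Ω) := μ ⊗ₘ P.kernel t

lemma measurePreserving_fst_jointLaw [SFinite μ] (t : ℝ≥0) :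
    MeasurePreserving Prod.fst (P.jointLaw μ t) μ :=
  ⟨measurable_fst, Measure.fst_compProd μ (P.kernel t)⟩

lemma measurePreserving_snd_jointLaw [SFinite μ] (hstat : P.IsStationary μ) (t : ℝ≥0) :
    MeasurePreserving Prod.snd (P.jointLaw μ t) μ :=
  ⟨measurable_snd, (Measure.snd_compProd μ (P.kernel t)).trans (hstat t)⟩

lemma act_indicator_one (t : ℝ≥0) {u : Set Ω} (hu : MeasurableSet u) (z : Ω) :
    P.act t (u.indicator fun _ => (1 : ℝ)) z = (P.kernel t z).real u := by
  rw [MarkovSemigroup.act, integral_indicator_const _ hu, smul_eq_mul, mul_one]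

lemma jointLaw_prod [IsFiniteMeasure μ] (t : ℝ≥0) {s u : Set Ω} (hs : MeasurableSet s)
    (hu : MeasurableSet u) :
    P.jointLaw μ t (s ×ˢ u) = ENNReal.ofReal
      (∫ z, P.act t (u.indicator fun _ => (1 : ℝ)) z * s.indicator (fun _ => (1 : ℝ)) z ∂μ) := by
  have hmul (z : Ω) : P.act t (u.indicator fun _ => (1 : ℝ)) z * s.indicator (fun _ => (1 : ℝ)) z
      = s.indicator (fun z => (P.kernel t z).real u) z := by
    rw [act_indicator_one t hu]
    by_cases hz : z ∈ s
    · rw [Set.indicator_of_mem hz, Set.indicator_of_mem hz, mul_one]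
    · rw [Set.indicator_of_notMem hz, Set.indicator_of_notMem hz, mul_zero]
  simp_rw [hmul]
  rw [MarkovSemigroup.jointLaw, Measure.compProd_apply_prod hs hu, integral_indicator hs,
    ofReal_integral_eq_lintegral_ofReal _ (Eventually.of_forall fun _ => measureReal_nonneg)]
  · exact setLIntegral_congr_fun hs fun z _ => (ofReal_measureReal (measure_ne_top _ _)).symm
  · refine Integrable.of_bound (C := 1)
      ((P.kernel t).measurable_coe hu).ennreal_toReal.aestronglyMeasurable
      (Eventually.of_forall fun z => ?_)
    rw [Real.norm_eq_abs, abs_of_nonneg measureReal_nonneg]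
    exact measureReal_le_one

lemma measurePreserving_swap_jointLaw [IsFiniteMeasure μ] (hrev : P.IsReversible μ) (t : ℝ≥0) :
    MeasurePreserving Prod.swap (P.jointLaw μ t) (P.jointLaw μ t) := by
  have : IsFiniteMeasure (P.jointLaw μ t) := by
    unfold MarkovSemigroup.jointLaw
    infer_instance
  refine ⟨measurable_swap, ?_⟩
  have : IsFiniteMeasure ((P.jointLaw μ t).map Prod.swap) := Measure.isFiniteMeasure_map _ _
  refine Measure.ext_prod fun {s u} hs hu => ?_
  rw [Measure.map_apply measurable_swap (hs.prod hu), Set.preimage_swap_prod,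
    jointLaw_prod t hu hs, jointLaw_prod t hs hu,
    hrev t _ _ ((memLp_const (1 : ℝ)).indicator hs) ((memLp_const (1 : ℝ)).indicator hu)]
  simp_rw [mul_comm]

lemma MarkovSemigroup.IsReversible.isStationary [IsFiniteMeasure μ] (hrev : P.IsReversible μ) :
    P.IsStationary μ := fun t => by
  have hsnd : MeasurePreserving Prod.snd (P.jointLaw μ t) μ :=
    (measurePreserving_fst_jointLaw t).comp (measurePreserving_swap_jointLaw hrev t)
  exact (Measure.snd_compProd μ (P.kernel t)).symm.trans hsnd.map_eq

lemma integral_comp_measurePreserving {X Y E : Type*} [MeasurableSpace X] [MeasurableSpace Y]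
    [NormedAddCommGroup E] [NormedSpace ℝ E] {ν : Measure X} {ρ : Measure Y} {g : X → Y}
    (hg : MeasurePreserving g ν ρ) {F : Y → E} (hF : AEStronglyMeasurable F ρ) :
    ∫ x, F (g x) ∂ν = ∫ y, F y ∂ρ := by
  obtain ⟨hgm, rfl⟩ := hg
  exact (integral_map hgm.aemeasurable hF).symm

lemma integral_jointLaw_swap [IsFiniteMeasure μ] {E : Type*} [NormedAddCommGroup E]
    [NormedSpace ℝ E] (hrev : P.IsReversible μ) (t : ℝ≥0) (Φ : Ω × Ω → E) :
    ∫ p, Φ p.swap ∂(P.jointLaw μ t) = ∫ p, Φ p ∂(P.jointLaw μ t) :=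
  (measurePreserving_swap_jointLaw hrev t).integral_comp
    MeasurableEquiv.prodComm.measurableEmbedding Φ

lemma ae_integrable_kernel [SFinite μ] {E : Type*} [NormedAddCommGroup E]
    (hstat : P.IsStationary μ) (t : ℝ≥0) {F : Ω → E} (hF : Integrable F μ) :
    ∀ᵐ z ∂μ, Integrable F (P.kernel t z) := by
  have h := (measurePreserving_snd_jointLaw hstat t).integrable_comp_of_integrable hF
  exact ((Measure.integrable_compProd_iff h.aestronglyMeasurable).1 h).1

variable {E : Type*} [NormedRing E] [NormedAlgebra ℝ E]

lemma enorm_act_rpow_le {p : ℝ≥0∞} (hp : 1 ≤ p) (hp' : p ≠ ∞) (t : ℝ≥0) {F : Ω → E} {z : Ω}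
    (hF : AEStronglyMeasurable F (P.kernel t z)) :
    ‖P.act t F z‖ₑ ^ p.toReal ≤ ∫⁻ y, ‖F y‖ₑ ^ p.toReal ∂(P.kernel t z) := by
  have hp0 : p ≠ 0 := (zero_lt_one.trans_le hp).ne'
  have hnorm : ‖P.act t F z‖ₑ ≤ eLpNorm F p (P.kernel t z) := by
    refine (enorm_integral_le_lintegral_enorm _).trans ?_
    rw [← eLpNorm_one_eq_lintegral_enorm]
    exact eLpNorm_le_eLpNorm_of_exponent_le hp hF
  refine (ENNReal.rpow_le_rpow hnorm ENNReal.toReal_nonneg).trans_eq ?_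
  rw [eLpNorm_eq_lintegral_rpow_enorm_toReal hp0 hp', one_div,
    ENNReal.rpow_inv_rpow (ENNReal.toReal_pos hp0 hp').ne']

lemma eLpNorm_act_le [IsFiniteMeasure μ] (hstat : P.IsStationary μ) {p : ℝ≥0∞} (hp : 1 ≤ p)
    (hp' : p ≠ ∞) (t : ℝ≥0) {F : Ω → E} (hF : MemLp F p μ) :
    eLpNorm (P.act t F) p μ ≤ eLpNorm F p μ := by
  have hp0 : p ≠ 0 := (zero_lt_one.trans_le hp).ne'
  have hjensen : ∀ᵐ z ∂μ,
      ‖P.act t F z‖ₑ ^ p.toReal ≤ ∫⁻ y, ‖F y‖ₑ ^ p.toReal ∂(P.kernel t z) := by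
    filter_upwards [ae_integrable_kernel hstat t (hF.integrable hp)] with z hz
    exact enorm_act_rpow_le hp hp' t hz.aestronglyMeasurable
  have hbind : μ.bind (P.kernel t) = μ := hstat t
  have hmeas : AEMeasurable (fun y => ‖F y‖ₑ ^ p.toReal) (μ.bind (P.kernel t)) :=
    hbind.symm ▸ hF.aestronglyMeasurable.enorm.pow_const _
  rw [eLpNorm_eq_lintegral_rpow_enorm_toReal hp0 hp',
    eLpNorm_eq_lintegral_rpow_enorm_toReal hp0 hp']
  refine ENNReal.rpow_le_rpow ((lintegral_mono_ae hjensen).trans_eq ?_) (by positivity)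
  rw [← Measure.lintegral_bind (P.kernel t).aemeasurable hmeas, hbind]

/-- Bounded, strongly measurable functions: the test functions against which integrable functions
are paired. -/
structure IsBoundedMeasurable {E : Type*} [NormedAddCommGroup E] (K : Ω → E) : Prop where
  stronglyMeasurable : StronglyMeasurable K
  bounded : ∃ C, ∀ z, ‖K z‖ ≤ C

namespace IsBoundedMeasurable

section NormedAddCommGroup

variable {E : Type*} [NormedAddCommGroup E] {K : Ω → E}

lemma comp {X : Type*} [MeasurableSpace X] (hK : IsBoundedMeasurable K) {g : X → Ω}
    (hg : Measurable g) : IsBoundedMeasurable fun x => K (g x) :=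
  ⟨hK.stronglyMeasurable.comp_measurable hg, hK.bounded.imp fun _ h _ => h _⟩

lemma memLp {ν : Measure Ω} [IsFiniteMeasure ν] (hK : IsBoundedMeasurable K) (p : ℝ≥0∞) :
    MemLp K p ν := by
  obtain ⟨C, hC⟩ := hK.bounded
  exact MemLp.of_bound hK.stronglyMeasurable.aestronglyMeasurable C (Eventually.of_forall hC)

lemma integrable {ν : Measure Ω} [IsFiniteMeasure ν] (hK : IsBoundedMeasurable K) :
    Integrable K ν :=
  memLp_one_iff_integrable.1 (hK.memLp 1)

lemma sub {K' : Ω → E} (hK : IsBoundedMeasurable K) (hK' : IsBoundedMeasurable K') :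
    IsBoundedMeasurable fun z => K z - K' z := by
  obtain ⟨C, hC⟩ := hK.bounded
  obtain ⟨C', hC'⟩ := hK'.bounded
  exact ⟨hK.stronglyMeasurable.sub hK'.stronglyMeasurable, C + C', fun z =>
    (norm_sub_le _ _).trans (add_le_add (hC z) (hC' z))⟩

end NormedAddCommGroup

variable {F K : Ω → E}

lemma act (hK : IsBoundedMeasurable K) (P : MarkovSemigroup Ω) (t : ℝ≥0) :
    IsBoundedMeasurable (P.act t K) := by
  obtain ⟨C, hC⟩ := hK.bounded
  refine ⟨hK.stronglyMeasurable.integral_kernel, C, fun z => ?_⟩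
  refine (norm_integral_le_of_norm_le_const (Eventually.of_forall hC)).trans_eq ?_
  simp

variable (τ : E →L[ℝ] ℝ)

lemma integrable_mul {ν : Measure Ω} (hK : IsBoundedMeasurable K) (hF : Integrable F ν) :
    Integrable (fun z => τ (F z * K z)) ν := by
  obtain ⟨C, hC⟩ := hK.bounded
  exact τ.integrable_comp
    (hF.mul_bdd hK.stronglyMeasurable.aestronglyMeasurable (Eventually.of_forall hC))

variable [CompleteSpace E]

lemma integral_act_mul [SFinite μ] (hstat : P.IsStationary μ) (t : ℝ≥0) (hF : Integrable F μ)
    (hK : IsBoundedMeasurable K) :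
    ∫ z, τ (P.act t F z * K z) ∂μ = ∫ p, τ (F p.2 * K p.1) ∂(P.jointLaw μ t) := by
  have hF2 : Integrable (fun p : Ω × Ω => F p.2) (P.jointLaw μ t) :=
    (measurePreserving_snd_jointLaw hstat t).integrable_comp_of_integrable hF
  rw [MarkovSemigroup.jointLaw,
    Measure.integral_compProd ((hK.comp measurable_fst).integrable_mul τ hF2)]
  refine integral_congr_ae ?_
  filter_upwards [ae_integrable_kernel hstat t hF] with z hz
  exact ((τ ∘L (ContinuousLinearMap.mul ℝ E).flip (K z)).integral_comp_comm hz).symm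

lemma integral_mul_act [SFinite μ] (t : ℝ≥0) (hF : Integrable F μ) (hK : IsBoundedMeasurable K) :
    ∫ z, τ (F z * P.act t K z) ∂μ = ∫ p, τ (F p.1 * K p.2) ∂(P.jointLaw μ t) := by
  have hF1 : Integrable (fun p : Ω × Ω => F p.1) (P.jointLaw μ t) :=
    (measurePreserving_fst_jointLaw t).integrable_comp_of_integrable hF
  rw [MarkovSemigroup.jointLaw,
    Measure.integral_compProd ((hK.comp measurable_snd).integrable_mul τ hF1)]
  refine integral_congr_ae (Eventually.of_forall fun z => ?_)
  exact ((τ ∘L ContinuousLinearMap.mul ℝ E (F z)).integral_comp_comm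
    (hK.integrable (ν := P.kernel t z))).symm

lemma integral_act_mul_eq_integral_mul_act [IsFiniteMeasure μ] (hrev : P.IsReversible μ) (t : ℝ≥0)
    (hF : Integrable F μ) (hK : IsBoundedMeasurable K) :
    ∫ z, τ (P.act t F z * K z) ∂μ = ∫ z, τ (F z * P.act t K z) ∂μ := by
  rw [integral_act_mul τ hrev.isStationary t hF hK, integral_mul_act τ t hF hK,
    ← integral_jointLaw_swap hrev]
  rfl

end IsBoundedMeasurable

end JointLaw

local instance {E : Type*} [NormedAddCommGroup E] [NormedSpace ℝ E] [FiniteDimensional ℝ E] :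
    CompleteSpace E :=
  FiniteDimensional.complete ℝ E

section FiniteDimensional

variable {E : Type*} [NormedAddCommGroup E] [NormedSpace ℝ E] [FiniteDimensional ℝ E]

/-- The continuous coordinates of a finite-dimensional space in the basis `Module.finBasis`. -/
def coordCLM (E : Type*) [NormedAddCommGroup E] [NormedSpace ℝ E] [FiniteDimensional ℝ E]
    (k : Fin (Module.finrank ℝ E)) : E →L[ℝ] ℝ :=
  LinearMap.toContinuousLinearMap ((Module.finBasis ℝ E).coord k)

lemma sum_coordCLM_smul (X : E) : ∑ k, coordCLM E k X • Module.finBasis ℝ E k = X :=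
  (Module.finBasis ℝ E).sum_repr X

lemma eq_sum_coordCLM {Ω : Type*} (F : Ω → E) :
    F = ∑ k, fun z => coordCLM E k (F z) • Module.finBasis ℝ E k := by
  ext z
  rw [Finset.sum_apply, sum_coordCLM_smul]

lemma tendsto_eLpNorm_of_coordCLM {Ω ι : Type*} [MeasurableSpace Ω] {μ : Measure Ω}
    {l : Filter ι} {F : ι → Ω → E} {p : ℝ≥0∞} (hp : 1 ≤ p)
    (hF : ∀ i k, AEStronglyMeasurable (fun z => coordCLM E k (F i z)) μ)
    (hlim : ∀ k, Tendsto (fun i => eLpNorm (fun z => coordCLM E k (F i z)) p μ) l (𝓝 0)) :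
    Tendsto (fun i => eLpNorm (F i) p μ) l (𝓝 0) := by
  have hsum : Tendsto (fun i => ∑ k, eLpNorm (fun z => coordCLM E k (F i z)) p μ
      * ‖Module.finBasis ℝ E k‖ₑ) l (𝓝 0) := by
    simpa only [zero_mul, Finset.sum_const_zero] using tendsto_finsetSum Finset.univ fun k _ =>
      ENNReal.Tendsto.mul_const (hlim k)
        (Or.inr (enorm_ne_top (x := Module.finBasis ℝ E k)))
  refine tendsto_of_tendsto_of_tendsto_of_le_of_le tendsto_const_nhds hsum (fun _ => zero_le)
    fun i => ?_
  beta_reduce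
  rw [eq_sum_coordCLM (F i)]
  refine (eLpNorm_sum_le (fun k _ => (hF i k).smul_const _) hp).trans
    (Finset.sum_le_sum fun k _ => ?_)
  rw [mul_comm, ← enorm_norm, ← ofReal_norm, norm_norm]
  refine eLpNorm_le_mul_eLpNorm_of_ae_le_mul (Eventually.of_forall fun z => ?_) p
  rw [← eq_sum_coordCLM (F i), norm_smul, mul_comm]

end FiniteDimensional

section SuitableFunctions

variable {Ω : Type*} {A : Subalgebra ℝ (Ω → ℝ)}
  {E : Type*} [NormedRing E] [NormedAlgebra ℝ E] [FiniteDimensional ℝ E]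

lemma comp_mul_eq_sum_coordCLM (ℓ : E →L[ℝ] ℝ) (F G : Ω → E) :
    (fun z => ℓ (F z * G z)) = ∑ k, ∑ l, ℓ (Module.finBasis ℝ E k * Module.finBasis ℝ E l) •
      ((fun z => coordCLM E k (F z)) * fun z => coordCLM E l (G z)) := by
  ext z
  conv_lhs => rw [← sum_coordCLM_smul (F z), ← sum_coordCLM_smul (G z), Finset.sum_mul_sum]
  simp only [map_sum, Finset.sum_apply, Pi.smul_apply, Pi.mul_apply, smul_mul_smul_comm,
    map_smul, smul_eq_mul]
  exact Finset.sum_congr rfl fun k _ => Finset.sum_congr rfl fun l _ => mul_comm _ _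

/-- The algebra of suitable `E`-valued functions: those all of whose real coordinates belong to the
algebra `A` of suitable real functions. -/
def suitableFun (A : Subalgebra ℝ (Ω → ℝ)) (E : Type*) [NormedRing E] [NormedAlgebra ℝ E]
    [FiniteDimensional ℝ E] : Subalgebra ℝ (Ω → E) where
  carrier := {F | ∀ ℓ : E →L[ℝ] ℝ, (fun z => ℓ (F z)) ∈ A}
  add_mem' {F G} hF hG ℓ := by
    simpa only [Pi.add_apply, map_add] using! A.add_mem (hF ℓ) (hG ℓ)
  mul_mem' {F G} hF hG ℓ := by
    simp only [Pi.mul_apply, comp_mul_eq_sum_coordCLM]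
    exact A.sum_mem fun k _ => A.sum_mem fun l _ => A.smul_mem (A.mul_mem (hF _) (hG _)) _
  algebraMap_mem' r ℓ := A.algebraMap_mem (ℓ (algebraMap ℝ E r))

namespace suitableFun

lemma const_mem (X : E) : (fun _ : Ω => X) ∈ suitableFun A E := fun ℓ => A.algebraMap_mem (ℓ X)

variable [MeasurableSpace Ω] {μ : Measure Ω} {P : MarkovSemigroup Ω}
  (hA : P.IsSuitableAlgebra μ A)
include hA

lemma stronglyMeasurable (F : suitableFun A E) : StronglyMeasurable F.1 := by
  rw [eq_sum_coordCLM F.1]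
  exact Finset.stronglyMeasurable_sum _ fun k _ =>
    (hA.measurable _ (F.2 (coordCLM E k))).stronglyMeasurable.smul_const _

lemma memLp_two (F : suitableFun A E) : MemLp F.1 2 μ := by
  rw [eq_sum_coordCLM F.1]
  refine memLp_finsetSum' _ fun k _ => ?_
  have h2 : MemLp (fun z => coordCLM E k (F.1 z)) 2 μ :=
    (memLp_two_iff_integrable_sq (hA.measurable _ (F.2 _)).aestronglyMeasurable).2
      (hA.integrable _ (A.pow_mem (F.2 _) 2))
  exact (ContinuousLinearMap.toSpanSingleton ℝ (Module.finBasis ℝ E k)).comp_memLp' h2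

lemma integrable (F : suitableFun A E) : Integrable F.1 μ := by
  rw [eq_sum_coordCLM F.1]
  exact integrable_finsetSum' _ fun k _ => (hA.integrable _ (F.2 _)).smul_const _

lemma integrable_kernel (F : suitableFun A E) (t : ℝ≥0) (z : Ω) :
    Integrable F.1 (P.kernel t z) := by
  rw [eq_sum_coordCLM F.1]
  exact integrable_finsetSum' _ fun k _ => (hA.integrable_kernel _ (F.2 _) t z).smul_const _

lemma map_act (ℓ : E →L[ℝ] ℝ) (F : suitableFun A E) (t : ℝ≥0) (z : Ω) :
    ℓ (P.act t F.1 z) = P.act t (fun y => ℓ (F.1 y)) z :=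
  (ℓ.integral_comp_comm (integrable_kernel hA F t z)).symm

/-- The operator `P_t` on suitable functions. -/
def act (t : ℝ≥0) : suitableFun A E →ₗ[ℝ] suitableFun A E where
  toFun F := ⟨P.act t F.1, fun ℓ => by
    simp only [map_act hA]
    exact hA.act_mem _ (F.2 ℓ) t⟩
  map_add' F G := Subtype.ext <| funext fun z =>
    integral_add (integrable_kernel hA F t z) (integrable_kernel hA G t z)
  map_smul' c F := Subtype.ext <| funext fun _ => integral_smul c F.1

lemma act_zero (F : suitableFun A E) : act hA 0 F = F :=
  Subtype.ext (P.act_zero (stronglyMeasurable hA F))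

lemma act_act (s t : ℝ≥0) (F : suitableFun A E) : act hA s (act hA t F) = act hA (s + t) F := by
  refine Subtype.ext <| funext fun z => ?_
  have h := integrable_kernel hA F (s + t) z
  rw [P.kernel_add] at h
  change _ = ∫ y, F.1 y ∂(P.kernel (s + t) z)
  rw [P.kernel_add]
  exact (Kernel.integral_comp h).symm

/-- The difference quotient `(P_t - 1) / t` on suitable functions. -/
def diffQuot (t : ℝ≥0) : suitableFun A E →ₗ[ℝ] suitableFun A E :=
  (t : ℝ)⁻¹ • (act hA t - LinearMap.id)

lemma act_diffQuot (s t : ℝ≥0) (F : suitableFun A E) :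
    act hA s (diffQuot hA t F) = (t : ℝ)⁻¹ • (act hA (s + t) F - act hA s F) := by
  rw [diffQuot, LinearMap.smul_apply, map_smul, LinearMap.sub_apply, map_sub, act_act,
    LinearMap.id_apply]

lemma diffQuot_act (s t : ℝ≥0) (F : suitableFun A E) :
    diffQuot hA t (act hA s F) = act hA s (diffQuot hA t F) := by
  rw [act_diffQuot, diffQuot, LinearMap.smul_apply, LinearMap.sub_apply, act_act, add_comm t,
    LinearMap.id_apply]

lemma act_sub_self {t : ℝ≥0} (ht : t ≠ 0) (F : suitableFun A E) :
    act hA t F - F = (t : ℝ) • diffQuot hA t F := by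
  rw [diffQuot, LinearMap.smul_apply, smul_inv_smul₀ (NNReal.coe_ne_zero.2 ht),
    LinearMap.sub_apply, LinearMap.id_apply]

lemma map_diffQuot (ℓ : E →L[ℝ] ℝ) (F : suitableFun A E) (t : ℝ≥0) (z : Ω) :
    ℓ ((diffQuot hA t F).1 z) = P.diffQuot (fun y => ℓ (F.1 y)) t z := by
  change ℓ ((t : ℝ)⁻¹ • (P.act t F.1 z - F.1 z)) = _
  rw [map_smul, map_sub, map_act hA]
  rfl

lemma tendsto_diffQuot (F : suitableFun A E) (z : Ω) :
    Tendsto (fun t => (diffQuot hA t F).1 z) (𝓝[>] 0) (𝓝 (P.generator F.1 z)) := by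
  have hlim : Tendsto (fun t => (diffQuot hA t F).1 z) (𝓝[>] 0)
      (𝓝 (∑ k, P.generator (fun y => coordCLM E k (F.1 y)) z • Module.finBasis ℝ E k)) := by
    have hsum (t : ℝ≥0) : (diffQuot hA t F).1 z
        = ∑ k, P.diffQuot (fun y => coordCLM E k (F.1 y)) t z • Module.finBasis ℝ E k := by
      simp only [← map_diffQuot hA, sum_coordCLM_smul]
    simp only [hsum]
    exact tendsto_finsetSum _ fun k _ => (hA.tendsto_generator _ (F.2 _) z).smul_const _
  rwa [← hlim.limUnder_eq] at hlim

lemma map_generator (ℓ : E →L[ℝ] ℝ) (F : suitableFun A E) (z : Ω) :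
    ℓ (P.generator F.1 z) = P.generator (fun y => ℓ (F.1 y)) z := by
  refine tendsto_nhds_unique ((ℓ.continuous.tendsto _).comp (tendsto_diffQuot hA F z)) ?_
  simp only [Function.comp_def, map_diffQuot hA]
  exact hA.tendsto_generator _ (F.2 ℓ) z

/-- The generator on suitable functions. -/
def gen : suitableFun A E →ₗ[ℝ] suitableFun A E where
  toFun F := ⟨P.generator F.1, fun ℓ => by
    simp only [map_generator hA]
    exact hA.generator_mem _ (F.2 ℓ)⟩
  map_add' F G := Subtype.ext <| funext fun z => by
    refine tendsto_nhds_unique (tendsto_diffQuot hA (F + G) z) ?_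
    simp only [map_add]
    exact (tendsto_diffQuot hA F z).add (tendsto_diffQuot hA G z)
  map_smul' c F := Subtype.ext <| funext fun z => by
    refine tendsto_nhds_unique (tendsto_diffQuot hA (c • F) z) ?_
    simp only [map_smul]
    exact (tendsto_diffQuot hA F z).const_smul c

/-- The carré du champ on suitable functions. -/
def gamma (F G : suitableFun A E) : suitableFun A E :=
  (1 / 2 : ℝ) • (gen hA (F * G) - F * gen hA G - gen hA F * G)

lemma tendsto_eLpNorm_diffQuot_sub_gen (F : suitableFun A E) :
    Tendsto (fun t => eLpNorm (diffQuot hA t F - gen hA F).1 2 μ) (𝓝[>] 0) (𝓝 0) := by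
  refine tendsto_eLpNorm_of_coordCLM one_le_two
    (fun t k => (hA.measurable _ ((diffQuot hA t F - gen hA F).2 _)).aestronglyMeasurable)
    fun k => (hA.tendsto_generator_L2 _ (F.2 (coordCLM E k))).congr fun t => ?_
  congr 1
  ext z
  change _ = coordCLM E k ((diffQuot hA t F).1 z - P.generator F.1 z)
  rw [map_sub, map_diffQuot hA, map_generator hA]
  rfl

lemma inv_smul_integral_sub_mul_self (F : suitableFun A E) (t : ℝ≥0) (z : Ω) :
    (t : ℝ)⁻¹ • ∫ y, (F.1 y - F.1 z) * (F.1 y - F.1 z) ∂(P.kernel t z)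
      = (diffQuot hA t (F * F)).1 z - F.1 z * (diffQuot hA t F).1 z
        - (diffQuot hA t F).1 z * F.1 z := by
  have i1 := integrable_kernel hA F t z
  have i2 : Integrable (fun y => F.1 y * F.1 y) (P.kernel t z) := integrable_kernel hA (F * F) t z
  have hexpand (y : Ω) : (F.1 y - F.1 z) * (F.1 y - F.1 z)
      = F.1 y * F.1 y - F.1 y * F.1 z - (F.1 z * F.1 y - F.1 z * F.1 z) := by noncomm_ring
  have i3 : Integrable (fun y => F.1 y * F.1 y - F.1 y * F.1 z) (P.kernel t z) :=
    i2.sub (i1.mul_const _)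
  have i4 : Integrable (fun y => F.1 z * F.1 y - F.1 z * F.1 z) (P.kernel t z) :=
    (i1.const_mul _).sub (integrable_const _)
  simp only [hexpand]
  rw [integral_sub i3 i4, integral_sub i2 (i1.mul_const _),
    integral_sub (i1.const_mul _) (integrable_const _), integral_mul_const_of_integrable i1,
    integral_const_mul_of_integrable i1, integral_const, probReal_univ, one_smul]
  change _ = (t : ℝ)⁻¹ • (P.act t (F.1 * F.1) z - F.1 z * F.1 z)
    - F.1 z * ((t : ℝ)⁻¹ • (P.act t F.1 z - F.1 z))
    - ((t : ℝ)⁻¹ • (P.act t F.1 z - F.1 z)) * F.1 z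
  rw [mul_smul_comm, smul_mul_assoc, ← smul_sub, ← smul_sub]
  congr 1
  simp only [MarkovSemigroup.act, Pi.mul_apply]
  noncomm_ring

lemma tendsto_gamma (F : suitableFun A E) (z : Ω) :
    Tendsto (fun t : ℝ≥0 => (1 / 2 : ℝ) •
        ((t : ℝ)⁻¹ • ∫ y, (F.1 y - F.1 z) * (F.1 y - F.1 z) ∂(P.kernel t z))) (𝓝[>] 0)
      (𝓝 (P.gamma F.1 F.1 z)) := by
  simp only [inv_smul_integral_sub_mul_self hA]
  have h := tendsto_diffQuot hA F z
  exact (((tendsto_diffQuot hA (F * F) z).sub (h.const_mul (F.1 z))).sub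
    (h.mul_const (F.1 z))).const_smul _

lemma gamma_sub_const (F : suitableFun A E) (X : E) :
    P.gamma (F.1 - fun _ => X) (F.1 - fun _ => X) = P.gamma F.1 F.1 := by
  ext z
  have hlim := tendsto_gamma hA (F - ⟨_, const_mem X⟩) z
  have hcoe : (F - ⟨fun _ => X, const_mem X⟩ : suitableFun A E).1 = F.1 - fun _ => X := rfl
  simp only [hcoe, Pi.sub_apply, sub_sub_sub_cancel_right] at hlim
  exact tendsto_nhds_unique hlim (tendsto_gamma hA F z)

lemma gamma_neg (F : suitableFun A E) : P.gamma (-F.1) (-F.1) = P.gamma F.1 F.1 := by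
  ext z
  have hlim := tendsto_gamma hA (-F) z
  have hcoe : (-F).1 = -F.1 := rfl
  simp only [hcoe, Pi.neg_apply, ← neg_sub', neg_mul_neg] at hlim
  exact tendsto_nhds_unique hlim (tendsto_gamma hA F z)

end suitableFun

end SuitableFunctions

section Flow

variable {Ω : Type*} [MeasurableSpace Ω] {μ : Measure Ω} {P : MarkovSemigroup Ω}
  {A : Subalgebra ℝ (Ω → ℝ)}
  {E : Type*} [NormedRing E] [NormedAlgebra ℝ E] [FiniteDimensional ℝ E]

namespace suitableFun

variable (hA : P.IsSuitableAlgebra μ A)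

/-- The class of a suitable function in `L_2(μ)`. -/
def toL2 : suitableFun A E →ₗ[ℝ] Lp E 2 μ where
  toFun F := (memLp_two hA F).toLp F.1
  map_add' _ _ := MemLp.toLp_add _ _
  map_smul' _ _ := MemLp.toLp_const_smul _ _

lemma toL2_eq_iff {F G : suitableFun A E} : toL2 hA F = toL2 hA G ↔ F.1 =ᵐ[μ] G.1 :=
  MemLp.toLp_eq_toLp_iff (memLp_two hA F) (memLp_two hA G)

lemma tendsto_toL2_diffQuot (F : suitableFun A E) :
    Tendsto (fun t => toL2 hA (diffQuot hA t F)) (𝓝[>] 0) (𝓝 (toL2 hA (gen hA F))) :=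
  (Lp.tendsto_Lp_iff_tendsto_eLpNorm'' (fun t => (diffQuot hA t F).1)
    (fun t => memLp_two hA (diffQuot hA t F)) (gen hA F).1 (memLp_two hA (gen hA F))).2
    (tendsto_eLpNorm_diffQuot_sub_gen hA F)

lemma tendsto_toL2_act (F : suitableFun A E) :
    Tendsto (fun t => toL2 hA (act hA t F)) (𝓝 0) (𝓝 (toL2 hA F)) := by
  have hright : Tendsto (fun t => toL2 hA (act hA t F) - toL2 hA F) (𝓝[>] 0) (𝓝 0) := by
    have hsmul : Tendsto (fun t : ℝ≥0 => (t : ℝ) • toL2 hA (diffQuot hA t F)) (𝓝[>] 0)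
        (𝓝 ((0 : ℝ) • toL2 hA (gen hA F))) :=
      ((NNReal.continuous_coe.tendsto 0).mono_left nhdsWithin_le_nhds).smul
        (tendsto_toL2_diffQuot hA F)
    rw [zero_smul] at hsmul
    refine hsmul.congr' ?_
    filter_upwards [self_mem_nhdsWithin] with t ht
    rw [← map_smul, ← map_sub, act_sub_self hA (ne_of_gt ht)]
  have hnhds : 𝓝 (0 : ℝ≥0) = pure 0 ⊔ 𝓝[>] 0 := by
    rw [← nhdsWithin_insert, ← nhdsWithin_univ, Set.Ioi_insert, ← Set.Ici_bot]
    rfl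
  rw [hnhds, tendsto_sup]
  refine ⟨?_, by simpa using hright.add_const (toL2 hA F)⟩
  simpa only [tendsto_pure_left, act_zero] using fun s hs => mem_of_mem_nhds hs

/-- The orbit `s ↦ P_s F` in `L_2(μ)`, constant at negative times. -/
def flow (s : ℝ) (F : suitableFun A E) : Lp E 2 μ := toL2 hA (act hA s.toNNReal F)

variable [IsFiniteMeasure μ] (hstat : P.IsStationary μ)
include hstat

lemma norm_toL2_act_le (t : ℝ≥0) (F : suitableFun A E) :
    ‖toL2 hA (act hA t F)‖ ≤ ‖toL2 hA F‖ := by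
  change ‖(memLp_two hA (act hA t F)).toLp _‖ ≤ ‖(memLp_two hA F).toLp _‖
  rw [Lp.norm_toLp, Lp.norm_toLp]
  exact ENNReal.toReal_mono (memLp_two hA F).eLpNorm_ne_top
    (eLpNorm_act_le hstat one_le_two ENNReal.ofNat_ne_top t (memLp_two hA F))

lemma norm_toL2_act_sub_le (t : ℝ≥0) (F G : suitableFun A E) :
    ‖toL2 hA (act hA t F) - toL2 hA (act hA t G)‖ ≤ ‖toL2 hA F - toL2 hA G‖ := by
  simpa only [map_sub] using norm_toL2_act_le hA hstat t (F - G)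

lemma act_congr_ae {F G : suitableFun A E} (h : F.1 =ᵐ[μ] G.1) (t : ℝ≥0) :
    (act hA t F).1 =ᵐ[μ] (act hA t G).1 := by
  rw [← toL2_eq_iff hA, ← sub_eq_zero, ← norm_le_zero_iff]
  refine (norm_toL2_act_sub_le hA hstat t F G).trans_eq ?_
  rw [(toL2_eq_iff hA).2 h, sub_self, norm_zero]

lemma gen_congr_ae {F G : suitableFun A E} (h : F.1 =ᵐ[μ] G.1) :
    (gen hA F).1 =ᵐ[μ] (gen hA G).1 := by
  refine (toL2_eq_iff hA).1 (tendsto_nhds_unique (tendsto_toL2_diffQuot hA F)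
    ((tendsto_toL2_diffQuot hA G).congr fun t => (toL2_eq_iff hA).2 ?_))
  filter_upwards [h, act_congr_ae hA hstat h t] with z hz hact
  change (t : ℝ)⁻¹ • ((act hA t G).1 z - G.1 z) = (t : ℝ)⁻¹ • ((act hA t F).1 z - F.1 z)
  rw [hz, hact]

lemma tendsto_toL2_act_diffQuot (s : ℝ≥0) (F : suitableFun A E) :
    Tendsto (fun t => toL2 hA (act hA s (diffQuot hA t F))) (𝓝[>] 0)
      (𝓝 (toL2 hA (act hA s (gen hA F)))) := by
  rw [tendsto_iff_norm_sub_tendsto_zero]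
  exact squeeze_zero (fun _ => norm_nonneg _) (fun t => norm_toL2_act_sub_le hA hstat s _ _)
    (tendsto_iff_norm_sub_tendsto_zero.1 (tendsto_toL2_diffQuot hA F))

lemma gen_act_ae_eq (s : ℝ≥0) (F : suitableFun A E) :
    (gen hA (act hA s F)).1 =ᵐ[μ] (act hA s (gen hA F)).1 := by
  refine (toL2_eq_iff hA).1 (tendsto_nhds_unique (tendsto_toL2_diffQuot hA (act hA s F)) ?_)
  simpa only [diffQuot_act] using tendsto_toL2_act_diffQuot hA hstat s F

lemma norm_toL2_act_sub_toL2_act_le {s t : ℝ≥0} (h : s ≤ t) (F : suitableFun A E) :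
    ‖toL2 hA (act hA t F) - toL2 hA (act hA s F)‖ ≤ ‖toL2 hA (act hA (t - s) F) - toL2 hA F‖ := by
  simpa only [act_act, add_tsub_cancel_of_le h]
    using norm_toL2_act_sub_le hA hstat s (act hA (t - s) F) F

lemma continuous_flow (F : suitableFun A E) : Continuous fun s => flow hA s F := by
  refine Continuous.comp (g := fun t => toL2 hA (act hA t F)) (continuous_iff_continuousAt.2
    fun t => ?_) continuous_real_toNNReal
  rw [ContinuousAt, tendsto_iff_norm_sub_tendsto_zero]
  have hgap : Tendsto (fun s : ℝ≥0 => max s t - min s t) (𝓝 t) (𝓝 0) := by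
    have hc : Continuous fun s : ℝ≥0 => max s t - min s t := by fun_prop
    simpa using hc.tendsto t
  refine squeeze_zero (fun _ => norm_nonneg _) (fun s => ?_)
    (tendsto_iff_norm_sub_tendsto_zero.1 ((tendsto_toL2_act hA F).comp hgap))
  rw [Function.comp_apply]
  rcases le_total s t with h | h
  · rw [norm_sub_rev, max_eq_right h, min_eq_left h]
    exact norm_toL2_act_sub_toL2_act_le hA hstat h F
  · rw [max_eq_left h, min_eq_right h]
    exact norm_toL2_act_sub_toL2_act_le hA hstat h F

lemma hasDerivWithinAt_flow (F : suitableFun A E) {s : ℝ} (hs : 0 ≤ s) :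
    HasDerivWithinAt (fun r => flow hA r F) (flow hA s (gen hA F)) (Set.Ioi s) s := by
  rw [hasDerivWithinAt_iff_tendsto_slope' (by simp)]
  have hgap : Tendsto (fun r : ℝ => (r - s).toNNReal) (𝓝[>] s) (𝓝[>] 0) := by
    refine tendsto_nhdsWithin_iff.2 ⟨?_, ?_⟩
    · have hc : Continuous fun r : ℝ => (r - s).toNNReal := by fun_prop
      simpa using (hc.tendsto s).mono_left nhdsWithin_le_nhds
    · filter_upwards [self_mem_nhdsWithin] with r hr
      simpa using hr
  refine ((tendsto_toL2_act_diffQuot hA hstat s.toNNReal F).comp hgap).congr' ?_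
  filter_upwards [self_mem_nhdsWithin] with r (hr : s < r)
  rw [Function.comp_apply, act_diffQuot, Real.coe_toNNReal _ (sub_nonneg.2 hr.le),
    ← Real.toNNReal_add hs (sub_nonneg.2 hr.le), add_sub_cancel, map_smul, map_sub]
  rfl

lemma hasDerivAt_flow (F : suitableFun A E) {s : ℝ} (hs : 0 < s) :
    HasDerivAt (fun r => flow hA r F) (flow hA s (gen hA F)) s := by
  have hc := continuous_flow hA hstat (gen hA F)
  have hint : HasDerivAt (fun r => flow hA 0 F + ∫ u in (0 : ℝ)..r, flow hA u (gen hA F))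
      (flow hA s (gen hA F)) s :=
    (intervalIntegral.integral_hasDerivAt_right (hc.intervalIntegrable _ _)
      (hc.stronglyMeasurableAtFilter _ _) hc.continuousAt).const_add _
  refine hint.congr_of_eventuallyEq ?_
  filter_upwards [lt_mem_nhds hs] with r hr
  rw [intervalIntegral.integral_eq_sub_of_hasDeriv_right (f := fun r => flow hA r F)
    (continuous_flow hA hstat F).continuousOn (fun x hx => hasDerivWithinAt_flow hA hstat F ?_)
    (hc.intervalIntegrable _ _), add_sub_cancel]
  rw [min_eq_left hr.le] at hx
  exact hx.1.le

end suitableFun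

end Flow

section MovingFunctionals

variable {D E : Type*} [AddCommGroup D] [Module ℝ D] [NormedAddCommGroup E] [NormedSpace ℝ E]
  {ι : D →ₗ[ℝ] E} {Λ : ℝ → D →ₗ[ℝ] ℝ} {C : ℝ} {x : ℝ → D}

lemma hasDerivAt_movingFunctional (hΛ : ∀ r y, |Λ r y| ≤ C * ‖ι y‖) {x' : D} {s ℓ : ℝ}
    (hx : HasDerivAt (fun r => ι (x r)) (ι x') s)
    (hc : Tendsto (fun r => Λ r x') (𝓝 s) (𝓝 (Λ s x')))
    (hd : HasDerivAt (fun r => Λ r (x s)) ℓ s) :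
    HasDerivAt (fun r => Λ r (x r)) (Λ s x' + ℓ) s := by
  rw [hasDerivAt_iff_isLittleO] at hx hd ⊢
  have hvec : (fun r => Λ r (x r - x s - (r - s) • x')) =o[𝓝 s] fun r => r - s := by
    refine Asymptotics.IsBigO.trans_isLittleO (g := fun r => ι (x r) - ι (x s) - (r - s) • ι x')
      (Asymptotics.IsBigO.of_bound C (Eventually.of_forall fun r => ?_)) hx
    simpa only [map_sub, map_smul] using! hΛ r (x r - x s - (r - s) • x')
  have hslope : (fun r => (r - s) * (Λ r x' - Λ s x')) =o[𝓝 s] fun r => r - s := by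
    have hone : (fun r => Λ r x' - Λ s x') =o[𝓝 s] fun _ => (1 : ℝ) :=
      (Asymptotics.isLittleO_one_iff ℝ).2 (by simpa using hc.sub_const (Λ s x'))
    simpa using (Asymptotics.isBigO_refl (fun r => r - s) (𝓝 s)).mul_isLittleO hone
  refine ((hvec.add hslope).add hd).congr_left fun r => ?_
  simp only [map_sub, map_smul, smul_eq_mul]
  ring

lemma continuous_movingFunctional (hΛ : ∀ r y, |Λ r y| ≤ C * ‖ι y‖)
    (hx : Continuous fun r => ι (x r)) (hc : ∀ y, Continuous fun r => Λ r y) :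
    Continuous fun r => Λ r (x r) := by
  refine continuous_iff_continuousAt.2 fun s => ?_
  have hvec : Tendsto (fun r => Λ r (x r - x s)) (𝓝 s) (𝓝 0) := by
    refine squeeze_zero_norm (a := fun r => C * ‖ι (x r) - ι (x s)‖) (fun r => ?_) ?_
    · simpa only [map_sub] using! hΛ r (x r - x s)
    · simpa using ((hx.tendsto s).sub_const (ι (x s))).norm.const_mul C
  refine (hvec.add ((hc (x s)).tendsto s)).congr (fun r => ?_) |>.mono_right (by rw [zero_add])
  rw [map_sub, sub_add_cancel]

lemma tendsto_inv_mul_integral {g : ℝ → ℝ} (hg : Continuous g) :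
    Tendsto (fun ε : ℝ => ε⁻¹ * ∫ u in (0 : ℝ)..ε, g u) (𝓝[>] 0) (𝓝 (g 0)) := by
  have hderiv : HasDerivAt (fun r => ∫ u in (0 : ℝ)..r, g u) (g 0) 0 :=
    intervalIntegral.integral_hasDerivAt_right (hg.intervalIntegrable _ _)
      (hg.stronglyMeasurableAtFilter _ _) hg.continuousAt
  refine ((hasDerivAt_iff_tendsto_slope.1 hderiv).mono_left
    (nhdsWithin_mono 0 fun x (hx : 0 < x) => hx.ne')).congr fun r => ?_
  simp [slope]

lemma le_of_forall_integral_le {g h : ℝ → ℝ} (hg : Continuous g) (hh : Continuous h)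
    (hle : ∀ ε > 0, ∫ u in (0 : ℝ)..ε, g u ≤ ∫ u in (0 : ℝ)..ε, h u) : g 0 ≤ h 0 := by
  refine le_of_tendsto_of_tendsto (tendsto_inv_mul_integral hg) (tendsto_inv_mul_integral hh) ?_
  filter_upwards [self_mem_nhdsWithin] with ε (hε : 0 < ε)
  exact mul_le_mul_of_nonneg_left (hle ε hε) (inv_nonneg.2 hε.le)

end MovingFunctionals

section Pairing

variable {Ω : Type*} [MeasurableSpace Ω] {μ : Measure Ω}
  {P : MarkovSemigroup Ω} {A : Subalgebra ℝ (Ω → ℝ)}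
  {E : Type*} [NormedRing E] [NormedAlgebra ℝ E]

/-- The bilinear form `(X, Y) ↦ τ (X Y)`. -/
def mulForm (τ : E →L[ℝ] ℝ) : E →L[ℝ] E →L[ℝ] ℝ :=
  ContinuousLinearMap.compL ℝ E E ℝ τ ∘L ContinuousLinearMap.mul ℝ E

/-- The functional `X ↦ ∫ τ(X K) dμ` on `L_2(μ)`. -/
def pairL2 (μ : Measure Ω) [IsFiniteMeasure μ] (τ : E →L[ℝ] ℝ) {K : Ω → E}
    (hK : IsBoundedMeasurable K) : Lp E 2 μ →L[ℝ] ℝ :=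
  ((mulForm τ).lpPairing μ 2 2).flip ((hK.memLp 2).toLp K)

variable [FiniteDimensional ℝ E]

namespace suitableFun

variable (hA : P.IsSuitableAlgebra μ A)

/-- The class of a suitable function in `L_1(μ)`. -/
def toL1 : suitableFun A E →ₗ[ℝ] Lp E 1 μ where
  toFun F := (memLp_one_iff_integrable.2 (integrable hA F)).toLp F.1
  map_add' _ _ := MemLp.toLp_add _ _
  map_smul' _ _ := MemLp.toLp_const_smul _ _

lemma norm_toL1 (F : suitableFun A E) : ‖toL1 hA F‖ = ∫ z, ‖F.1 z‖ ∂μ :=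
  L1.norm_of_fun_eq_integral_norm (integrable hA F)

lemma holderL_toL2 (F G : suitableFun A E) :
    (ContinuousLinearMap.mul ℝ E).holderL μ 2 2 1 (toL2 hA F) (toL2 hA G)
      = toL1 hA (F * G) := by
  refine (MemLp.toLp_eq_toLp_iff ((ContinuousLinearMap.mul ℝ E).memLp_of_bilin 1 (Lp.memLp _)
    (Lp.memLp _)) (memLp_one_iff_integrable.2 (integrable hA (F * G)))).2 ?_
  filter_upwards [(memLp_two hA F).coeFn_toLp, (memLp_two hA G).coeFn_toLp] with z hF hG
  exact congr_arg₂ (· * ·) hF hG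

variable [IsFiniteMeasure μ]

lemma norm_toL1_act_le (hstat : P.IsStationary μ) (t : ℝ≥0) (F : suitableFun A E) :
    ‖toL1 hA (act hA t F)‖ ≤ ‖toL1 hA F‖ := by
  have hF := memLp_one_iff_integrable.2 (integrable hA F)
  change ‖(memLp_one_iff_integrable.2 (integrable hA (act hA t F))).toLp _‖ ≤ ‖hF.toLp _‖
  rw [Lp.norm_toLp, Lp.norm_toLp]
  exact ENNReal.toReal_mono hF.eLpNorm_ne_top
    (eLpNorm_act_le hstat le_rfl ENNReal.one_ne_top t hF)

variable (τ : E →L[ℝ] ℝ) {K : Ω → E} (hK : IsBoundedMeasurable K)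

/-- The functional `F ↦ ∫ τ(P_s F · K) dμ`. -/
def pairing (s : ℝ) : suitableFun A E →ₗ[ℝ] ℝ :=
  (pairL2 μ τ hK).toLinearMap ∘ₗ toL2 hA ∘ₗ act hA s.toNNReal

lemma pairing_eq_pairL2_flow (s : ℝ) (F : suitableFun A E) :
    pairing hA τ hK s F = pairL2 μ τ hK (flow hA s F) := rfl

lemma pairing_apply (s : ℝ) (F : suitableFun A E) :
    pairing hA τ hK s F = ∫ z, τ (P.act s.toNNReal F.1 z * K z) ∂μ := by
  change (mulForm τ).lpPairing μ 2 2 (toL2 hA (act hA s.toNNReal F)) ((hK.memLp 2).toLp K) = _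
  rw [ContinuousLinearMap.lpPairing_eq_integral]
  refine integral_congr_ae ?_
  filter_upwards [(memLp_two hA (act hA s.toNNReal F)).coeFn_toLp, (hK.memLp 2).coeFn_toLp]
    with z hF hK
  exact congr_arg₂ (mulForm τ · ·) hF hK

lemma pairing_eq_integral_mul_act (hrev : P.IsReversible μ) (s : ℝ) (F : suitableFun A E) :
    pairing hA τ hK s F = ∫ z, τ (F.1 z * P.act s.toNNReal K z) ∂μ := by
  rw [pairing_apply, IsBoundedMeasurable.integral_act_mul_eq_integral_mul_act τ hrev _
    (integrable hA F) hK]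

lemma pairing_congr_ae (hstat : P.IsStationary μ) (s : ℝ) {F G : suitableFun A E}
    (h : F.1 =ᵐ[μ] G.1) : pairing hA τ hK s F = pairing hA τ hK s G := by
  rw [pairing_apply, pairing_apply]
  refine integral_congr_ae ?_
  filter_upwards [act_congr_ae hA hstat h s.toNNReal] with z hz
  exact congr_arg (fun X => τ (X * K z)) hz

variable (hstat : P.IsStationary μ)

include hstat in
lemma exists_abs_pairing_le :
    ∃ C, ∀ s (F : suitableFun A E), |pairing hA τ hK s F| ≤ C * ‖toL1 hA F‖ := by
  obtain ⟨C, hC⟩ := hK.bounded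
  rcases isEmpty_or_nonempty Ω with hΩ | ⟨⟨z₀⟩⟩
  · refine ⟨0, fun s F => ?_⟩
    simp [pairing_apply, Measure.eq_zero_of_isEmpty μ]
  have hC₀ : 0 ≤ C := (norm_nonneg _).trans (hC z₀)
  refine ⟨‖τ‖ * C, fun s F => ?_⟩
  refine le_trans ?_ (mul_le_mul_of_nonneg_left (norm_toL1_act_le hA hstat s.toNNReal F)
    (mul_nonneg (norm_nonneg τ) hC₀))
  rw [norm_toL1, ← integral_const_mul, pairing_apply, ← Real.norm_eq_abs]
  refine norm_integral_le_of_norm_le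
    ((integrable hA (act hA s.toNNReal F)).norm.const_mul _) (Eventually.of_forall fun z => ?_)
  calc ‖τ (P.act s.toNNReal F.1 z * K z)‖
      ≤ ‖τ‖ * (‖P.act s.toNNReal F.1 z‖ * ‖K z‖) :=
        (τ.le_opNorm _).trans (by gcongr; exact norm_mul_le _ _)
    _ ≤ ‖τ‖ * (‖P.act s.toNNReal F.1 z‖ * C) := by gcongr; exact hC z
    _ = ‖τ‖ * C * ‖P.act s.toNNReal F.1 z‖ := by ring

include hstat in
lemma continuous_pairing (F : suitableFun A E) : Continuous fun s => pairing hA τ hK s F := by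
  simp only [pairing_eq_pairL2_flow]
  exact (pairL2 μ τ hK).continuous.comp (continuous_flow hA hstat F)

include hstat in
lemma hasDerivAt_pairing (F : suitableFun A E) {s : ℝ} (hs : 0 < s) :
    HasDerivAt (fun r => pairing hA τ hK r F) (pairing hA τ hK s (gen hA F)) s := by
  simp only [pairing_eq_pairL2_flow]
  exact (pairL2 μ τ hK).hasFDerivAt.comp_hasDerivAt s
    (hasDerivAt_flow hA hstat F hs)

/-- The increment of the pairings with `P_s F` over the time interval `[s, s + ε]`. -/
def increment (ε s : ℝ) : suitableFun A E →ₗ[ℝ] ℝ :=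
  pairing hA τ hK (s + ε) - pairing hA τ hK s

/-- The time average `F ↦ ∫_s^{s + ε} ∫ τ(P_ρ F · K) dμ dρ`. -/
def timeAverage (ε s : ℝ) : suitableFun A E →ₗ[ℝ] ℝ where
  toFun F := ∫ ρ in s..(s + ε), pairing hA τ hK ρ F
  map_add' F G := by
    simp only [map_add]
    exact intervalIntegral.integral_add
      ((continuous_pairing hA τ hK hstat F).intervalIntegrable _ _)
      ((continuous_pairing hA τ hK hstat G).intervalIntegrable _ _)
  map_smul' c F := by
    simp only [map_smul, smul_eq_mul, RingHom.id_apply]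
    exact intervalIntegral.integral_const_mul _ _

lemma timeAverage_congr_ae (ε s : ℝ) {F G : suitableFun A E} (h : F.1 =ᵐ[μ] G.1) :
    timeAverage hA τ hK hstat ε s F = timeAverage hA τ hK hstat ε s G := by
  change ∫ ρ in s..(s + ε), _ = ∫ ρ in s..(s + ε), _
  simp only [pairing_congr_ae hA τ hK hstat _ h]

lemma timeAverage_gen {ε s : ℝ} (hε : 0 ≤ ε) (hs : 0 ≤ s) (F : suitableFun A E) :
    timeAverage hA τ hK hstat ε s (gen hA F) = increment hA τ hK ε s F :=
  intervalIntegral.integral_eq_sub_of_hasDerivAt_of_le (by linarith)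
    (continuous_pairing hA τ hK hstat F).continuousOn
    (fun x hx => hasDerivAt_pairing hA τ hK hstat F (hs.trans_lt hx.1))
    ((continuous_pairing hA τ hK hstat _).intervalIntegrable _ _)

lemma hasDerivAt_timeAverage (ε s : ℝ) (F : suitableFun A E) :
    HasDerivAt (fun r => timeAverage hA τ hK hstat ε r F) (increment hA τ hK ε s F) s := by
  have hc := continuous_pairing hA τ hK hstat F
  have hprim (u : ℝ) : HasDerivAt (fun r => ∫ ρ in (0 : ℝ)..r, pairing hA τ hK ρ F)
      (pairing hA τ hK u F) u :=
    intervalIntegral.integral_hasDerivAt_right (hc.intervalIntegrable _ _)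
      (hc.stronglyMeasurableAtFilter _ _) hc.continuousAt
  refine (((hprim (s + ε)).comp_add_const s ε).sub (hprim s)).congr_of_eventuallyEq
    (Eventually.of_forall fun r => ?_)
  exact (intervalIntegral.integral_interval_sub_left (hc.intervalIntegrable _ _)
    (hc.intervalIntegrable _ _)).symm

lemma continuous_timeAverage (ε : ℝ) (F : suitableFun A E) :
    Continuous fun s => timeAverage hA τ hK hstat ε s F :=
  continuous_iff_continuousAt.2 fun s => (hasDerivAt_timeAverage hA τ hK hstat ε s F).continuousAt

lemma exists_abs_timeAverage_le (ε : ℝ) :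
    ∃ C, ∀ s (F : suitableFun A E), |timeAverage hA τ hK hstat ε s F| ≤ C * ‖toL1 hA F‖ := by
  obtain ⟨C, hC⟩ := exists_abs_pairing_le (A := A) hA τ hK hstat
  refine ⟨C * |ε|, fun s F => ?_⟩
  change ‖∫ ρ in s..(s + ε), pairing hA τ hK ρ F‖ ≤ _
  refine (intervalIntegral.norm_integral_le_of_norm_le_const fun r _ => hC r F).trans_eq ?_
  rw [add_sub_cancel_left]
  ring

include hstat in
lemma continuous_increment (ε : ℝ) (F : suitableFun A E) :
    Continuous fun s => increment hA τ hK ε s F :=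
  ((continuous_pairing hA τ hK hstat F).comp (continuous_add_const ε)).sub
    (continuous_pairing hA τ hK hstat F)

include hstat in
lemma hasDerivAt_increment {ε s : ℝ} (hε : 0 ≤ ε) (hs : 0 < s) (F : suitableFun A E) :
    HasDerivAt (fun r => increment hA τ hK ε r F) (increment hA τ hK ε s (gen hA F)) s :=
  ((hasDerivAt_pairing hA τ hK hstat F (add_pos_of_pos_of_nonneg hs hε)).comp_add_const s ε).sub
    (hasDerivAt_pairing hA τ hK hstat F hs)

include hstat in
lemma exists_abs_increment_le (ε : ℝ) :
    ∃ C, ∀ s (F : suitableFun A E), |increment hA τ hK ε s F| ≤ C * ‖toL1 hA F‖ := by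
  obtain ⟨C, hC⟩ := exists_abs_pairing_le (A := A) hA τ hK hstat
  refine ⟨2 * C, fun s F => (abs_sub _ _).trans ?_⟩
  linarith [hC (s + ε) F, hC s F]

end suitableFun

end Pairing

lemma le_exp_mul_of_hasDerivAt {V V' : ℝ → ℝ} {κ t : ℝ} (ht : 0 ≤ t)
    (hV : ContinuousOn V (Set.Icc 0 t)) (hV' : ∀ r ∈ Set.Ioo 0 t, HasDerivAt V (V' r) r)
    (hle : ∀ r ∈ Set.Ioo 0 t, κ * V r ≤ V' r) : V 0 ≤ Real.exp (-(κ * t)) * V t := by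
  have hexp (r : ℝ) : HasDerivAt (fun r => Real.exp (-(κ * r))) (Real.exp (-(κ * r)) * -κ) r := by
    simpa using ((hasDerivAt_id r).const_mul κ).neg.exp
  have hmono : MonotoneOn (fun r => Real.exp (-(κ * r)) * V r) (Set.Icc 0 t) := by
    refine monotoneOn_of_hasDerivWithinAt_nonneg (convex_Icc 0 t)
      (f' := fun r => Real.exp (-(κ * r)) * -κ * V r + Real.exp (-(κ * r)) * V' r)
      (ContinuousOn.mul (by fun_prop) hV) (fun r hr => ?_) fun r hr => ?_
    all_goals rw [interior_Icc] at hr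
    · exact ((hexp r).mul (hV' r hr)).hasDerivWithinAt
    · rw [mul_assoc, ← mul_add]
      exact mul_nonneg (Real.exp_pos _).le (by linarith [hle r hr])
  simpa using hmono (Set.left_mem_Icc.2 ht) (Set.right_mem_Icc.2 ht) ht

section BackwardFlow

variable {Ω : Type*} [MeasurableSpace Ω] {μ : Measure Ω} {P : MarkovSemigroup Ω}
  {A : Subalgebra ℝ (Ω → ℝ)}
  {E : Type*} [NormedRing E] [NormedAlgebra ℝ E] [FiniteDimensional ℝ E]

namespace suitableFun

variable (hA : P.IsSuitableAlgebra μ A)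

/-- The iterated carré du champ `Γ₂(F) = Γ₂(F, F)` on suitable functions. -/
def gamma₂ (F : suitableFun A E) : suitableFun A E :=
  (1 / 2 : ℝ) • (gen hA (gamma hA F F) - gamma hA F (gen hA F) - gamma hA (gen hA F) F)

/-- The orbit of the semigroup run backwards from time `t`, that is, `F ↦ P_{t - r} F`. -/
def backward (t r : ℝ) : suitableFun A E →ₗ[ℝ] suitableFun A E := act hA (t - r).toNNReal

lemma backward_zero (t : ℝ≥0) (F : suitableFun A E) : backward hA t 0 F = act hA t F := by
  rw [backward, sub_zero, Real.toNNReal_coe]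

lemma backward_self (t : ℝ) (F : suitableFun A E) : backward hA t t F = F := by
  rw [backward, sub_self, Real.toNNReal_zero, act_zero]

lemma toL1_backward_mul (t r : ℝ) (F G : suitableFun A E) :
    toL1 hA (backward hA t r F * backward hA t r G) =
      (ContinuousLinearMap.mul ℝ E).holderL μ 2 2 1 (flow hA (t - r) F) (flow hA (t - r) G) :=
  (holderL_toL2 hA _ _).symm

variable [IsFiniteMeasure μ] (hstat : P.IsStationary μ)

include hstat in
lemma gen_backward_ae_eq (t r : ℝ) (F : suitableFun A E) :
    (gen hA (backward hA t r F)).1 =ᵐ[μ] (backward hA t r (gen hA F)).1 :=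
  gen_act_ae_eq hA hstat _ F

include hstat in
lemma continuous_toL1_backward_mul (t : ℝ) (F G : suitableFun A E) :
    Continuous fun r => toL1 hA (backward hA t r F * backward hA t r G) := by
  simp only [toL1_backward_mul]
  have hF := (continuous_flow hA hstat F).comp (continuous_sub_left t)
  have hG := (continuous_flow hA hstat G).comp (continuous_sub_left t)
  exact (((ContinuousLinearMap.mul ℝ E).holderL μ 2 2 1).continuous.comp hF).clm_apply hG

include hstat in
lemma hasDerivAt_toL1_backward_mul {t r : ℝ} (hr : r < t) (F G : suitableFun A E) :
    HasDerivAt (fun r => toL1 hA (backward hA t r F * backward hA t r G))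
      (toL1 hA (-(backward hA t r (gen hA F) * backward hA t r G
        + backward hA t r F * backward hA t r (gen hA G)))) r := by
  simp only [map_neg, map_add, toL1_backward_mul]
  have hF := HasDerivAt.comp_const_sub t r (hasDerivAt_flow hA hstat F (sub_pos.2 hr))
  have hG := HasDerivAt.comp_const_sub t r (hasDerivAt_flow hA hstat G (sub_pos.2 hr))
  refine (((ContinuousLinearMap.mul ℝ E).holderL μ 2 2 1).hasDerivAt_of_bilinear
    (u := fun r => flow hA (t - r) F) (v := fun r => flow hA (t - r) G)
    (fun _ => hF) (fun _ => hG)).congr_deriv ?_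
  rw [map_neg, map_neg, neg_apply, neg_add, add_comm]

section Identities

variable {a b e : suitableFun A E} (hb : (gen hA a).1 =ᵐ[μ] b.1)
include hb

omit [IsFiniteMeasure μ] in
lemma gamma_ae_eq :
    (gamma hA a a).1 =ᵐ[μ] ((1 / 2 : ℝ) • (gen hA (a * a) - (a * b + b * a))).1 := by
  filter_upwards [hb] with z hz
  change (1 / 2 : ℝ) • ((gen hA (a * a)).1 z - a.1 z * (gen hA a).1 z - (gen hA a).1 z * a.1 z)
    = (1 / 2 : ℝ) • ((gen hA (a * a)).1 z - (a.1 z * b.1 z + b.1 z * a.1 z))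
  rw [hz, sub_sub]

include hstat in
lemma gamma₂_ae_eq (he : (gen hA b).1 =ᵐ[μ] e.1) :
    (gamma₂ hA a).1 =ᵐ[μ] ((1 / 4 : ℝ) • (gen hA (gen hA (a * a))
      - (2 : ℝ) • gen hA (a * b + b * a) + ((a * e + b * b) + (b * b + e * a)))).1 := by
  have hgamma : (gen hA (gamma hA a a)).1 =ᵐ[μ]
      ((1 / 2 : ℝ) • (gen hA (gen hA (a * a)) - gen hA (a * b + b * a))).1 := by
    rw [← map_sub, ← map_smul]
    exact gen_congr_ae hA hstat (gamma_ae_eq hA hb)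
  have hleft : (gen hA (a * gen hA a)).1 =ᵐ[μ] (gen hA (a * b)).1 :=
    gen_congr_ae hA hstat ((ae_eq_refl a.1).mul hb)
  have hright : (gen hA (gen hA a * a)).1 =ᵐ[μ] (gen hA (b * a)).1 :=
    gen_congr_ae hA hstat (hb.mul (ae_eq_refl a.1))
  have hgen : (gen hA (gen hA a)).1 =ᵐ[μ] e.1 := (gen_congr_ae hA hstat hb).trans he
  rw [map_add] at hgamma ⊢
  filter_upwards [hb, hgamma, hleft, hright, hgen] with z hbz hgammaz hleftz hrightz hgenz
  change (1 / 2 : ℝ) • ((gen hA (gamma hA a a)).1 z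
    - (1 / 2 : ℝ) • ((gen hA (a * gen hA a)).1 z - a.1 z * (gen hA (gen hA a)).1 z
      - (gen hA a).1 z * (gen hA a).1 z)
    - (1 / 2 : ℝ) • ((gen hA (gen hA a * a)).1 z - (gen hA a).1 z * (gen hA a).1 z
      - (gen hA (gen hA a)).1 z * a.1 z)) =
    (1 / 4 : ℝ) • ((gen hA (gen hA (a * a))).1 z
      - (2 : ℝ) • ((gen hA (a * b)).1 z + (gen hA (b * a)).1 z)
      + ((a.1 z * e.1 z + b.1 z * b.1 z) + (b.1 z * b.1 z + e.1 z * a.1 z)))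
  rw [hbz, hgammaz, hleftz, hrightz, hgenz]
  change (1 / 2 : ℝ) • ((1 / 2 : ℝ) • ((gen hA (gen hA (a * a))).1 z
    - ((gen hA (a * b)).1 z + (gen hA (b * a)).1 z)) - _ - _) = _
  module

end Identities

variable (τ : E →L[ℝ] ℝ) {K : Ω → E} (hK : IsBoundedMeasurable K)

/-- The time average over `[r, r + ε]` of `Γ(P_{t - r} F)`, in the form in which it can be
differentiated in `r`: the generator of the square is integrated in time, and becomes an
increment. -/
def smoothedGamma (ε t : ℝ) (F : suitableFun A E) (r : ℝ) : ℝ :=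
  1 / 2 * (increment hA τ hK ε r (backward hA t r F * backward hA t r F)
    - timeAverage hA τ hK hstat ε r (backward hA t r F * backward hA t r (gen hA F)
      + backward hA t r (gen hA F) * backward hA t r F))

lemma smoothedGamma_eq_timeAverage {ε r : ℝ} (hε : 0 ≤ ε) (hr : 0 ≤ r) (t : ℝ)
    (F : suitableFun A E) :
    smoothedGamma hA hstat τ hK ε t F r
      = timeAverage hA τ hK hstat ε r (gamma hA (backward hA t r F) (backward hA t r F)) := by
  rw [timeAverage_congr_ae hA τ hK hstat ε r (gamma_ae_eq hA (gen_backward_ae_eq hA hstat t r F)),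
    map_smul, map_sub, timeAverage_gen hA τ hK hstat hε hr, smul_eq_mul, smoothedGamma]

lemma continuous_smoothedGamma (ε t : ℝ) (F : suitableFun A E) :
    Continuous (smoothedGamma hA hstat τ hK ε t F) := by
  obtain ⟨C, hC⟩ := exists_abs_increment_le (A := A) hA τ hK hstat ε
  obtain ⟨C', hC'⟩ := exists_abs_timeAverage_le (A := A) hA τ hK hstat ε
  refine continuous_const.mul (.sub ?_ ?_)
  · exact continuous_movingFunctional hC (continuous_toL1_backward_mul hA hstat t F F)
      (continuous_increment hA τ hK hstat ε)
  · refine continuous_movingFunctional hC' ?_ (continuous_timeAverage hA τ hK hstat ε)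
    simp only [map_add]
    exact (continuous_toL1_backward_mul hA hstat t F _).add
      (continuous_toL1_backward_mul hA hstat t _ F)

lemma hasDerivAt_smoothedGamma {ε t r : ℝ} (hε : 0 ≤ ε) (hr : 0 < r) (hrt : r < t)
    (F : suitableFun A E) :
    HasDerivAt (smoothedGamma hA hstat τ hK ε t F)
      (2 * timeAverage hA τ hK hstat ε r (gamma₂ hA (backward hA t r F))) r := by
  obtain ⟨C, hC⟩ := exists_abs_increment_le (A := A) hA τ hK hstat ε
  obtain ⟨C', hC'⟩ := exists_abs_timeAverage_le (A := A) hA τ hK hstat ε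
  let a := fun r => backward hA t r F
  let b := fun r => backward hA t r (gen hA F)
  let e := fun r => backward hA t r (gen hA (gen hA F))
  have hsq : HasDerivAt (fun r => toL1 hA (a r * a r))
      (toL1 hA (-(b r * a r + a r * b r))) r := hasDerivAt_toL1_backward_mul hA hstat hrt F F
  have hcross : HasDerivAt (fun r => toL1 hA (a r * b r + b r * a r))
      (toL1 hA (-((b r * b r + a r * e r) + (e r * a r + b r * b r)))) r := by
    simp only [neg_add (b r * b r + _), map_add (toL1 hA)]
    exact (hasDerivAt_toL1_backward_mul hA hstat hrt F _).add
      (hasDerivAt_toL1_backward_mul hA hstat hrt _ F)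
  have hincrement := hasDerivAt_movingFunctional hC hsq
    ((continuous_increment hA τ hK hstat ε _).tendsto r)
    (hasDerivAt_increment hA τ hK hstat hε hr (a r * a r))
  have haverage := hasDerivAt_movingFunctional hC' hcross
    ((continuous_timeAverage hA τ hK hstat ε _).tendsto r)
    (hasDerivAt_timeAverage hA τ hK hstat ε r (a r * b r + b r * a r))
  refine ((hincrement.sub haverage).const_mul (1 / 2)).congr_deriv ?_
  rw [timeAverage_congr_ae hA τ hK hstat ε r (gamma₂_ae_eq hA hstat
    (gen_backward_ae_eq hA hstat t r F) (gen_backward_ae_eq hA hstat t r (gen hA F)))]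
  simp only [← timeAverage_gen hA τ hK hstat hε hr.le, map_add, map_sub, map_neg, map_smul,
    smul_eq_mul, a, b, e]
  ring

lemma timeAverage_gamma_act_le {ε κ : ℝ} (hε : 0 ≤ ε) {t : ℝ≥0} {F : suitableFun A E}
    (h : ∀ r ∈ Set.Ioo (0 : ℝ) t,
      κ * timeAverage hA τ hK hstat ε r (gamma hA (backward hA t r F) (backward hA t r F))
        ≤ 2 * timeAverage hA τ hK hstat ε r (gamma₂ hA (backward hA t r F))) :
    timeAverage hA τ hK hstat ε 0 (gamma hA (act hA t F) (act hA t F))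
      ≤ Real.exp (-(κ * t)) * timeAverage hA τ hK hstat ε t (gamma hA F F) := by
  have hV {r : ℝ} (hr : 0 ≤ r) := smoothedGamma_eq_timeAverage hA hstat τ hK hε hr t F
  have hle := le_exp_mul_of_hasDerivAt (κ := κ) t.coe_nonneg
    (continuous_smoothedGamma hA hstat τ hK ε t F).continuousOn
    (fun r hr => hasDerivAt_smoothedGamma hA hstat τ hK hε hr.1 hr.2 F)
    fun r hr => (hV hr.1.le).symm ▸ h r hr
  rwa [hV le_rfl, hV t.coe_nonneg, backward_zero, backward_self] at hle

/-- A differential inequality `κ Γ ≤ 2 Γ₂` along the orbit, tested against `K` on short time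
intervals, makes `Γ` contract exponentially along the semigroup. -/
lemma pairing_gamma_act_le {κ : ℝ} {t : ℝ≥0} {F : suitableFun A E}
    (h : ∀ ε > 0, ∀ r ∈ Set.Ioo (0 : ℝ) t,
      κ * timeAverage hA τ hK hstat ε r (gamma hA (backward hA t r F) (backward hA t r F))
        ≤ 2 * timeAverage hA τ hK hstat ε r (gamma₂ hA (backward hA t r F))) :
    pairing hA τ hK 0 (gamma hA (act hA t F) (act hA t F))
      ≤ Real.exp (-(κ * t)) * pairing hA τ hK t (gamma hA F F) := by
  have hcont := continuous_pairing hA τ hK hstat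
  have hle := le_of_forall_integral_le (hcont (gamma hA (act hA t F) (act hA t F)))
    (((hcont (gamma hA F F)).comp (continuous_add_const (t : ℝ))).const_mul
      (Real.exp (-(κ * t)))) fun ε hε => by
    have hε_le := timeAverage_gamma_act_le hA hstat τ hK hε.le (h ε hε)
    change ∫ u in (0 : ℝ)..(0 + ε), _ ≤ _ * ∫ u in (t : ℝ)..(t + ε), _ at hε_le
    rw [zero_add] at hε_le
    simp only [Function.comp_apply]
    rwa [intervalIntegral.integral_const_mul,
      intervalIntegral.integral_comp_add_right (pairing hA τ hK · _), zero_add, add_comm ε]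
  simpa only [Function.comp_apply, zero_add] using hle

end suitableFun

end BackwardFlow

section PositiveWeights

variable {Ω : Type*} [MeasurableSpace Ω] {μ : Measure Ω} {P : MarkovSemigroup Ω}
  {n : Type*} [Fintype n] [DecidableEq n]

/-- A bounded measurable matrix weight `K ≽ 0`, with positivity expressed by duality, against
positive semidefinite matrices. -/
structure IsPosWeight (K : Ω → Matrix n n ℂ) : Prop extends IsBoundedMeasurable K where
  nonneg : ∀ z (X : Matrix n n ℂ), X.PosSemidef → 0 ≤ reTrace (X * K z)

lemma IsPosWeight.act {K : Ω → Matrix n n ℂ} (hK : IsPosWeight K) (P : MarkovSemigroup Ω)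
    (t : ℝ≥0) : IsPosWeight (P.act t K) where
  toIsBoundedMeasurable := hK.toIsBoundedMeasurable.act P t
  nonneg z X hX := by
    have := P.isMarkovKernel t
    have h := ((mulForm reTrace) X).integral_comp_comm (hK.integrable (ν := P.kernel t z))
    exact (integral_nonneg fun y => hK.nonneg y X hX).trans_eq h

namespace suitableFun

variable {A : Subalgebra ℝ (Ω → ℝ)} [IsFiniteMeasure μ]
  (hA : P.IsSuitableAlgebra μ A) (hstat : P.IsStationary μ) (hrev : P.IsReversible μ)
  {K : Ω → Matrix n n ℂ} (hK : IsPosWeight K)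
include hrev

lemma pairing_nonneg (s : ℝ) {F : suitableFun A (Matrix n n ℂ)}
    (hF : ∀ᵐ z ∂μ, (F.1 z).PosSemidef) :
    0 ≤ pairing hA reTrace hK.toIsBoundedMeasurable s F := by
  rw [pairing_eq_integral_mul_act hA _ _ hrev]
  refine integral_nonneg_of_ae ?_
  filter_upwards [hF] with z hz
  exact (hK.act P s.toNNReal).nonneg z _ hz

lemma timeAverage_nonneg {ε : ℝ} (hε : 0 ≤ ε) (s : ℝ) {F : suitableFun A (Matrix n n ℂ)}
    (hF : ∀ᵐ z ∂μ, (F.1 z).PosSemidef) :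
    0 ≤ timeAverage hA reTrace hK.toIsBoundedMeasurable hstat ε s F :=
  intervalIntegral.integral_nonneg (by linarith) fun r _ => pairing_nonneg hA hrev hK r hF

end suitableFun

end PositiveWeights

section SuitableMatrices

variable {Ω : Type*} {A : Subalgebra ℝ (Ω → ℝ)} {d : ℕ}

lemma isHermitian_integral [MeasurableSpace Ω] {ν : Measure Ω} {n : Type*} [Fintype n]
    [DecidableEq n] {f : Ω → Matrix n n ℂ} (hf : ∀ z, (f z).IsHermitian) :
    (∫ z, f z ∂ν).IsHermitian := by
  have hstar := (starL' ℝ : Matrix n n ℂ ≃L[ℝ] Matrix n n ℂ).integral_comp_comm (μ := ν) f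
  exact hstar.symm.trans (integral_congr_ae (Eventually.of_forall hf))

lemma eq_sum_single_re_im {m n : Type*} [Fintype m] [Fintype n] [DecidableEq m] [DecidableEq n]
    (X : Matrix m n ℂ) :
    X = ∑ i, ∑ j, ((X i j).re • Matrix.single i j (1 : ℂ)
      + (X i j).im • Matrix.single i j Complex.I) := by
  conv_lhs => rw [Matrix.matrix_eq_sum_single X]
  refine Finset.sum_congr rfl fun i _ => Finset.sum_congr rfl fun j _ => ?_
  rw [Matrix.smul_single, Matrix.smul_single, ← Matrix.single_add, Complex.real_smul,
    Complex.real_smul, mul_one, Complex.re_add_im]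

lemma isSuitable_iff {f : Ω → Matrix (Fin d) (Fin d) ℂ} :
    IsSuitable A f ↔
      (∀ z, (f z).IsHermitian) ∧ f ∈ suitableFun A (Matrix (Fin d) (Fin d) ℂ) := by
  refine ⟨fun h => ⟨h.isHermitian, fun ℓ => ?_⟩, fun h => ⟨h.1,
    fun i j => h.2 (Complex.reLm ∘ₗ Matrix.entryLinearMap ℝ ℂ i j).toContinuousLinearMap,
    fun i j => h.2 (Complex.imLm ∘ₗ Matrix.entryLinearMap ℝ ℂ i j).toContinuousLinearMap⟩⟩
  have hℓ : (fun z => ℓ (f z)) =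
      ∑ i, ∑ j, (ℓ (Matrix.single i j (1 : ℂ)) • (fun z => (f z i j).re)
        + ℓ (Matrix.single i j Complex.I) • (fun z => (f z i j).im)) := by
    ext z
    conv_lhs => rw [eq_sum_single_re_im (f z)]
    simp only [map_sum, map_add, map_smul, Finset.sum_apply, Pi.add_apply, Pi.smul_apply,
      smul_eq_mul, mul_comm]
  rw [hℓ]
  exact A.sum_mem fun i _ => A.sum_mem fun j _ =>
    A.add_mem (A.smul_mem (h.re_mem i j) _) (A.smul_mem (h.im_mem i j) _)

lemma IsSuitable.neg {f : Ω → Matrix (Fin d) (Fin d) ℂ} (hf : IsSuitable A f) :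
    IsSuitable A (-f) :=
  isSuitable_iff.2 ⟨fun z => (hf.isHermitian z).neg, neg_mem (isSuitable_iff.1 hf).2⟩

variable [MeasurableSpace Ω] {μ : Measure Ω} {P : MarkovSemigroup Ω}

lemma IsSuitable.act (hA : P.IsSuitableAlgebra μ A) {f : Ω → Matrix (Fin d) (Fin d) ℂ}
    (hf : IsSuitable A f) (t : ℝ≥0) : IsSuitable A (P.act t f) :=
  isSuitable_iff.2 ⟨fun _ => isHermitian_integral hf.isHermitian,
    (suitableFun.act hA t ⟨f, (isSuitable_iff.1 hf).2⟩).2⟩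

end SuitableMatrices

section GradientBound

variable {Ω : Type*} [MeasurableSpace Ω] {μ : Measure Ω} [IsFiniteMeasure μ]
  {P : MarkovSemigroup Ω} {A : Subalgebra ℝ (Ω → ℝ)} {d : ℕ} {c : ℝ}
  (hA : P.IsSuitableAlgebra μ A) {K : Ω → Matrix (Fin d) (Fin d) ℂ}

namespace suitableFun

variable {F : suitableFun A (Matrix (Fin d) (Fin d) ℂ)}

lemma timeAverage_gamma_le (hBE : BakryEmery P μ A d c) (hc : 0 < c) (hF : IsSuitable A F.1)
    (hstat : P.IsStationary μ) (hrev : P.IsReversible μ) (hK : IsPosWeight K) {ε : ℝ}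
    (hε : 0 ≤ ε) (r : ℝ) :
    2 / c * timeAverage hA reTrace hK.toIsBoundedMeasurable hstat ε r (gamma hA F F)
      ≤ 2 * timeAverage hA reTrace hK.toIsBoundedMeasurable hstat ε r (gamma₂ hA F) := by
  have hnonneg : 0 ≤ timeAverage hA reTrace hK.toIsBoundedMeasurable hstat ε r
      (c • gamma₂ hA F - gamma hA F F) :=
    timeAverage_nonneg hA hstat hrev hK hε r (hBE F.1 hF)
  rw [map_sub, map_smul, smul_eq_mul] at hnonneg
  rw [div_mul_eq_mul_div, div_le_iff₀ hc]
  linarith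

end suitableFun

include hA in
/-- The gradient bound `Γ(P_t f) ≼ e^{-2t/c} P_t Γ(f)`, in weak form. -/
lemma integral_reTrace_gamma_act_mul_le (hBE : BakryEmery P μ A d c) (hc : 0 < c)
    {f : Ω → Matrix (Fin d) (Fin d) ℂ} (hf : IsSuitable A f) (hrev : P.IsReversible μ)
    (hK : IsPosWeight K) (t : ℝ≥0) :
    ∫ z, reTrace (P.gamma (P.act t f) (P.act t f) z * K z) ∂μ
      ≤ Real.exp (-(2 / c * t)) * ∫ z, reTrace (P.gamma f f z * P.act t K z) ∂μ := by
  have hle := suitableFun.pairing_gamma_act_le hA hrev.isStationary reTrace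
    hK.toIsBoundedMeasurable (κ := 2 / c) (t := t) (F := ⟨f, (isSuitable_iff.1 hf).2⟩)
    fun ε hε r _ => suitableFun.timeAverage_gamma_le hA hBE hc (hf.act hA (t - r).toNNReal)
      hrev.isStationary hrev hK hε.le r
  simp only [suitableFun.pairing_eq_integral_mul_act hA _ _ hrev, Real.toNNReal_zero,
    Real.toNNReal_coe, P.act_zero hK.stronglyMeasurable] at hle
  exact hle

end GradientBound

section TruncatedExponential

/-- The truncated exponential `x ↦ exp (θ min(x, k))`, a bounded substitute for `x ↦ exp (θ x)`. -/
def truncExp (k θ x : ℝ) : ℝ := Real.exp (θ * min x k)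

lemma truncExp_nonneg (k θ x : ℝ) : 0 ≤ truncExp k θ x := (Real.exp_pos _).le

lemma continuous_truncExp (k θ : ℝ) : Continuous (truncExp k θ) := by
  unfold truncExp
  fun_prop

lemma truncExp_le (k : ℝ) {θ : ℝ} (hθ : 0 ≤ θ) (x : ℝ) : truncExp k θ x ≤ Real.exp (θ * k) :=
  Real.exp_le_exp.2 (mul_le_mul_of_nonneg_left (min_le_right _ _) hθ)

lemma exp_sub_one_le {w : ℝ} (hw : 0 ≤ w) : Real.exp w - 1 ≤ w * (Real.exp w + 1) / 2 := by
  have hderiv (x : ℝ) : HasDerivAt (fun w => w * (Real.exp w + 1) / 2 - (Real.exp w - 1))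
      ((1 * (Real.exp x + 1) + x * Real.exp x) / 2 - Real.exp x) x :=
    (((hasDerivAt_id x).mul ((Real.hasDerivAt_exp x).add_const 1)).div_const 2).sub
      ((Real.hasDerivAt_exp x).sub_const 1)
  have hmono : Monotone fun w : ℝ => w * (Real.exp w + 1) / 2 - (Real.exp w - 1) := by
    refine monotone_of_deriv_nonneg (fun x => (hderiv x).differentiableAt) fun x => ?_
    rw [(hderiv x).deriv]
    have h1 := Real.add_one_le_exp (-x)
    have h2 : Real.exp x * Real.exp (-x) = 1 := by
      rw [← Real.exp_add, add_neg_cancel, Real.exp_zero]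
    nlinarith [Real.exp_pos x]
  have h := hmono hw
  simp only [zero_mul, Real.exp_zero, zero_div, sub_self] at h
  linarith

lemma abs_exp_sub_exp_le (u v : ℝ) :
    |Real.exp u - Real.exp v| ≤ |u - v| * ((Real.exp u + Real.exp v) / 2) := by
  wlog h : v ≤ u generalizing u v
  · have := this v u (le_of_not_ge h)
    rwa [abs_sub_comm, abs_sub_comm u v, add_comm (Real.exp u)]
  rw [abs_of_nonneg (sub_nonneg.2 (Real.exp_le_exp.2 h)), abs_of_nonneg (sub_nonneg.2 h)]
  have h1 := exp_sub_one_le (sub_nonneg.2 h)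
  have h2 : Real.exp u = Real.exp v * Real.exp (u - v) := by rw [← Real.exp_add, add_sub_cancel]
  rw [h2]
  nlinarith [Real.exp_pos v]

lemma abs_truncExp_sub_le (k : ℝ) {θ : ℝ} (hθ : 0 ≤ θ) (x y : ℝ) :
    |truncExp k θ x - truncExp k θ y|
      ≤ |x - y| * ((θ * truncExp k θ x + θ * truncExp k θ y) / 2) := by
  have hmin : |min x k - min y k| ≤ |x - y| := by
    simpa only [sub_self, abs_zero, max_eq_left (abs_nonneg (x - y))]
      using abs_min_sub_min_le_max x k y k
  calc |truncExp k θ x - truncExp k θ y|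
      ≤ |θ * min x k - θ * min y k| * ((truncExp k θ x + truncExp k θ y) / 2) :=
        abs_exp_sub_exp_le _ _
    _ = θ * |min x k - min y k| * ((truncExp k θ x + truncExp k θ y) / 2) := by
        rw [← mul_sub, abs_mul, abs_of_nonneg hθ]
    _ ≤ θ * |x - y| * ((truncExp k θ x + truncExp k θ y) / 2) := by
        gcongr
        linarith [truncExp_nonneg k θ x, truncExp_nonneg k θ y]
    _ = |x - y| * ((θ * truncExp k θ x + θ * truncExp k θ y) / 2) := by ring

end TruncatedExponential

section Increments

variable {Ω : Type*} [MeasurableSpace Ω] {μ : Measure Ω} [IsFiniteMeasure μ] {P : MarkovSemigroup Ω}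
  {E : Type*} [NormedRing E] [NormedAlgebra ℝ E] (τ : E →L[ℝ] ℝ)

/-- The squared increment `(F y - F z)²` of a function between two points, as a function of
`(z, y)`. -/
def sqIncrement (F : Ω → E) (p : Ω × Ω) : E := (F p.2 - F p.1) * (F p.2 - F p.1)

omit [MeasurableSpace Ω] [NormedAlgebra ℝ E] in
lemma sqIncrement_swap (F : Ω → E) (p : Ω × Ω) : sqIncrement F p.swap = sqIncrement F p := by
  simp only [sqIncrement, Prod.fst_swap, Prod.snd_swap]
  noncomm_ring

lemma integral_increment_mul_increment [CompleteSpace E] (hrev : P.IsReversible μ) {h K : Ω → E}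
    (hh : Integrable h μ) (hK : IsBoundedMeasurable K) (t : ℝ≥0) :
    ∫ p, τ ((h p.2 - h p.1) * (K p.2 - K p.1)) ∂(P.jointLaw μ t)
      = 2 * (∫ z, τ (h z * K z) ∂μ - ∫ z, τ (P.act t h z * K z) ∂μ) := by
  have h1 : Integrable (fun p : Ω × Ω => h p.1) (P.jointLaw μ t) :=
    (measurePreserving_fst_jointLaw t).integrable_comp_of_integrable hh
  have h2 : Integrable (fun p : Ω × Ω => h p.2) (P.jointLaw μ t) :=
    (measurePreserving_snd_jointLaw hrev.isStationary t).integrable_comp_of_integrable hh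
  have K1 : IsBoundedMeasurable fun p : Ω × Ω => K p.1 := hK.comp measurable_fst
  have K2 : IsBoundedMeasurable fun p : Ω × Ω => K p.2 := hK.comp measurable_snd
  have e11 : ∫ p, τ (h p.1 * K p.1) ∂(P.jointLaw μ t) = ∫ z, τ (h z * K z) ∂μ :=
    integral_comp_measurePreserving (measurePreserving_fst_jointLaw t)
      (hK.integrable_mul τ hh).aestronglyMeasurable
  have e22 : ∫ p, τ (h p.2 * K p.2) ∂(P.jointLaw μ t) = ∫ z, τ (h z * K z) ∂μ := by
    rw [← e11, ← integral_jointLaw_swap hrev]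
    rfl
  have e21 := IsBoundedMeasurable.integral_act_mul τ hrev.isStationary t hh hK
  have e12 : ∫ p, τ (h p.1 * K p.2) ∂(P.jointLaw μ t)
      = ∫ p, τ (h p.2 * K p.1) ∂(P.jointLaw μ t) := by
    rw [← integral_jointLaw_swap hrev]
    rfl
  have hexpand (p : Ω × Ω) : τ ((h p.2 - h p.1) * (K p.2 - K p.1))
      = (τ (h p.2 * K p.2) - τ (h p.2 * K p.1)) - (τ (h p.1 * K p.2) - τ (h p.1 * K p.1)) := by
    rw [sub_mul, mul_sub, mul_sub, map_sub, map_sub, map_sub]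
  have i22 := K2.integrable_mul τ h2
  have i21 := K1.integrable_mul τ h2
  have i12 := K2.integrable_mul τ h1
  have i11 := K1.integrable_mul τ h1
  simp only [hexpand]
  rw [integral_sub (by exact i22.sub i21) (by exact i12.sub i11), integral_sub i22 i21,
    integral_sub i12 i11, e22, e11, e12, ← e21]
  ring

variable [FiniteDimensional ℝ E] {A : Subalgebra ℝ (Ω → ℝ)}

namespace suitableFun

variable (hA : P.IsSuitableAlgebra μ A)

omit [IsFiniteMeasure μ] in
lemma tendsto_toL1_mul_diffQuot (F G : suitableFun A E) :
    Tendsto (fun t => toL1 hA (G * diffQuot hA t F)) (𝓝[>] 0) (𝓝 (toL1 hA (G * gen hA F))) := by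
  simp only [← holderL_toL2]
  exact (((ContinuousLinearMap.mul ℝ E).holderL μ 2 2 1
    (toL2 hA G)).continuous.tendsto _).comp (tendsto_toL2_diffQuot hA F)

omit [IsFiniteMeasure μ] in
lemma tendsto_toL1_diffQuot_mul (F G : suitableFun A E) :
    Tendsto (fun t => toL1 hA (diffQuot hA t F * G)) (𝓝[>] 0) (𝓝 (toL1 hA (gen hA F * G))) := by
  simp only [← holderL_toL2]
  exact ((((ContinuousLinearMap.mul ℝ E).holderL μ 2 2 1).flip
    (toL2 hA G)).continuous.tendsto _).comp (tendsto_toL2_diffQuot hA F)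

variable (hstat : P.IsStationary μ) {K : Ω → E} (hK : IsBoundedMeasurable K)

include hA in
lemma integrable_sqIncrement (hstat : P.IsStationary μ) (F : suitableFun A E) (t : ℝ≥0) :
    Integrable (sqIncrement F.1) (P.jointLaw μ t) := by
  have hincr : MemLp (fun p : Ω × Ω => F.1 p.2 - F.1 p.1) 2 (P.jointLaw μ t) :=
    ((memLp_two hA F).comp_measurePreserving (measurePreserving_snd_jointLaw hstat t)).sub
      ((memLp_two hA F).comp_measurePreserving (measurePreserving_fst_jointLaw t))
  exact hincr.integrable_mul hincr

lemma pairing_zero (F : suitableFun A E) : pairing hA τ hK 0 F = ∫ z, τ (F.1 z * K z) ∂μ := by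
  rw [pairing_apply, Real.toNNReal_zero, P.act_zero (stronglyMeasurable hA F)]

include hstat in
lemma tendsto_pairing (s : ℝ) {ι : Type*} {l : Filter ι} {F : ι → suitableFun A E}
    {G : suitableFun A E} (h : Tendsto (fun i => toL1 hA (F i)) l (𝓝 (toL1 hA G))) :
    Tendsto (fun i => pairing hA τ hK s (F i)) l (𝓝 (pairing hA τ hK s G)) := by
  obtain ⟨C, hC⟩ := exists_abs_pairing_le (A := A) hA τ hK hstat
  rw [tendsto_iff_norm_sub_tendsto_zero] at h ⊢
  refine squeeze_zero (fun _ => norm_nonneg _) (fun i => ?_)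
    (by simpa only [mul_zero] using h.const_mul C)
  rw [← map_sub, ← map_sub]
  exact hC s _

include hA hstat hK in
lemma tendsto_integral_diffQuot_mul (F : suitableFun A E) :
    Tendsto (fun t => ∫ z, τ ((diffQuot hA t F).1 z * K z) ∂μ) (𝓝[>] 0)
      (𝓝 (∫ z, τ (P.generator F.1 z * K z) ∂μ)) := by
  have h := tendsto_toL1_mul_diffQuot hA F 1
  simp only [one_mul] at h
  have hlim := tendsto_pairing τ hA hstat hK 0 h
  simp only [pairing_zero] at hlim
  exact hlim

include hA hstat hK in
lemma inv_mul_integral_sqIncrement_mul (F : suitableFun A E) (t : ℝ≥0) :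
    (t : ℝ)⁻¹ * ∫ p, τ (sqIncrement F.1 p * K p.1) ∂(P.jointLaw μ t)
      = pairing hA τ hK 0 (diffQuot hA t (F * F) - F * diffQuot hA t F - diffQuot hA t F * F) := by
  have hint := integrable_sqIncrement hA hstat F t
  rw [pairing_zero, MarkovSemigroup.jointLaw,
    Measure.integral_compProd ((hK.comp measurable_fst).integrable_mul τ hint),
    ← integral_const_mul]
  refine integral_congr_ae ?_
  filter_upwards [((Measure.integrable_compProd_iff hint.aestronglyMeasurable).1 hint).1]
    with z hz
  change _ = τ (((diffQuot hA t (F * F)).1 z - F.1 z * (diffQuot hA t F).1 z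
    - (diffQuot hA t F).1 z * F.1 z) * K z)
  rw [← inv_smul_integral_sub_mul_self hA, smul_mul_assoc, map_smul, smul_eq_mul]
  congr 1
  exact (τ ∘L (ContinuousLinearMap.mul ℝ E).flip (K z)).integral_comp_comm hz

include hA hstat hK in
lemma tendsto_integral_sqIncrement_mul (F : suitableFun A E) :
    Tendsto (fun t : ℝ≥0 => (t : ℝ)⁻¹ * ∫ p, τ (sqIncrement F.1 p * K p.1) ∂(P.jointLaw μ t))
      (𝓝[>] 0) (𝓝 (2 * ∫ z, τ (P.gamma F.1 F.1 z * K z) ∂μ)) := by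
  have hgen := tendsto_toL1_mul_diffQuot hA (F * F) 1
  simp only [one_mul] at hgen
  have hlim := (hgen.sub (tendsto_toL1_mul_diffQuot hA F F)).sub (tendsto_toL1_diffQuot_mul hA F F)
  simp only [← map_sub] at hlim
  simp only [inv_mul_integral_sqIncrement_mul τ hA hstat hK]
  convert tendsto_pairing τ hA hstat hK 0 hlim
  have hgamma : gen hA (F * F) - F * gen hA F - gen hA F * F = (2 : ℝ) • gamma hA F F := by
    rw [gamma, smul_smul, mul_one_div_cancel two_ne_zero, one_smul]
  rw [hgamma, map_smul, pairing_zero, smul_eq_mul]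
  rfl

end suitableFun

end Increments

section DirichletForm

variable {Ω : Type*} [MeasurableSpace Ω] {μ : Measure Ω} [IsFiniteMeasure μ] {P : MarkovSemigroup Ω}
  {A : Subalgebra ℝ (Ω → ℝ)} {n : Type*} [Fintype n] [DecidableEq n]
  {F G : suitableFun A (Matrix n n ℂ)} {φ χ : ℝ → ℝ} {s : ℝ}

lemma integral_reTrace_increment_mul_increment_cfc_le (hA : P.IsSuitableAlgebra μ A)
    (hrev : P.IsReversible μ) (hF : ∀ z, (F.1 z).IsHermitian) (hG : ∀ z, (G.1 z).IsHermitian)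
    (hφ : IsBoundedMeasurable fun z => cfc φ (F.1 z))
    (hχ : IsBoundedMeasurable fun z => cfc χ (F.1 z)) (hχ0 : ∀ x, 0 ≤ χ x)
    (hφχ : ∀ x y, |φ x - φ y| ≤ |x - y| * ((χ x + χ y) / 2)) (hs : 0 < s) (t : ℝ≥0) :
    ∫ p, reTrace ((G.1 p.2 - G.1 p.1) * (cfc φ (F.1 p.2) - cfc φ (F.1 p.1))) ∂(P.jointLaw μ t)
      ≤ 1 / 2 * (s * ∫ p, reTrace (sqIncrement F.1 p * cfc χ (F.1 p.1)) ∂(P.jointLaw μ t)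
        + s⁻¹ * ∫ p, reTrace (sqIncrement G.1 p * cfc χ (F.1 p.1)) ∂(P.jointLaw μ t)) := by
  let S (p : Ω × Ω) : Matrix n n ℂ := s • sqIncrement F.1 p + s⁻¹ • sqIncrement G.1 p
  have iF := suitableFun.integrable_sqIncrement hA hrev.isStationary F t
  have iG := suitableFun.integrable_sqIncrement hA hrev.isStationary G t
  have iS : Integrable S (P.jointLaw μ t) := (iF.smul s).add (iG.smul s⁻¹)
  have χ1 : IsBoundedMeasurable fun p : Ω × Ω => cfc χ (F.1 p.1) := hχ.comp measurable_fst
  have χ2 : IsBoundedMeasurable fun p : Ω × Ω => cfc χ (F.1 p.2) := hχ.comp measurable_snd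
  have hsymm : ∫ p, reTrace (S p * cfc χ (F.1 p.2)) ∂(P.jointLaw μ t)
      = ∫ p, reTrace (S p * cfc χ (F.1 p.1)) ∂(P.jointLaw μ t) := by
    rw [← integral_jointLaw_swap hrev]
    simp only [S, sqIncrement_swap, Prod.snd_swap]
  have hsplit : ∫ p, reTrace (S p * cfc χ (F.1 p.1)) ∂(P.jointLaw μ t)
      = s * ∫ p, reTrace (sqIncrement F.1 p * cfc χ (F.1 p.1)) ∂(P.jointLaw μ t)
        + s⁻¹ * ∫ p, reTrace (sqIncrement G.1 p * cfc χ (F.1 p.1)) ∂(P.jointLaw μ t) := by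
    simp only [S, add_mul, smul_mul_assoc, map_add, map_smul, smul_eq_mul]
    rw [integral_add ((χ1.integrable_mul _ iF).const_mul s) ((χ1.integrable_mul _ iG).const_mul _),
      integral_const_mul, integral_const_mul]
  have hpointwise (p : Ω × Ω) :
      reTrace ((G.1 p.2 - G.1 p.1) * (cfc φ (F.1 p.2) - cfc φ (F.1 p.1)))
        ≤ 1 / 4 * (reTrace (S p * cfc χ (F.1 p.2)) + reTrace (S p * cfc χ (F.1 p.1))) := by
    rw [← map_add, ← mul_add]
    exact reTrace_mul_cfc_sub_cfc_le (hF p.2) (hF p.1) ((hG p.2).sub (hG p.1)) hχ0 hφχ hs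
  have i1 := χ1.integrable_mul reTrace iS
  have i2 := χ2.integrable_mul reTrace iS
  have hφ21 := (hφ.comp measurable_snd).sub (hφ.comp (g := Prod.fst (α := Ω)) measurable_fst)
  have iG21 := ((measurePreserving_snd_jointLaw hrev.isStationary t).integrable_comp_of_integrable
    (suitableFun.integrable hA G)).sub
    ((measurePreserving_fst_jointLaw t).integrable_comp_of_integrable (suitableFun.integrable hA G))
  have i21 : Integrable (fun p : Ω × Ω => reTrace (S p * cfc χ (F.1 p.2))
      + reTrace (S p * cfc χ (F.1 p.1))) (P.jointLaw μ t) := i2.add i1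
  refine (integral_mono (hφ21.integrable_mul reTrace iG21) (i21.const_mul _)
    hpointwise).trans_eq ?_
  rw [integral_const_mul, integral_add i2 i1, hsymm, hsplit]
  ring

lemma neg_integral_reTrace_generator_mul_cfc_le (hA : P.IsSuitableAlgebra μ A)
    (hrev : P.IsReversible μ) (hF : ∀ z, (F.1 z).IsHermitian) (hG : ∀ z, (G.1 z).IsHermitian)
    (hφ : IsBoundedMeasurable fun z => cfc φ (F.1 z))
    (hχ : IsBoundedMeasurable fun z => cfc χ (F.1 z)) (hχ0 : ∀ x, 0 ≤ χ x)
    (hφχ : ∀ x y, |φ x - φ y| ≤ |x - y| * ((χ x + χ y) / 2)) (hs : 0 < s) :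
    -∫ z, reTrace (P.generator G.1 z * cfc φ (F.1 z)) ∂μ
      ≤ 1 / 2 * (s * ∫ z, reTrace (P.gamma F.1 F.1 z * cfc χ (F.1 z)) ∂μ
        + s⁻¹ * ∫ z, reTrace (P.gamma G.1 G.1 z * cfc χ (F.1 z)) ∂μ) := by
  have hlhs := (suitableFun.tendsto_integral_diffQuot_mul reTrace hA hrev.isStationary hφ G).neg
  have hrhs := (((suitableFun.tendsto_integral_sqIncrement_mul reTrace hA hrev.isStationary hχ
    F).const_mul s).add ((suitableFun.tendsto_integral_sqIncrement_mul reTrace hA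
      hrev.isStationary hχ G).const_mul s⁻¹)).const_mul (1 / 4)
  refine (le_of_tendsto_of_tendsto hlhs hrhs (Eventually.of_forall fun t => ?_)).trans_eq (by ring)
  have hincr := integral_reTrace_increment_mul_increment_cfc_le hA hrev hF hG hφ hχ hχ0 hφχ hs t
  have iG := suitableFun.integrable hA G
  have iPG : Integrable (P.act t G.1) μ := suitableFun.integrable hA (suitableFun.act hA t G)
  rw [integral_increment_mul_increment reTrace hrev iG hφ] at hincr
  have hquot : -∫ z, reTrace ((suitableFun.diffQuot hA t G).1 z * cfc φ (F.1 z)) ∂μ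
      = (t : ℝ)⁻¹ * (∫ z, reTrace (G.1 z * cfc φ (F.1 z)) ∂μ
        - ∫ z, reTrace (P.act t G.1 z * cfc φ (F.1 z)) ∂μ) := by
    rw [← integral_sub (hφ.integrable_mul reTrace iG) (hφ.integrable_mul reTrace iPG),
      ← integral_neg, ← integral_const_mul]
    refine integral_congr_ae (Eventually.of_forall fun z => ?_)
    change -reTrace ((t : ℝ)⁻¹ • (P.act t G.1 z - G.1 z) * cfc φ (F.1 z)) = _
    simp only [smul_mul_assoc, sub_mul, map_smul, map_sub, smul_eq_mul]
    ring
  refine hquot.trans_le ?_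
  have := mul_le_mul_of_nonneg_left hincr (inv_nonneg.2 t.coe_nonneg)
  linarith

end DirichletForm

section CovarianceBound

variable {Ω : Type*} [MeasurableSpace Ω] {μ : Measure Ω} {P : MarkovSemigroup Ω}
  {A : Subalgebra ℝ (Ω → ℝ)}

section PositiveWeights

variable {n : Type*} [Fintype n] [DecidableEq n] {F : Ω → Matrix n n ℂ}
  (hF : StronglyMeasurable F) (hH : ∀ z, (F z).IsHermitian)
include hF hH

lemma isPosWeight_cfc {φ : ℝ → ℝ} (hφ : Continuous φ) (h0 : ∀ x, 0 ≤ φ x) {C : ℝ}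
    (hC : ∀ x, φ x ≤ C) : IsPosWeight fun z => cfc φ (F z) where
  stronglyMeasurable := stronglyMeasurable_cfc hF hH hφ
  bounded := ⟨C, fun _ => norm_cfc_le ((h0 0).trans (hC 0)) fun x _ =>
    (Real.norm_of_nonneg (h0 x)).trans_le (hC x)⟩
  nonneg _ _ hX := reTrace_mul_cfc_nonneg (hH _) hX h0

lemma isPosWeight_truncExp (k : ℝ) {θ : ℝ} (hθ : 0 ≤ θ) :
    IsPosWeight fun z => cfc (truncExp k θ) (F z) :=
  isPosWeight_cfc hF hH (continuous_truncExp k θ) (truncExp_nonneg k θ) (truncExp_le k hθ)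

end PositiveWeights

lemma le_mul_of_hasDerivAt_of_tendsto_zero {φ φ' : ℝ → ℝ} {a c : ℝ} (hc : 0 < c)
    (hcont : Continuous φ) (hφ' : ∀ r > 0, HasDerivAt φ (φ' r) r)
    (hle : ∀ r > 0, -(a * Real.exp (-(r / c))) ≤ φ' r) (hlim : Tendsto φ atTop (𝓝 0)) :
    φ 0 ≤ c * a := by
  have hexp (r : ℝ) : HasDerivAt (fun r => c * a * Real.exp (-(r / c)))
      (c * a * (Real.exp (-(r / c)) * -(1 / c))) r :=
    (((hasDerivAt_id r).div_const c).neg.exp).const_mul _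
  have hmono : MonotoneOn (fun r => φ r - c * a * Real.exp (-(r / c))) (Set.Ici 0) := by
    refine monotoneOn_of_hasDerivWithinAt_nonneg (convex_Ici 0)
      (f' := fun r => φ' r - c * a * (Real.exp (-(r / c)) * -(1 / c)))
      (hcont.sub (by fun_prop)).continuousOn (fun r hr => ?_) fun r hr => ?_
    · rw [interior_Ici] at hr
      exact ((hφ' r hr).sub (hexp r)).hasDerivWithinAt
    · rw [interior_Ici] at hr
      have hrw : c * a * (Real.exp (-(r / c)) * -(1 / c)) = -(a * Real.exp (-(r / c))) := by
        field_simp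
      rw [hrw]
      linarith [hle r hr]
  have hzero : Tendsto (fun r => φ r - c * a * Real.exp (-(r / c))) atTop (𝓝 0) := by
    have hdecay : Tendsto (fun r => Real.exp (-(r / c))) atTop (𝓝 0) :=
      Real.tendsto_exp_neg_atTop_nhds_zero.comp (tendsto_id.atTop_div_const hc)
    simpa only [mul_zero, sub_zero] using hlim.sub (hdecay.const_mul (c * a))
  have h := ge_of_tendsto hzero ((eventually_ge_atTop 0).mono fun r hr =>
    hmono Set.self_mem_Ici hr hr)
  simp only [zero_div, neg_zero, Real.exp_zero, mul_one] at h
  linarith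

namespace suitableFun

section Pairing

variable {E : Type*} [NormedRing E] [NormedAlgebra ℝ E] [FiniteDimensional ℝ E]
  (hA : P.IsSuitableAlgebra μ A) {F : suitableFun A E}

lemma tendsto_toL2_act_atTop (herg : P.IsErgodic μ) (h0 : ∫ z, F.1 z ∂μ = 0) :
    Tendsto (fun t => toL2 hA (act hA t F)) atTop (𝓝 0) := by
  have hlim : Tendsto (fun t => eLpNorm (act hA t F).1 2 μ) atTop (𝓝 0) := by
    refine tendsto_eLpNorm_of_coordCLM one_le_two
      (fun t k => (hA.measurable _ ((act hA t F).2 _)).aestronglyMeasurable) fun k => ?_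
    have hk := herg _ ((coordCLM E k).comp_memLp' (memLp_two hA F))
    simp only [Function.comp_def, (coordCLM E k).integral_comp_comm (integrable hA F), h0, map_zero,
      sub_zero, ← map_act hA] at hk
    exact hk
  refine (Lp.tendsto_Lp_iff_tendsto_eLpNorm'' (fun t => (act hA t F).1)
    (fun t => memLp_two hA (act hA t F)) 0 MemLp.zero').2 ?_
  simpa only [sub_zero] using hlim

variable [IsFiniteMeasure μ] (τ : E →L[ℝ] ℝ) {K : Ω → E} (hK : IsBoundedMeasurable K)

lemma tendsto_pairing_atTop (herg : P.IsErgodic μ) (h0 : ∫ z, F.1 z ∂μ = 0) :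
    Tendsto (fun s => pairing hA τ hK s F) atTop (𝓝 0) := by
  simp only [pairing_eq_pairL2_flow]
  rw [← map_zero (pairL2 μ τ hK)]
  exact ((pairL2 μ τ hK).continuous.tendsto 0).comp
    ((tendsto_toL2_act_atTop hA herg h0).comp tendsto_real_toNNReal_atTop)

lemma pairing_coe_gen (hstat : P.IsStationary μ) (t : ℝ≥0) :
    pairing hA τ hK t (gen hA F) = ∫ z, τ ((gen hA (act hA t F)).1 z * K z) ∂μ := by
  rw [pairing_apply, Real.toNNReal_coe]
  refine integral_congr_ae ?_
  filter_upwards [gen_act_ae_eq hA hstat t F] with z hz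
  rw [hz]
  rfl

include hK in
lemma integral_mul_le_of_neg_integral_gen_act_mul_le (hstat : P.IsStationary μ)
    (herg : P.IsErgodic μ) (h0 : ∫ z, F.1 z ∂μ = 0) {a c : ℝ} (hc : 0 < c)
    (hle : ∀ t : ℝ≥0,
      -∫ z, τ ((gen hA (act hA t F)).1 z * K z) ∂μ ≤ a * Real.exp (-(t / c))) :
    ∫ z, τ (F.1 z * K z) ∂μ ≤ c * a := by
  rw [← pairing_zero τ hA hK F]
  refine le_mul_of_hasDerivAt_of_tendsto_zero hc (continuous_pairing hA τ hK hstat F)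
    (fun r hr => hasDerivAt_pairing hA τ hK hstat F hr) (fun r hr => ?_)
    (tendsto_pairing_atTop hA τ hK herg h0)
  lift r to ℝ≥0 using hr.le
  rw [pairing_coe_gen hA τ hK hstat, neg_le]
  exact hle r

end Pairing

variable {d : ℕ} {c R : ℝ} [IsFiniteMeasure μ] (hA : P.IsSuitableAlgebra μ A)
  (hrev : P.IsReversible μ) (hBE : BakryEmery P μ A d c) (hc : 0 < c)
  {F : suitableFun A (Matrix (Fin d) (Fin d) ℂ)} (hF : IsSuitable A F.1) (k : ℝ) {θ : ℝ}
  (hθ : 0 ≤ θ)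
  (hR : ∀ t, ∫ z, reTrace (P.gamma F.1 F.1 z * P.act t (fun z => cfc (truncExp k θ) (F.1 z)) z) ∂μ
    ≤ R)
include hBE hc hF hR

include hrev hθ in
/-- With `G = P_t F` in the Dirichlet form estimate, the choice `s = exp (-t/c)` balances the two
energies, since the gradient bound gains the factor `exp (-2t/c)` on the second one. -/
lemma neg_integral_reTrace_gen_act_mul_le (t : ℝ≥0) :
    -∫ z, reTrace ((gen hA (act hA t F)).1 z * cfc (truncExp k θ) (F.1 z)) ∂μ
      ≤ θ * R * Real.exp (-(t / c)) := by
  have hK := isPosWeight_truncExp (stronglyMeasurable hA F) hF.isHermitian k hθ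
  have hχ : IsPosWeight fun z => cfc (fun x => θ * truncExp k θ x) (F.1 z) :=
    isPosWeight_cfc (stronglyMeasurable hA F) hF.isHermitian
      ((continuous_truncExp k θ).const_mul θ) (fun x => mul_nonneg hθ (truncExp_nonneg k θ x))
      fun x => mul_le_mul_of_nonneg_left (truncExp_le k hθ x) hθ
  have hs := Real.exp_pos (-(t / c))
  have hdirichlet := neg_integral_reTrace_generator_mul_cfc_le (F := F) (G := act hA t F) hA hrev
    hF.isHermitian (hF.act hA t).isHermitian hK.toIsBoundedMeasurable hχ.toIsBoundedMeasurable
    (fun x => mul_nonneg hθ (truncExp_nonneg k θ x)) (abs_truncExp_sub_le k hθ) hs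
  simp only [cfc_const_mul θ _ _ (continuous_truncExp k θ).continuousOn, mul_smul_comm, map_smul,
    smul_eq_mul, integral_const_mul] at hdirichlet
  have hgradient := integral_reTrace_gamma_act_mul_le hA hBE hc hF hrev hK t
  have hinitial := hR 0
  rw [P.act_zero hK.stronglyMeasurable] at hinitial
  have hbalance : (Real.exp (-(t / c)))⁻¹
      * ∫ z, reTrace (P.gamma (P.act t F.1) (P.act t F.1) z * cfc (truncExp k θ) (F.1 z)) ∂μ
      ≤ Real.exp (-(t / c)) * R := by
    rw [inv_mul_le_iff₀ hs, ← mul_assoc, ← Real.exp_add]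
    refine (hgradient.trans (mul_le_mul_of_nonneg_left (hR t) (Real.exp_pos _).le)).trans_eq ?_
    ring_nf
  have := mul_le_mul_of_nonneg_left
    (add_le_add (mul_le_mul_of_nonneg_left hinitial hs.le) hbalance) hθ
  refine hdirichlet.trans ?_
  change 1 / 2 * (_ + _ * (θ * ∫ z, reTrace
    (P.gamma (P.act t F.1) (P.act t F.1) z * cfc (truncExp k θ) (F.1 z)) ∂μ)) ≤ _
  linarith

include hA hrev hθ in
lemma integral_reTrace_mul_cfc_truncExp_le (herg : P.IsErgodic μ) (h0 : ∫ z, F.1 z ∂μ = 0) :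
    ∫ z, reTrace (F.1 z * cfc (truncExp k θ) (F.1 z)) ∂μ ≤ c * (θ * R) :=
  integral_mul_le_of_neg_integral_gen_act_mul_le hA reTrace (isPosWeight_truncExp
    (stronglyMeasurable hA F) hF.isHermitian k hθ).toIsBoundedMeasurable hrev.isStationary herg h0
    hc (neg_integral_reTrace_gen_act_mul_le hA hrev hBE hc hF k hθ hR)

end suitableFun

end CovarianceBound

section DifferentialInequalities

variable {κ θ : ℝ}

lemma le_mul_exp_of_hasDerivAt {m m' : ℝ → ℝ} (hθ : 0 ≤ θ)
    (hm : ContinuousOn m (Set.Icc 0 θ)) (hm' : ∀ x ∈ Set.Ioo 0 θ, HasDerivAt m (m' x) x)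
    (hle : ∀ x ∈ Set.Ioo 0 θ, m' x ≤ 2 * κ * x * m x) : m θ ≤ m 0 * Real.exp (κ * θ ^ 2) := by
  have hexp : ∀ x, HasDerivAt (fun x : ℝ => Real.exp (-(κ * x ^ 2)))
      (Real.exp (-(κ * x ^ 2)) * -(κ * (2 * x))) x := fun x => by
    simpa using (((hasDerivAt_pow 2 x).const_mul κ).neg).exp
  have hanti : AntitoneOn (fun x => m x * Real.exp (-(κ * x ^ 2))) (Set.Icc 0 θ) := by
    refine antitoneOn_of_hasDerivWithinAt_nonpos (convex_Icc 0 θ)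
      (f' := fun x => m' x * Real.exp (-(κ * x ^ 2))
        + m x * (Real.exp (-(κ * x ^ 2)) * -(κ * (2 * x))))
      (hm.mul (by fun_prop)) (fun x hx => ?_) (fun x hx => ?_)
    · rw [interior_Icc] at hx
      exact ((hm' x hx).mul (hexp x)).hasDerivWithinAt
    · rw [interior_Icc] at hx
      linarith [mul_le_mul_of_nonneg_right (hle x hx) (Real.exp_pos (-(κ * x ^ 2))).le]
  have h := hanti (Set.left_mem_Icc.2 hθ) (Set.right_mem_Icc.2 hθ) hθ
  simpa [Real.exp_neg, ← div_eq_mul_inv, div_le_iff₀ (Real.exp_pos _)] using h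

/- The integrating factor is `1 / √(1 - κ x²)`: the hypothesis says that the derivative of
`(L x - a) / √(1 - κ x²)` is nonpositive. -/
lemma le_mul_one_sub_sqrt_of_hasDerivAt {L L' : ℝ → ℝ} {a : ℝ} (hκ : 0 ≤ κ) (hθ : 0 ≤ θ)
    (hκθ : κ * θ ^ 2 < 1) (hL : ContinuousOn L (Set.Icc 0 θ))
    (hL' : ∀ x ∈ Set.Ioo 0 θ, HasDerivAt L (L' x) x)
    (hle : ∀ x ∈ Set.Ioo 0 θ, L' x ≤ κ * x * (x * L' x - L x + a)) (h0 : L 0 = 0) :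
    L θ ≤ a * (1 - √(1 - κ * θ ^ 2)) := by
  have hlt : ∀ x ∈ Set.Icc 0 θ, 0 < 1 - κ * x ^ 2 := fun x hx => by
    linarith [mul_le_mul_of_nonneg_left (pow_le_pow_left₀ hx.1 hx.2 2) hκ]
  have hsqrt : ∀ x ∈ Set.Icc 0 θ, HasDerivAt (fun x : ℝ => √(1 - κ * x ^ 2))
      (-(κ * (2 * x)) / (2 * √(1 - κ * x ^ 2))) x := fun x hx => by
    have h : HasDerivAt (fun x : ℝ => 1 - κ * x ^ 2) (-(κ * (2 * x))) x := by
      simpa using ((hasDerivAt_pow 2 x).const_mul κ).const_sub 1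
    exact h.sqrt (hlt x hx).ne'
  have hanti : AntitoneOn (fun x => (L x - a) / √(1 - κ * x ^ 2)) (Set.Icc 0 θ) := by
    refine antitoneOn_of_hasDerivWithinAt_nonpos (convex_Icc 0 θ)
      (f' := fun x => (L' x * √(1 - κ * x ^ 2)
        - (L x - a) * (-(κ * (2 * x)) / (2 * √(1 - κ * x ^ 2)))) / √(1 - κ * x ^ 2) ^ 2)
      ((hL.sub continuousOn_const).div (by fun_prop) fun x hx => (Real.sqrt_pos.2 (hlt x hx)).ne')
      (fun x hx => ?_) (fun x hx => ?_)
    · have hx' := interior_subset hx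
      rw [interior_Icc] at hx
      exact (((hL' x hx).sub_const a).div (hsqrt x hx')
        (Real.sqrt_pos.2 (hlt x hx')).ne').hasDerivWithinAt
    · have hpos := hlt x (interior_subset hx)
      rw [interior_Icc] at hx
      have hS : 0 < √(1 - κ * x ^ 2) := Real.sqrt_pos.2 hpos
      have hnum : L' x * √(1 - κ * x ^ 2)
          - (L x - a) * (-(κ * (2 * x)) / (2 * √(1 - κ * x ^ 2)))
          = (L' x * √(1 - κ * x ^ 2) ^ 2 + κ * x * (L x - a)) / √(1 - κ * x ^ 2) := by
        field_simp
        ring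
      rw [hnum]
      refine div_nonpos_of_nonpos_of_nonneg (div_nonpos_of_nonpos_of_nonneg ?_ hS.le) (sq_nonneg _)
      rw [Real.sq_sqrt hpos.le]
      linarith [hle x hx]
  have h := hanti (Set.left_mem_Icc.2 hθ) (Set.right_mem_Icc.2 hθ) hθ
  simp only [h0, zero_sub, ne_eq, OfNat.ofNat_ne_zero, not_false_eq_true, zero_pow, mul_zero,
    sub_zero, Real.sqrt_one, div_one,
    div_le_iff₀ (Real.sqrt_pos.2 (hlt θ (Set.right_mem_Icc.2 hθ)))] at h
  linarith

lemma one_sub_sqrt_one_sub_sq_le {s : ℝ} (hs : 0 ≤ s) (hs1 : s < 1) :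
    1 - √(1 - s ^ 2) ≤ s ^ 2 / (2 * (1 - s)) := by
  have hsq : √(1 - s ^ 2) * √(1 - s ^ 2) = 1 - s ^ 2 := Real.mul_self_sqrt (by nlinarith)
  have hle : 1 - s ≤ √(1 - s ^ 2) := Real.le_sqrt_of_sq_le (by nlinarith)
  rw [le_div_iff₀ (by linarith)]
  nlinarith [Real.sqrt_le_one.2 (show 1 - s ^ 2 ≤ 1 by nlinarith)]

end DifferentialInequalities

section OptimalParameters

lemma exists_bernstein_parameter {a s t : ℝ} (ha : 0 ≤ a) (hs : 0 < s) (ht : 0 < t) :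
    ∃ θ, 0 ≤ θ ∧ s * θ < 1 ∧
      -(θ * t) + a * θ ^ 2 / (2 * (1 - s * θ)) ≤ -t ^ 2 / (2 * a + 2 * t * s) := by
  rcases ha.eq_or_lt with rfl | ha
  · refine ⟨1 / (2 * s), by positivity, ?_, le_of_eq ?_⟩
    · field_simp
      norm_num
    · field_simp
      ring
  · have hθ : 1 - s * (t / (a + s * t)) = a / (a + s * t) := by
      field_simp
      ring
    refine ⟨t / (a + s * t), by positivity, ?_, le_of_eq ?_⟩
    · linarith [show 0 < a / (a + s * t) by positivity]
    · rw [hθ, show 2 * a + 2 * t * s = 2 * (a + s * t) by ring]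
      field_simp
      ring

lemma le_sqrt_of_forall_mul_le {x v L : ℝ} (hv : 0 ≤ v) (hL : 0 ≤ L)
    (h : ∀ θ, 0 < θ → θ * x ≤ L + v / 2 * θ ^ 2) : x ≤ √(2 * v * L) := by
  rcases le_or_gt x 0 with hx | hx
  · exact hx.trans (Real.sqrt_nonneg _)
  refine Real.le_sqrt_of_sq_le ?_
  have hdiscr : discrim (v / 2) (-x) L ≤ 0 := discrim_le_zero fun θ => by
    rcases le_or_gt θ 0 with hθ | hθ
    · nlinarith [mul_self_nonneg θ]
    · linarith [h θ hθ]
  rw [discrim] at hdiscr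
  linarith

end OptimalParameters

section Laplace

variable {Ω : Type*} [MeasurableSpace Ω] {μ : Measure Ω}

section TruncMGF

variable {n : Type*} [Fintype n] [DecidableEq n]

lemma abs_reTrace_cfc_le {B : Matrix n n ℂ} (hB : B.IsHermitian) {φ : ℝ → ℝ} {C : ℝ}
    (hφ : ∀ x, |x| ≤ ‖B‖ → |φ x| ≤ C) : |reTrace (cfc φ B)| ≤ Fintype.card n * C := by
  rw [reTrace_cfc hB, ← nsmul_eq_mul, ← Finset.card_univ]
  exact (Finset.abs_sum_le_sum_abs _ _).trans
    (Finset.sum_le_card_nsmul _ _ _ fun i _ => hφ _ (abs_eigenvalues_le hB i))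

lemma abs_min_mul_truncExp_le (k : ℝ) {θ : ℝ} (hθ : 0 ≤ θ) (x : ℝ) :
    |min x k * truncExp k θ x| ≤ (|x| + |k|) * Real.exp (θ * k) := by
  rw [abs_mul, abs_of_nonneg (truncExp_nonneg k θ x)]
  refine mul_le_mul ?_ (truncExp_le k hθ x) (truncExp_nonneg k θ x) (by positivity)
  exact abs_min_le_max_abs_abs.trans (max_le_add_of_nonneg (abs_nonneg x) (abs_nonneg k))

lemma continuous_min_mul_truncExp (k θ : ℝ) : Continuous fun x => min x k * truncExp k θ x :=
  (continuous_id.min continuous_const).mul (continuous_truncExp k θ)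

/-- The (unnormalized) trace moment generating function `θ ↦ 𝔼_μ tr exp(θ min(F, k))` of the
random Hermitian matrix `F`, truncated from above at level `k`. -/
def truncMGF (μ : Measure Ω) (F : Ω → Matrix n n ℂ) (k θ : ℝ) : ℝ :=
  ∫ z, reTrace (cfc (truncExp k θ) (F z)) ∂μ

/-- The derivative of `truncMGF` in the parameter `θ`. -/
def truncMGFDeriv (μ : Measure Ω) (F : Ω → Matrix n n ℂ) (k θ : ℝ) : ℝ :=
  ∫ z, reTrace (cfc (fun x => min x k * truncExp k θ x) (F z)) ∂μ

variable {F : Ω → Matrix n n ℂ} (hH : ∀ z, (F z).IsHermitian)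
include hH

lemma truncMGF_zero (k : ℝ) : truncMGF μ F k 0 = μ.real Set.univ * Fintype.card n := by
  have hone (z : Ω) : reTrace (cfc (truncExp k 0) (F z)) = Fintype.card n := by
    simp [reTrace_cfc (hH z), truncExp]
  simp [truncMGF, hone]

variable [IsFiniteMeasure μ] (hF : StronglyMeasurable F) (k : ℝ) {θ : ℝ} (hθ : 0 ≤ θ)
include hF

include hθ in
lemma integrable_reTrace_cfc_truncExp :
    Integrable (fun z => reTrace (cfc (truncExp k θ) (F z))) μ :=
  reTrace.integrable_comp (isPosWeight_truncExp hF hH k hθ).integrable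

include hθ in
lemma integrable_reTrace_cfc_min_mul_truncExp (hint : Integrable F μ) :
    Integrable (fun z => reTrace (cfc (fun x => min x k * truncExp k θ x) (F z))) μ := by
  refine Integrable.mono' (((hint.norm.add (integrable_const |k|)).mul_const
    (Real.exp (θ * k))).const_mul (Fintype.card n : ℝ)) (reTrace.continuous.comp_stronglyMeasurable
      (stronglyMeasurable_cfc hF hH (continuous_min_mul_truncExp k θ))).aestronglyMeasurable
    (ae_of_all _ fun z => abs_reTrace_cfc_le (hH z) fun x hx =>
      (abs_min_mul_truncExp_le k hθ x).trans ?_)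
  change _ ≤ (‖F z‖ + |k|) * _
  gcongr

lemma hasDerivAt_truncMGF (hint : Integrable F μ) (hθ : 0 < θ) :
    HasDerivAt (truncMGF μ F k) (truncMGFDeriv μ F k θ) θ := by
  refine (hasDerivAt_integral_of_dominated_loc_of_deriv_le (𝕜 := ℝ)
    (F' := fun u z => reTrace (cfc (fun x => min x k * truncExp k u x) (F z)))
    (bound := fun z => Fintype.card n * ((‖F z‖ + |k|) * Real.exp ((θ + 1) * |k|)))
    (Ioo_mem_nhds hθ (lt_add_one θ)) ?_ (integrable_reTrace_cfc_truncExp hH hF k hθ.le)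
    (integrable_reTrace_cfc_min_mul_truncExp hH hF k hθ.le hint).aestronglyMeasurable
    (ae_of_all _ fun z u hu => ?_) ?_ (ae_of_all _ fun z u _ => ?_)).2
  · filter_upwards [lt_mem_nhds hθ] with u hu
    exact (integrable_reTrace_cfc_truncExp hH hF k hu.le).aestronglyMeasurable
  · refine abs_reTrace_cfc_le (hH z) fun x hx => (abs_min_mul_truncExp_le k hu.1.le x).trans ?_
    have huk : u * k ≤ (θ + 1) * |k| :=
      (mul_le_mul_of_nonneg_left (le_abs_self k) hu.1.le).trans
        (mul_le_mul_of_nonneg_right hu.2.le (abs_nonneg k))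
    gcongr
  · exact ((hint.norm.add (integrable_const |k|)).mul_const _).const_mul _
  · simp only [reTrace_cfc (hH z)]
    refine HasDerivAt.fun_sum fun i _ => ?_
    simpa only [truncExp, one_mul, mul_comm, id] using
      ((hasDerivAt_id u).mul_const (min ((hH z).eigenvalues i) k)).exp

lemma continuousOn_truncMGF : ContinuousOn (truncMGF μ F k) (Set.Icc 0 θ) := by
  refine continuousOn_of_dominated (bound := fun _ => Fintype.card n * Real.exp (θ * |k|))
    (fun u hu => (integrable_reTrace_cfc_truncExp hH hF k hu.1).aestronglyMeasurable)
    (fun u hu => ae_of_all _ fun z => abs_reTrace_cfc_le (hH z) fun x _ => ?_)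
    (integrable_const _) (ae_of_all _ fun z => ?_)
  · rw [abs_of_nonneg (truncExp_nonneg k u x)]
    refine (truncExp_le k hu.1 x).trans (Real.exp_le_exp.2 ?_)
    exact (mul_le_mul_of_nonneg_left (le_abs_self k) hu.1).trans
      (mul_le_mul_of_nonneg_right hu.2 (abs_nonneg k))
  · simp only [reTrace_cfc (hH z)]
    unfold truncExp
    fun_prop

include hθ in
lemma truncMGFDeriv_le (hint : Integrable F μ) :
    truncMGFDeriv μ F k θ ≤ ∫ z, reTrace (F z * cfc (truncExp k θ) (F z)) ∂μ := by
  refine integral_mono (integrable_reTrace_cfc_min_mul_truncExp hH hF k hθ hint)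
    ((isPosWeight_truncExp hF hH k hθ).integrable_mul reTrace hint) fun z => ?_
  have hmul : F z * cfc (truncExp k θ) (F z) = cfc (fun x => x * truncExp k θ x) (F z) := by
    rw [cfc_mul (fun x => x) (truncExp k θ) (F z) continuousOn_id
      (continuous_truncExp k θ).continuousOn, cfc_id' ℝ (F z) (hH z).isSelfAdjoint]
  change _ ≤ reTrace (F z * cfc (truncExp k θ) (F z))
  rw [hmul]
  exact reTrace_cfc_mono (hH z) fun x =>
    mul_le_mul_of_nonneg_right (min_le_left x k) (truncExp_nonneg k θ x)

include hθ in
lemma truncMGF_pos [Nonempty n] [NeZero μ] : 0 < truncMGF μ F k θ := by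
  have hpos (z : Ω) : 0 < reTrace (cfc (truncExp k θ) (F z)) := by
    rw [reTrace_cfc (hH z)]
    exact Finset.sum_pos (fun i _ => Real.exp_pos _) Finset.univ_nonempty
  have hsupp : Function.support (fun z => reTrace (cfc (truncExp k θ) (F z))) = Set.univ :=
    Set.eq_univ_of_forall fun z => (hpos z).ne'
  rw [truncMGF, integral_pos_iff_support_of_nonneg (fun z => (hpos z).le)
    (integrable_reTrace_cfc_truncExp hH hF k hθ), hsupp]
  exact Measure.measure_univ_pos.2 (NeZero.ne μ)

end TruncMGF

end Laplace

section LaplaceBounds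

variable {Ω : Type*} [MeasurableSpace Ω] {μ : Measure Ω} {P : MarkovSemigroup Ω}
  {A : Subalgebra ℝ (Ω → ℝ)}

lemma IsBoundedMeasurable.integral_mul_act_le [IsFiniteMeasure μ] {E : Type*} [NormedRing E]
    [NormedAlgebra ℝ E] [CompleteSpace E] (τ : E →L[ℝ] ℝ) (hstat : P.IsStationary μ) (t : ℝ≥0)
    {G K : Ω → E} {g h : Ω → ℝ} (hG : Integrable G μ) (hK : IsBoundedMeasurable K)
    (hg : Integrable g μ) (hh : Integrable h μ)
    (hle : ∀ᵐ z ∂μ, ∀ y, τ (G z * K y) ≤ g z + h y) :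
    ∫ z, τ (G z * P.act t K z) ∂μ ≤ ∫ z, g z ∂μ + ∫ z, h z ∂μ := by
  have hfst := measurePreserving_fst_jointLaw (P := P) (μ := μ) t
  have hsnd := measurePreserving_snd_jointLaw hstat t
  have hg1 : Integrable (fun p : Ω × Ω => g p.1) (P.jointLaw μ t) :=
    hfst.integrable_comp_of_integrable hg
  have hh2 : Integrable (fun p : Ω × Ω => h p.2) (P.jointLaw μ t) :=
    hsnd.integrable_comp_of_integrable hh
  rw [integral_mul_act τ t hG hK, ← integral_comp_measurePreserving hfst hg.aestronglyMeasurable,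
    ← integral_comp_measurePreserving hsnd hh.aestronglyMeasurable, ← integral_add hg1 hh2]
  refine integral_mono_ae ((hK.comp measurable_snd).integrable_mul τ
    (hfst.integrable_comp_of_integrable hG)) (hg1.add hh2) ?_
  filter_upwards [hfst.quasiMeasurePreserving.ae hle] with p hp using hp p.2

section Matrices

variable {n : Type*} [Fintype n] [DecidableEq n] {X B : Matrix n n ℂ}

lemma mul_reTrace_mul_cfc_truncExp_le (hX : X.IsHermitian) (hB : B.IsHermitian) (k θ b β : ℝ) :
    β * reTrace (X * cfc (truncExp k θ) B)
      ≤ θ * reTrace (cfc (fun x => min x k * truncExp k θ x) B)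
        - (b + 1) * reTrace (cfc (truncExp k θ) B)
        + Real.exp b * reTrace (NormedSpace.exp (β • X)) := by
  have hβX : (β • X).IsHermitian := (IsSelfAdjoint.all β).smul hX
  have h := reTrace_mul_cfc_exp_le hβX hB (fun x => θ * min x k) b
  have hsplit : reTrace (cfc (fun x => (θ * min x k - b - 1) * Real.exp (θ * min x k)) B)
      = θ * reTrace (cfc (fun x => min x k * truncExp k θ x) B)
        - (b + 1) * reTrace (cfc (truncExp k θ) B) := by
    simp only [reTrace_cfc hB, Finset.mul_sum, ← Finset.sum_sub_distrib, truncExp]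
    exact Finset.sum_congr rfl fun i _ => by ring
  rw [hsplit, CFC.real_exp_eq_normedSpace_exp hβX.isSelfAdjoint, smul_mul_assoc, map_smul] at h
  exact h

lemma card_le_reTrace_exp (hX : X.IsHermitian) (h0 : 0 ≤ reTrace X) :
    (Fintype.card n : ℝ) ≤ reTrace (NormedSpace.exp X) := by
  have htrace : reTrace X = ∑ i, hX.eigenvalues i := by
    conv_lhs => rw [← cfc_id ℝ X hX.isSelfAdjoint]
    exact reTrace_cfc hX id
  rw [← CFC.real_exp_eq_normedSpace_exp hX.isSelfAdjoint, reTrace_cfc hX]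
  calc (Fintype.card n : ℝ) ≤ ∑ i, (hX.eigenvalues i + 1) := by
        simpa [Finset.sum_add_distrib, ← htrace] using h0
    _ ≤ _ := Finset.sum_le_sum fun i _ => Real.add_one_le_exp _

namespace suitableFun

variable (hA : P.IsSuitableAlgebra μ A) {F : suitableFun A (Matrix n n ℂ)}
  (hF : ∀ z, (F.1 z).IsHermitian)
include hA hF

open scoped MatrixOrder in
lemma posSemidef_gamma (z : Ω) : (P.gamma F.1 F.1 z).PosSemidef := by
  rw [← Matrix.nonneg_iff_posSemidef]
  refine ge_of_tendsto' (tendsto_gamma hA F z) fun t => smul_nonneg (by norm_num)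
    (smul_nonneg (by positivity) (integral_nonneg fun y => ?_))
  have h := Matrix.posSemidef_conjTranspose_mul_self (F.1 y - F.1 z)
  rw [((hF y).sub (hF z)).eq] at h
  exact h.nonneg

lemma card_le_reTrace_exp_gamma {β : ℝ} (hβ : 0 ≤ β) (z : Ω) :
    (Fintype.card n : ℝ) ≤ reTrace (NormedSpace.exp (β • P.gamma F.1 F.1 z)) := by
  have hΓ := (posSemidef_gamma hA hF z).smul hβ
  exact card_le_reTrace_exp hΓ.isHermitian (Complex.nonneg_iff.1 hΓ.trace_nonneg).1

lemma stronglyMeasurable_reTrace_exp_gamma (β : ℝ) :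
    StronglyMeasurable fun z => reTrace (NormedSpace.exp (β • P.gamma F.1 F.1 z)) := by
  have hΓ (z : Ω) : (β • P.gamma F.1 F.1 z).IsHermitian :=
    (IsSelfAdjoint.all β).smul (posSemidef_gamma hA hF z).isHermitian
  have hexp (z : Ω) : NormedSpace.exp (β • P.gamma F.1 F.1 z)
      = cfc Real.exp (β • P.gamma F.1 F.1 z) :=
    (CFC.real_exp_eq_normedSpace_exp (hΓ z).isSelfAdjoint).symm
  simp only [hexp]
  exact reTrace.continuous.comp_stronglyMeasurable (stronglyMeasurable_cfc
    ((stronglyMeasurable hA (gamma hA F F)).const_smul β) hΓ Real.continuous_exp)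

section Integral

variable [IsProbabilityMeasure μ] {β : ℝ} (hβ : 0 ≤ β)
  (hint : Integrable (fun z => reTrace (NormedSpace.exp (β • P.gamma F.1 F.1 z))) μ)
include hβ hint

lemma card_le_integral_reTrace_exp_gamma :
    (Fintype.card n : ℝ) ≤ ∫ z, reTrace (NormedSpace.exp (β • P.gamma F.1 F.1 z)) ∂μ := by
  simpa using integral_mono (integrable_const (μ := μ) (Fintype.card n : ℝ)) hint
    (card_le_reTrace_exp_gamma hA hF hβ)

lemma integral_reTrace_exp_gamma_pos [Nonempty n] :
    0 < ∫ z, reTrace (NormedSpace.exp (β • P.gamma F.1 F.1 z)) ∂μ :=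
  (Nat.cast_pos.2 Fintype.card_pos).trans_le
    (card_le_integral_reTrace_exp_gamma hA hF hβ hint)

end Integral

end suitableFun

end Matrices

/-- The logarithm of the exponential mean, `log 𝔼_μ tr̄ exp(β Γ(f)) = β r_f(β)`, as a real number.
It is meaningful only when `tr exp(β Γ(f))` is integrable. -/
def logExpMean (P : MarkovSemigroup Ω) (μ : Measure Ω) {d : ℕ}
    (f : Ω → Matrix (Fin d) (Fin d) ℂ) (β : ℝ) : ℝ :=
  Real.log (∫ z, reTrace (NormedSpace.exp (β • P.gamma f f z)) ∂μ) - Real.log d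

namespace suitableFun

variable {d : ℕ} {c : ℝ} (hA : P.IsSuitableAlgebra μ A) (hrev : P.IsReversible μ)
  (herg : P.IsErgodic μ) (hBE : BakryEmery P μ A d c) (hc : 0 < c)
  {F : suitableFun A (Matrix (Fin d) (Fin d) ℂ)} (hF : IsSuitable A F.1)
  (h0 : ∫ z, F.1 z ∂μ = 0) (k : ℝ) {θ : ℝ}
include hA hrev herg hBE hc hF h0

lemma truncMGFDeriv_le_of_ae_le [IsFiniteMeasure μ] (hθ : 0 ≤ θ) {g h : Ω → ℝ}
    (hg : Integrable g μ) (hh : Integrable h μ)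
    (hle : ∀ᵐ z ∂μ, ∀ y,
      reTrace (P.gamma F.1 F.1 z * cfc (truncExp k θ) (F.1 y)) ≤ g z + h y) :
    truncMGFDeriv μ F.1 k θ ≤ c * (θ * (∫ z, g z ∂μ + ∫ z, h z ∂μ)) := by
  have hsm := stronglyMeasurable hA F
  refine (truncMGFDeriv_le hF.isHermitian hsm k hθ (integrable hA F)).trans
    (integral_reTrace_mul_cfc_truncExp_le hA hrev hBE hc hF k hθ (fun t => ?_) herg h0)
  exact (isPosWeight_truncExp hsm hF.isHermitian k hθ).toIsBoundedMeasurable.integral_mul_act_le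
    reTrace hrev.isStationary t (integrable hA (gamma hA F F)) hg hh hle

lemma truncMGF_le_of_norm_gamma_le [IsProbabilityMeasure μ] (hθ : 0 ≤ θ) {v : ℝ}
    (hv : ∀ᵐ z ∂μ, ‖P.gamma F.1 F.1 z‖ ≤ v) :
    truncMGF μ F.1 k θ ≤ d * Real.exp (c * v / 2 * θ ^ 2) := by
  have hH := hF.isHermitian
  have hsm := stronglyMeasurable hA F
  have hODE := le_mul_exp_of_hasDerivAt (κ := c * v / 2) hθ (continuousOn_truncMGF hH hsm k)
    (fun x hx => hasDerivAt_truncMGF hH hsm k (integrable hA F) hx.1) fun x hx => ?_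
  · simpa [truncMGF_zero hH] using hODE
  have hint := integrable_reTrace_cfc_truncExp (μ := μ) hH hsm k hx.1.le
  refine (truncMGFDeriv_le_of_ae_le hA hrev herg hBE hc hF h0 k hx.1.le (integrable_zero _ _ _)
    (hint.const_mul v) ?_).trans_eq ?_
  · filter_upwards [hv] with z hz y
    rw [Pi.zero_apply, zero_add]
    have hΓ := (posSemidef_gamma hA hH z).isHermitian
    exact reTrace_mul_cfc_le hΓ (hH y)
      (fun i => (le_abs_self _).trans ((abs_eigenvalues_le hΓ i).trans hz)) (truncExp_nonneg k x)
  · rw [integral_zero', integral_const_mul, ← truncMGF]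
    ring

section ExponentialMean

variable {β : ℝ} (hβ : 0 < β)
  (hint : Integrable (fun z => reTrace (NormedSpace.exp (β • P.gamma F.1 F.1 z))) μ)
include hβ hint

lemma truncMGFDeriv_le_of_integrable_exp_gamma [IsFiniteMeasure μ] (hθ : 0 ≤ θ) (b : ℝ) :
    truncMGFDeriv μ F.1 k θ ≤ c / β * θ * (θ * truncMGFDeriv μ F.1 k θ
      - (b + 1) * truncMGF μ F.1 k θ
      + Real.exp b * ∫ z, reTrace (NormedSpace.exp (β • P.gamma F.1 F.1 z)) ∂μ) := by
  have hH := hF.isHermitian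
  have hsm := stronglyMeasurable hA F
  have i1 := (integrable_reTrace_cfc_min_mul_truncExp hH hsm k hθ (integrable hA F)).const_mul θ
  have i2 := (integrable_reTrace_cfc_truncExp (μ := μ) hH hsm k hθ).const_mul (b + 1)
  refine (truncMGFDeriv_le_of_ae_le hA hrev herg hBE hc hF h0 k hθ
    ((hint.const_mul (Real.exp b)).const_mul β⁻¹) ((i1.sub i2).const_mul β⁻¹)
    (ae_of_all _ fun z y => ?_)).trans_eq ?_
  · have hyoung := mul_reTrace_mul_cfc_truncExp_le (posSemidef_gamma hA hH z).isHermitian (hH y)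
      k θ b β
    rw [← mul_add, ← div_eq_inv_mul, le_div_iff₀' hβ, add_comm]
    exact hyoung
  · rw [integral_const_mul, integral_const_mul, integral_const_mul]
    simp only [Pi.sub_apply]
    rw [integral_sub i1 i2, integral_const_mul, integral_const_mul, ← truncMGF, ← truncMGFDeriv]
    ring

lemma log_truncMGF_le [IsProbabilityMeasure μ] [NeZero d] (hθ : 0 ≤ θ) (hκθ : c / β * θ ^ 2 < 1) :
    Real.log (truncMGF μ F.1 k θ) - Real.log d
      ≤ logExpMean P μ F.1 β * (1 - √(1 - c / β * θ ^ 2)) := by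
  rw [logExpMean]
  have hH := hF.isHermitian
  have hsm := stronglyMeasurable hA F
  have hpos {x : ℝ} (hx : 0 ≤ x) : 0 < truncMGF μ F.1 k x := truncMGF_pos hH hsm k hx
  set W := ∫ z, reTrace (NormedSpace.exp (β • P.gamma F.1 F.1 z)) ∂μ with hW
  have hWpos : 0 < W := integral_reTrace_exp_gamma_pos hA hH hβ.le hint
  refine le_mul_one_sub_sqrt_of_hasDerivAt
    (L := fun x => Real.log (truncMGF μ F.1 k x) - Real.log d)
    (L' := fun x => truncMGFDeriv μ F.1 k x / truncMGF μ F.1 k x) (div_pos hc hβ).le hθ hκθ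
    (((continuousOn_truncMGF hH hsm k).log fun x hx => (hpos hx.1).ne').sub continuousOn_const)
    (fun x hx => ((hasDerivAt_truncMGF hH hsm k (integrable hA F) hx.1).log
      (hpos hx.1.le).ne').sub_const _) (fun x hx => ?_) (by simp [truncMGF_zero hH])
  have hm := hpos hx.1.le
  have hb : Real.exp (Real.log (truncMGF μ F.1 k x) - Real.log W) * W = truncMGF μ F.1 k x := by
    rw [Real.exp_sub, Real.exp_log hm, Real.exp_log hWpos, div_mul_cancel₀ _ hWpos.ne']
  have h := truncMGFDeriv_le_of_integrable_exp_gamma hA hrev herg hBE hc hF h0 k hβ hint hx.1.le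
    (Real.log (truncMGF μ F.1 k x) - Real.log W)
  rw [← hW, hb] at h
  rw [div_le_iff₀ hm]
  refine h.trans_eq ?_
  field_simp
  ring

end ExponentialMean

end suitableFun

end LaplaceBounds

section Tails

variable {Ω : Type*} [MeasurableSpace Ω] {μ : Measure Ω}

lemma tendsto_integral_min_natCast [IsFiniteMeasure μ] {g : Ω → ℝ} (hg : Integrable g μ) :
    Tendsto (fun k : ℕ => ∫ z, min (g z) k ∂μ) atTop (𝓝 (∫ z, g z ∂μ)) := by
  refine tendsto_integral_of_dominated_convergence (fun z => |g z|)
    (fun k => (hg.inf (integrable_const (k : ℝ))).aestronglyMeasurable) hg.abs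
    (fun k => ae_of_all _ fun z => ?_) (ae_of_all _ fun z => ?_)
  · rw [Real.norm_eq_abs, abs_le]
    exact ⟨le_min (neg_abs_le _) ((neg_nonpos.2 (abs_nonneg _)).trans (Nat.cast_nonneg k)),
      (min_le_left _ _).trans (le_abs_self _)⟩
  · refine tendsto_const_nhds.congr' ?_
    filter_upwards [eventually_ge_atTop ⌈g z⌉₊] with k hk
    exact (min_eq_left ((Nat.le_ceil _).trans (Nat.cast_le.2 hk))).symm

section LambdaMax

variable {d : ℕ} [NeZero d] {F : Ω → Matrix (Fin d) (Fin d) ℂ} (hH : ∀ z, (F z).IsHermitian)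
include hH

lemma integrable_lambdaMax (hint : Integrable F μ) (hF : StronglyMeasurable F) :
    Integrable (fun z => lambdaMax (F z)) μ :=
  hint.norm.mono' (measurable_lambdaMax hF hH).aestronglyMeasurable
    (ae_of_all _ fun z => abs_lambdaMax_le (hH z))

variable (hF : StronglyMeasurable F) {θ : ℝ} (hθ : 0 ≤ θ)
include hF hθ

lemma measure_le_lambdaMax_le [IsFiniteMeasure μ] (t : ℝ) :
    μ {z | t ≤ lambdaMax (F z)} ≤ ENNReal.ofReal (Real.exp (-(θ * t)) * truncMGF μ F t θ) := by
  have hlevel : {z | t ≤ lambdaMax (F z)}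
      ⊆ {z | Real.exp (θ * t) ≤ reTrace (cfc (truncExp t θ) (F z))} := fun z hz => by
    have h := apply_lambdaMax_le_reTrace_cfc (hH z) (truncExp_nonneg t θ)
    rwa [truncExp, min_eq_right hz] at h
  have hmarkov := mul_meas_ge_le_integral_of_nonneg (μ := μ) (ae_of_all _ fun z =>
    (truncExp_nonneg t θ _).trans (apply_lambdaMax_le_reTrace_cfc (hH z) (truncExp_nonneg t θ)))
    (integrable_reTrace_cfc_truncExp hH hF t hθ) (Real.exp (θ * t))
  rw [← ofReal_measureReal]
  refine ENNReal.ofReal_le_ofReal ((measureReal_mono hlevel).trans ?_)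
  rwa [Real.exp_neg, inv_mul_eq_div, le_div_iff₀' (Real.exp_pos _)]

variable [IsProbabilityMeasure μ] (hint : Integrable F μ)
include hint

lemma exp_mul_integral_min_lambdaMax_le (k : ℝ) :
    Real.exp (θ * ∫ z, min (lambdaMax (F z)) k ∂μ) ≤ truncMGF μ F k θ := by
  have hmin : Integrable (fun z => θ * min (lambdaMax (F z)) k) μ :=
    ((integrable_lambdaMax hH hint hF).inf (integrable_const k)).const_mul θ
  have htrace (z : Ω) : Real.exp (θ * min (lambdaMax (F z)) k)
      ≤ reTrace (cfc (truncExp k θ) (F z)) :=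
    apply_lambdaMax_le_reTrace_cfc (hH z) (truncExp_nonneg k θ)
  have hexp : Integrable (fun z => Real.exp (θ * min (lambdaMax (F z)) k)) μ :=
    (integrable_reTrace_cfc_truncExp hH hF k hθ).mono'
      (Real.continuous_exp.comp_aestronglyMeasurable hmin.aestronglyMeasurable)
      (ae_of_all _ fun z => by simpa using htrace z)
  rw [← integral_const_mul]
  exact (convexOn_exp.map_integral_le Real.continuous_exp.continuousOn isClosed_univ
    (ae_of_all _ fun _ => Set.mem_univ _) hmin hexp).trans
    (integral_mono hexp (integrable_reTrace_cfc_truncExp hH hF k hθ) htrace)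

lemma exp_mul_integral_lambdaMax_le {C : ℝ} (hC : ∀ k, truncMGF μ F k θ ≤ C) :
    Real.exp (θ * ∫ z, lambdaMax (F z) ∂μ) ≤ C :=
  le_of_tendsto' ((Real.continuous_exp.tendsto _).comp
    ((tendsto_integral_min_natCast (integrable_lambdaMax hH hint hF)).const_mul θ))
    fun k => (exp_mul_integral_min_lambdaMax_le hH hF hθ hint k).trans (hC k)

end LambdaMax

variable {P : MarkovSemigroup Ω} {A : Subalgebra ℝ (Ω → ℝ)} {d : ℕ}

lemma le_natCast_mul_exp_zero [IsProbabilityMeasure μ] [NeZero d] (s : Set Ω) :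
    μ s ≤ d * EReal.exp 0 := by
  rw [EReal.exp_zero, mul_one]
  exact prob_le_one.trans (Nat.one_le_cast.2 NeZero.one_le)

section Interface

variable {f : Ω → Matrix (Fin d) (Fin d) ℂ}

lemma le_expTail_iff [NeZero d] {c t : ℝ} {x : ℝ≥0∞} :
    x ≤ expTail P μ f c t ↔ ∀ β : ℝ, 0 < β → x ≤ d * EReal.exp (((-t ^ 2 : ℝ) : EReal) /
      (((2 * c : ℝ) : EReal) * expMean P μ f β + ((2 * t * √(c / β) : ℝ) : EReal))) := by
  have hd : (d : ℝ≥0∞) ≠ 0 := Nat.cast_ne_zero.2 (NeZero.ne d)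
  simp only [expTail, ENNReal.mul_iInf_of_ne hd (ENNReal.natCast_ne_top d), le_iInf_iff]

lemma ae_norm_gamma_le (hv : varProxy P μ f < ∞) :
    ∀ᵐ z ∂μ, ‖P.gamma f f z‖ ≤ (varProxy P μ f).toReal := by
  filter_upwards [ae_le_eLpNormEssSup (f := P.gamma f f) (μ := μ)] with z hz
  rw [varProxy, eLpNorm_exponent_top] at hv ⊢
  simpa using ENNReal.toReal_mono hv.ne hz

lemma gaussTail_of_varProxy_pos {c t : ℝ} (hc : 0 < c) (h0 : varProxy P μ f ≠ 0)
    (hv : varProxy P μ f < ∞) :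
    gaussTail P μ f c t
      = d * ENNReal.ofReal (Real.exp (-t ^ 2 / (2 * c * (varProxy P μ f).toReal))) := by
  have hpos : 0 < 2 * c * (varProxy P μ f).toReal :=
    mul_pos (by positivity) (ENNReal.toReal_pos h0 hv.ne)
  have hdiv : ENNReal.ofReal (t ^ 2) / (ENNReal.ofReal (2 * c) * varProxy P μ f)
      = ENNReal.ofReal (t ^ 2 / (2 * c * (varProxy P μ f).toReal)) := by
    rw [ENNReal.ofReal_div_of_pos hpos, ENNReal.ofReal_mul (p := 2 * c) (by positivity),
      ENNReal.ofReal_toReal hv.ne]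
  rw [gaussTail, hdiv, EReal.coe_ennreal_ofReal, max_eq_left (by positivity), ← EReal.coe_neg,
    EReal.exp_coe, neg_div]

end Interface

namespace suitableFun

variable (hA : P.IsSuitableAlgebra μ A) {F : suitableFun A (Matrix (Fin d) (Fin d) ℂ)}

section ExpMean

variable (hF : ∀ z, (F.1 z).IsHermitian) {β : ℝ}
include hA hF

lemma lintegral_normTrace_exp_gamma :
    ∫⁻ z, ENNReal.ofReal (normTrace (NormedSpace.exp (β • P.gamma F.1 F.1 z))) ∂μ
      = ENNReal.ofReal (d : ℝ)⁻¹
        * ∫⁻ z, ENNReal.ofReal (reTrace (NormedSpace.exp (β • P.gamma F.1 F.1 z))) ∂μ := by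
  rw [← lintegral_const_mul _
    (stronglyMeasurable_reTrace_exp_gamma hA hF β).measurable.ennreal_ofReal]
  exact lintegral_congr fun z => ENNReal.ofReal_mul (by positivity)

variable (hβ : 0 < β)
include hβ

section Integrable

variable [IsProbabilityMeasure μ] [NeZero d]
  (hint : Integrable (fun z => reTrace (NormedSpace.exp (β • P.gamma F.1 F.1 z))) μ)
include hint

lemma expMean_of_integrable : expMean P μ F.1 β = (β⁻¹ * logExpMean P μ F.1 β : ℝ) := by
  have hd : (0 : ℝ) < d := Nat.cast_pos.2 (NeZero.pos d)
  have hW := integral_reTrace_exp_gamma_pos hA hF hβ.le hint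
  rw [expMean, lintegral_normTrace_exp_gamma hA hF, ← ofReal_integral_eq_lintegral_ofReal hint
    (ae_of_all _ fun z => (Nat.cast_nonneg _).trans (card_le_reTrace_exp_gamma hA hF hβ.le z)),
    ← ENNReal.ofReal_mul (by positivity), ENNReal.log_ofReal_of_pos (by positivity),
    inv_mul_eq_div, Real.log_div hW.ne' hd.ne', EReal.coe_mul, logExpMean]

lemma logExpMean_nonneg : 0 ≤ logExpMean P μ F.1 β :=
  sub_nonneg.2 (Real.log_le_log (Nat.cast_pos.2 (NeZero.pos d))
    (by simpa using card_le_integral_reTrace_exp_gamma hA hF hβ.le hint))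

end Integrable

lemma expMean_of_not_integrable [NeZero d]
    (hint : ¬Integrable (fun z => reTrace (NormedSpace.exp (β • P.gamma F.1 F.1 z))) μ) :
    expMean P μ F.1 β = ⊤ := by
  have hd : (0 : ℝ) < d := Nat.cast_pos.2 (NeZero.pos d)
  have htop : ∫⁻ z, ENNReal.ofReal (reTrace (NormedSpace.exp (β • P.gamma F.1 F.1 z))) ∂μ = ∞ := by
    by_contra hne
    exact hint ⟨(stronglyMeasurable_reTrace_exp_gamma hA hF β).aestronglyMeasurable,
      (hasFiniteIntegral_iff_ofReal (ae_of_all _ fun z => (Nat.cast_nonneg _).trans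
        (card_le_reTrace_exp_gamma hA hF hβ.le z))).2 (lt_top_iff_ne_top.2 hne)⟩
  rw [expMean, lintegral_normTrace_exp_gamma hA hF, htop,
    ENNReal.mul_top (ENNReal.ofReal_pos.2 (inv_pos.2 hd)).ne', ENNReal.log_top,
    EReal.coe_mul_top_of_pos (inv_pos.2 hβ)]

end ExpMean

variable [IsProbabilityMeasure μ] [NeZero d] {c : ℝ} (hrev : P.IsReversible μ)
  (herg : P.IsErgodic μ) (hBE : BakryEmery P μ A d c) (hc : 0 < c) (hF : IsSuitable A F.1)
  (h0 : ∫ z, F.1 z ∂μ = 0)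
include hA hrev herg hBE hc hF h0

lemma truncMGF_le_of_integrable_exp_gamma (k : ℝ) {β θ : ℝ} (hβ : 0 < β)
    (hint : Integrable (fun z => reTrace (NormedSpace.exp (β • P.gamma F.1 F.1 z))) μ)
    (hθ : 0 ≤ θ) (hθ1 : √(c / β) * θ < 1) :
    truncMGF μ F.1 k θ ≤ d * Real.exp (c * (β⁻¹ * logExpMean P μ F.1 β) * θ ^ 2
      / (2 * (1 - √(c / β) * θ))) := by
  have hd : (0 : ℝ) < d := Nat.cast_pos.2 (NeZero.pos d)
  have hlog := logExpMean_nonneg hA hF.isHermitian hβ hint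
  have hsq : (√(c / β) * θ) ^ 2 = c / β * θ ^ 2 := by
    rw [mul_pow, Real.sq_sqrt (div_pos hc hβ).le]
  have hs : 0 ≤ √(c / β) * θ := by positivity
  have h := log_truncMGF_le hA hrev herg hBE hc hF h0 k hβ hint hθ
    (hsq ▸ (sq_lt_one_iff₀ hs).2 hθ1)
  rw [← hsq] at h
  have hm := truncMGF_pos (μ := μ) hF.isHermitian (stronglyMeasurable hA F) k hθ
  rw [← Real.log_le_log_iff hm (by positivity), Real.log_mul hd.ne' (Real.exp_ne_zero _),
    Real.log_exp, ← sub_le_iff_le_add']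
  refine h.trans ((mul_le_mul_of_nonneg_left (one_sub_sqrt_one_sub_sq_le hs hθ1) hlog).trans_eq ?_)
  rw [hsq]
  ring

lemma measure_le_lambdaMax_le_of_integrable_exp_gamma {β t : ℝ} (hβ : 0 < β) (ht : 0 < t)
    (hint : Integrable (fun z => reTrace (NormedSpace.exp (β • P.gamma F.1 F.1 z))) μ) :
    μ {z | t ≤ lambdaMax (F.1 z)} ≤ d * ENNReal.ofReal (Real.exp
      (-t ^ 2 / (2 * (c * (β⁻¹ * logExpMean P μ F.1 β)) + 2 * t * √(c / β)))) := by
  have hd : (0 : ℝ) < d := Nat.cast_pos.2 (NeZero.pos d)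
  have hlog := logExpMean_nonneg hA hF.isHermitian hβ hint
  obtain ⟨θ, hθ, hθ1, hb⟩ := exists_bernstein_parameter
    (a := c * (β⁻¹ * logExpMean P μ F.1 β)) (by positivity)
    (Real.sqrt_pos.2 (div_pos hc hβ)) ht
  rw [← ENNReal.ofReal_natCast, ← ENNReal.ofReal_mul hd.le]
  refine (measure_le_lambdaMax_le hF.isHermitian (stronglyMeasurable hA F) hθ t).trans
    (ENNReal.ofReal_le_ofReal ?_)
  calc Real.exp (-(θ * t)) * truncMGF μ F.1 t θ
      ≤ Real.exp (-(θ * t)) * (d * Real.exp (c * (β⁻¹ * logExpMean P μ F.1 β) * θ ^ 2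
        / (2 * (1 - √(c / β) * θ)))) := by
        gcongr
        exact truncMGF_le_of_integrable_exp_gamma hA hrev herg hBE hc hF h0 t hβ hint hθ hθ1
    _ = d * Real.exp (-(θ * t) + c * (β⁻¹ * logExpMean P μ F.1 β) * θ ^ 2
        / (2 * (1 - √(c / β) * θ))) := by rw [Real.exp_add]; ring
    _ ≤ _ := by gcongr

lemma measure_le_lambdaMax_le_expTail {t : ℝ} (ht : 0 ≤ t) :
    μ {z | t ≤ lambdaMax (F.1 z)} ≤ expTail P μ F.1 c t := by
  refine le_expTail_iff.2 fun β hβ => ?_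
  rcases ht.eq_or_lt with rfl | ht
  · simpa using le_natCast_mul_exp_zero (μ := μ) (d := d) {z | 0 ≤ lambdaMax (F.1 z)}
  by_cases hint : Integrable (fun z => reTrace (NormedSpace.exp (β • P.gamma F.1 F.1 z))) μ
  · rw [expMean_of_integrable hA hF.isHermitian hβ hint, ← EReal.coe_mul, ← EReal.coe_add,
      ← EReal.coe_div, EReal.exp_coe, mul_assoc 2 c]
    exact measure_le_lambdaMax_le_of_integrable_exp_gamma hA hrev herg hBE hc hF h0 hβ ht hint
  · rw [expMean_of_not_integrable hA hF.isHermitian hβ hint,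
      EReal.coe_mul_top_of_pos (by positivity), EReal.top_add_coe, EReal.div_top]
    exact le_natCast_mul_exp_zero _

section BoundedGamma

variable (hv : varProxy P μ F.1 < ∞)
include hv

lemma measure_le_lambdaMax_le_of_varProxy_lt_top {θ : ℝ} (hθ : 0 ≤ θ) (t : ℝ) :
    μ {z | t ≤ lambdaMax (F.1 z)} ≤ d * ENNReal.ofReal
      (Real.exp (-(θ * t) + c * (varProxy P μ F.1).toReal / 2 * θ ^ 2)) := by
  rw [← ENNReal.ofReal_natCast, ← ENNReal.ofReal_mul (Nat.cast_nonneg d)]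
  refine (measure_le_lambdaMax_le hF.isHermitian (stronglyMeasurable hA F) hθ t).trans
    (ENNReal.ofReal_le_ofReal ?_)
  rw [Real.exp_add, mul_left_comm]
  gcongr
  exact truncMGF_le_of_norm_gamma_le hA hrev herg hBE hc hF h0 t hθ (ae_norm_gamma_le hv)

lemma measure_le_lambdaMax_le_gaussTail {t : ℝ} (ht : 0 ≤ t) :
    μ {z | t ≤ lambdaMax (F.1 z)} ≤ gaussTail P μ F.1 c t := by
  have hθ {θ : ℝ} (hθ : 0 ≤ θ) := measure_le_lambdaMax_le_of_varProxy_lt_top hA hrev herg hBE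
    hc hF h0 hv hθ t
  rcases ht.eq_or_lt with rfl | ht
  · simpa [gaussTail] using le_natCast_mul_exp_zero (μ := μ) (d := d) {z | 0 ≤ lambdaMax (F.1 z)}
  rcases eq_or_ne (varProxy P μ F.1) 0 with hv0 | hv0
  · have hlim : Tendsto (fun θ : ℝ => (d : ℝ≥0∞) * ENNReal.ofReal (Real.exp (-(θ * t)))) atTop
        (𝓝 (d * ENNReal.ofReal 0)) :=
      ENNReal.Tendsto.const_mul (ENNReal.tendsto_ofReal (Real.tendsto_exp_neg_atTop_nhds_zero.comp
        (tendsto_id.atTop_mul_const ht))) (Or.inr (ENNReal.natCast_ne_top d))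
    rw [ENNReal.ofReal_zero, mul_zero] at hlim
    refine le_trans (ge_of_tendsto hlim ?_) zero_le
    filter_upwards [eventually_ge_atTop 0] with θ hθ0
    simpa [hv0] using hθ hθ0
  · have hpos := ENNReal.toReal_pos hv0 hv.ne
    rw [gaussTail_of_varProxy_pos hc hv0 hv]
    convert hθ (θ := t / (c * (varProxy P μ F.1).toReal)) (by positivity) using 4
    field_simp
    ring

lemma integral_lambdaMax_le :
    ∫ z, lambdaMax (F.1 z) ∂μ ≤ √(2 * c * (varProxy P μ F.1).toReal * Real.log d) := by
  have hd : (0 : ℝ) < d := Nat.cast_pos.2 (NeZero.pos d)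
  rw [mul_assoc 2 c]
  refine le_sqrt_of_forall_mul_le (by positivity) (Real.log_natCast_nonneg d) fun θ hθ => ?_
  have h := exp_mul_integral_lambdaMax_le hF.isHermitian (stronglyMeasurable hA F) hθ.le
    (integrable hA F) fun k =>
      truncMGF_le_of_norm_gamma_le hA hrev herg hBE hc hF h0 k hθ.le (ae_norm_gamma_le hv)
  rwa [← Real.exp_log hd, ← Real.exp_add, Real.exp_le_exp] at h

end BoundedGamma

end suitableFun

end Tails

section Centered

variable {Ω : Type*} [MeasurableSpace Ω] {μ : Measure Ω} {P : MarkovSemigroup Ω}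
  {A : Subalgebra ℝ (Ω → ℝ)} {d : ℕ} {f : Ω → Matrix (Fin d) (Fin d) ℂ}

lemma IsSuitable.centered (hf : IsSuitable A f) : IsSuitable A (centered μ f) :=
  isSuitable_iff.2 ⟨fun z => (hf.isHermitian z).sub (isHermitian_integral hf.isHermitian),
    sub_mem (isSuitable_iff.1 hf).2 (suitableFun.const_mem _)⟩

lemma lambdaMin_centered (z : Ω) :
    lambdaMin (centered μ f z) = -lambdaMax (centered μ (-f) z) := by
  rw [lambdaMin_eq_neg_lambdaMax_neg, centered, centered]
  simp only [Pi.neg_apply, integral_neg, neg_sub, sub_neg_eq_add, neg_add_eq_sub]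

section GammaCongr

variable {g : Ω → Matrix (Fin d) (Fin d) ℂ} (h : P.gamma f f = P.gamma g g)
include h

lemma expTail_congr_gamma (c t : ℝ) : expTail P μ f c t = expTail P μ g c t := by
  simp only [expTail, expMean, h]

lemma varProxy_congr_gamma : varProxy P μ f = varProxy P μ g := by
  simp only [varProxy, h]

lemma gaussTail_congr_gamma (c t : ℝ) : gaussTail P μ f c t = gaussTail P μ g c t := by
  simp only [gaussTail, varProxy_congr_gamma h]

end GammaCongr

section Bounds

variable (hA : P.IsSuitableAlgebra μ A) (hf : IsSuitable A f)
include hA hf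

lemma gamma_neg : P.gamma (-f) (-f) = P.gamma f f :=
  suitableFun.gamma_neg hA ⟨f, (isSuitable_iff.1 hf).2⟩

lemma gamma_centered : P.gamma (centered μ f) (centered μ f) = P.gamma f f :=
  suitableFun.gamma_sub_const hA ⟨f, (isSuitable_iff.1 hf).2⟩ _

lemma integrable_lambdaMax_centered [NeZero d] :
    Integrable (fun z => lambdaMax (centered μ f z)) μ :=
  have hcf := isSuitable_iff.1 (hf.centered (μ := μ))
  integrable_lambdaMax hcf.1 (suitableFun.integrable hA ⟨_, hcf.2⟩)
    (suitableFun.stronglyMeasurable hA ⟨_, hcf.2⟩)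

variable [IsProbabilityMeasure μ]

lemma integral_centered : ∫ z, centered μ f z ∂μ = 0 := by
  unfold centered
  rw [integral_sub (suitableFun.integrable hA ⟨f, (isSuitable_iff.1 hf).2⟩) (integrable_const _)]
  simp

variable [NeZero d]

variable {c : ℝ} (hrev : P.IsReversible μ) (herg : P.IsErgodic μ) (hBE : BakryEmery P μ A d c)
  (hc : 0 < c)
include hrev herg hBE hc

lemma measure_le_lambdaMax_centered_le_expTail {t : ℝ} (ht : 0 ≤ t) :
    μ {z | t ≤ lambdaMax (centered μ f z)} ≤ expTail P μ f c t := by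
  have hcf := hf.centered (μ := μ)
  rw [← expTail_congr_gamma (gamma_centered hA hf)]
  exact suitableFun.measure_le_lambdaMax_le_expTail hA (F := ⟨_, (isSuitable_iff.1 hcf).2⟩)
    hrev herg hBE hc hcf (integral_centered hA hf) ht

variable (hv : varProxy P μ f < ∞)
include hv

lemma measure_le_lambdaMax_centered_le_gaussTail {t : ℝ} (ht : 0 ≤ t) :
    μ {z | t ≤ lambdaMax (centered μ f z)} ≤ gaussTail P μ f c t := by
  have hcf := hf.centered (μ := μ)
  rw [← varProxy_congr_gamma (gamma_centered hA hf)] at hv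
  rw [← gaussTail_congr_gamma (gamma_centered hA hf)]
  exact suitableFun.measure_le_lambdaMax_le_gaussTail hA (F := ⟨_, (isSuitable_iff.1 hcf).2⟩)
    hrev herg hBE hc hcf (integral_centered hA hf) hv ht

lemma integral_lambdaMax_centered_le : ∫ z, lambdaMax (centered μ f z) ∂μ
    ≤ √(2 * c * (varProxy P μ f).toReal * Real.log d) := by
  have hcf := hf.centered (μ := μ)
  rw [← varProxy_congr_gamma (gamma_centered hA hf)] at hv ⊢
  exact suitableFun.integral_lambdaMax_le hA (F := ⟨_, (isSuitable_iff.1 hcf).2⟩)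
    hrev herg hBE hc hcf (integral_centered hA hf) hv

end Bounds

end Centered

end MatrixMarkov

end

theorem theorem3p4_general {Ω : Type*} [MeasurableSpace Ω] (μ : Measure Ω)
    [IsProbabilityMeasure μ] (P : MarkovSemigroup Ω) (hrev : P.IsReversible μ)
    (herg : P.IsErgodic μ)
    (A : Subalgebra ℝ (Ω → ℝ)) (hA : P.IsSuitableAlgebra μ A)
    (d : ℕ) (hd : 0 < d) (c : ℝ) (hc : 0 < c) (hBE : BakryEmery P μ A d c)
    (f : Ω → Matrix (Fin d) (Fin d) ℂ) (hf : IsSuitable A f) :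
    (∀ t : ℝ, 0 ≤ t →
      μ {z | t ≤ lambdaMax (centered μ f z)}
          ≤ expTail P μ f c t ∧
      μ {z | lambdaMin (centered μ f z) ≤ -t}
          ≤ expTail P μ f c t) ∧
    (varProxy P μ f < ∞ →
      (∀ t : ℝ, 0 ≤ t →
        μ {z | t ≤ lambdaMax (centered μ f z)}
            ≤ gaussTail P μ f c t ∧
        μ {z | lambdaMin (centered μ f z) ≤ -t}
            ≤ gaussTail P μ f c t) ∧
      Integrable (fun z => lambdaMax (centered μ f z)) μ ∧
      Integrable (fun z => lambdaMin (centered μ f z)) μ ∧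
      ∫ z, lambdaMax (centered μ f z) ∂μ
          ≤ √(2 * c * (varProxy P μ f).toReal * Real.log d) ∧
      -√(2 * c * (varProxy P μ f).toReal * Real.log d)
          ≤ ∫ z, lambdaMin (centered μ f z) ∂μ) := by
  have : NeZero d := ⟨hd.ne'⟩
  have hΓ := gamma_neg hA hf
  have hexp (t : ℝ) := expTail_congr_gamma (μ := μ) hΓ c t
  have hgauss (t : ℝ) := gaussTail_congr_gamma (μ := μ) hΓ c t
  have hvar := varProxy_congr_gamma (μ := μ) hΓ
  simp only [lambdaMin_centered, neg_le_neg_iff, integral_neg]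
  refine ⟨fun t ht => ⟨measure_le_lambdaMax_centered_le_expTail hA hf hrev herg hBE hc ht, ?_⟩,
    fun hv => ⟨fun t ht =>
      ⟨measure_le_lambdaMax_centered_le_gaussTail hA hf hrev herg hBE hc hv ht, ?_⟩,
    integrable_lambdaMax_centered hA hf, (integrable_lambdaMax_centered hA hf.neg).neg,
    integral_lambdaMax_centered_le hA hf hrev herg hBE hc hv, ?_⟩⟩
  · rw [← hexp]
    exact measure_le_lambdaMax_centered_le_expTail hA hf.neg hrev herg hBE hc ht
  · rw [← hgauss]
    exact measure_le_lambdaMax_centered_le_gaussTail hA hf.neg hrev herg hBE hc (hvar.trans_lt hv)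
      ht
  · rw [← hvar]
    exact integral_lambdaMax_centered_le hA hf.neg hrev herg hBE hc (hvar.trans_lt hv)

theorem theorem3p4 {Ω : Type*} [TopologicalSpace Ω] [PolishSpace Ω] [MeasurableSpace Ω]
    [BorelSpace Ω] (μ : Measure Ω) [IsProbabilityMeasure μ]
    (P : MarkovSemigroup Ω) (hstat : P.IsStationary μ) (hrev : P.IsReversible μ)
    (herg : P.IsErgodic μ)
    (A : Subalgebra ℝ (Ω → ℝ)) (hA : P.IsSuitableAlgebra μ A)
    (d : ℕ) (hd : 0 < d) (c : ℝ) (hc : 0 < c) (hBE : BakryEmery P μ A d c)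
    (f : Ω → Matrix (Fin d) (Fin d) ℂ) (hf : IsSuitable A f) :
    (∀ t : ℝ, 0 ≤ t →
      μ {z | t ≤ lambdaMax (centered μ f z)}
          ≤ expTail P μ f c t ∧
      μ {z | lambdaMin (centered μ f z) ≤ -t}
          ≤ expTail P μ f c t) ∧
    (varProxy P μ f < ∞ →
      (∀ t : ℝ, 0 ≤ t →
        μ {z | t ≤ lambdaMax (centered μ f z)}
            ≤ gaussTail P μ f c t ∧
        μ {z | lambdaMin (centered μ f z) ≤ -t}
            ≤ gaussTail P μ f c t) ∧
      Integrable (fun z => lambdaMax (centered μ f z)) μ ∧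
      Integrable (fun z => lambdaMin (centered μ f z)) μ ∧
      ∫ z, lambdaMax (centered μ f z) ∂μ
          ≤ √(2 * c * (varProxy P μ f).toReal * Real.log d) ∧
      -√(2 * c * (varProxy P μ f).toReal * Real.log d)
          ≤ ∫ z, lambdaMin (centered μ f z) ∂μ) := by
  exact theorem3p4_general μ P hrev herg A hA d hd c hc hBE f hf
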